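/- Let $\mathcal I$ be an incidence structure of (finite) points and lines. \textbf{Notions.} Two lines \emph{meet} if they are distinct and share a finite point. For distinct collinear points $A,B,C$, the point $B$ is \emph{between} $A$ and $C$ if every line through $B$ meets at least one line of each pair of intersecting lines through $A$ and $C$, respectively. The (closed) segment $\overline{RS}$ consists of $R$, $S$ and the points between them; the ray from $R$ through $A\neq R$ consists of $R$, $A$, the points between $R$ and $A$, and the points $X$ such that $A$ is between $R$ and $X$. Rays $r,s$ with endpoints $R,S$ are \emph{parallel} if they are not contained in a common line and every line meeting one of them meets the other or $\overline{RS}$. Two lines, or a ray and a line, are parallel if they contain parallel rays. A \emph{rimpoint} $(a,b)$ is given by two parallel lines $a,b$ for which there are a line parallel to both and a line meeting all three; it is \emph{incident} with $a$, with $b$, and with every line $m$ parallel to both $a$ and $b$ such that some line meets $a$, $b$ and $m$. Two rimpoints are equal if they are incident with the same lines. Let $\mathcal O$ be the set of rimpoints. $XY$ denotes the line joining $X$ and $Y$ (each finite or a rimpoint). For a finite point $A$ and $X\in\mathcal O$, $X^A$ is the other rimpoint on $XA$, and $X^{AB}=(X^A)^B$. \textbf{Axioms.} (A1) Any two distinct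 points are incident with a unique line. (A2) Each line is on at least one point. (A3) There exist three non-collinear points, and three (distinct) collinear points. (A4) Of three distinct collinear points, at least one has the property that every line through it meets at least one of each pair of intersecting lines through the other two. (A5) If $P$ is not on $\ell$, there are two distinct lines on $P$ not meeting $\ell$ such that each line meeting $\ell$ meets at least one of those two lines. (A6) For any two rays not contained in a common line there is a line $m$ such that each of the two rays is parallel to $m$ or contained in $m$. (A7) If $A,B,C,D,E,F$ are distinct rimpoints such that $AB\cap DE$, $BC\cap EF$, $CD\cap FA$ exist as finite points, then these three points are collinear. (A10) Given distinct finite points $P,Q$, there exist lines $\ell$ on $P$ and $m$ on $Q$ such that two common parallels to $\ell$ and $m$ meet on $PQ$. (A11) If $X$ is a rimpoint not on a line $\ell$, there is a unique finite point $R$ on $\ell$ such that for every finite point $S\neq R$ on $\ell$, two common parallels to $\ell$ and to the line $X^{SR}X^{RS}$ meet on $XR$. \textbf{Half-turns and reflections.} The \emph{half-turn} about a finite point $A$ is the permutation $X\mapsto X^A$ of $\mathcal O$. For rimpoints, $AB/\!/CD$ means that the lines $AB$ and $CD$ meet in a finite point. A cyclic order $\mathcal C$ on $\mathcal O$ is compatible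 with $/\!/$ if $AC/\!/BD\iff(\mathcal C(A,B,C)\wedge\mathcal C(C,D,A))\vee(\mathcal C(A,D,C)\wedge\mathcal C(C,B,A))$. An \emph{order-preserving axial map} with axis $\ell$ is a nonidentity permutation $\alpha$ of $\mathcal O$ that preserves a cyclic order compatible with $/\!/$ and is such that, for all rimpoints $X,Y$, the lines $XY^\alpha$ and $YX^\alpha$ can meet in a finite point only if it is on $\ell$, and do meet in a finite point whenever $X$ and $Y$ are on opposite sides of $\ell$ (that is, $X,Y$ are not on $\ell$ and $XY$ meets $\ell$). If non-parallel lines $\ell$ and $m$ have rimpoints $L_1,L_2$ and $M_1,M_2$, labelled such that $L_1M_2$ and $L_2M_1$ meet in a finite point, this point is denoted by $\ell\bowtie m$. The \emph{reflection} $\sigma_\ell$ in a line $\ell$ is the permutation of $\mathcal O$ that fixes the rimpoints of $\ell$ and maps each rimpoint $A$ not on $\ell$ to $A^{O}$, where $O=\ell\bowtie A^{\alpha}A^{\alpha^{-1}}$ and $\alpha$ is any order-preserving axial map with axis $\ell$ (such $\alpha$ exist and the choice does not matter). An \emph{abstract oval} $(O,S)$ is a set $O$ with $|O|\ge 3$ together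 with a set $S$ of involutory permutations of $O$ (the identity being allowed) such that for all $A_1,A_2,B_1,B_2\in O$ with $\{A_1,A_2\}\cap\{B_1,B_2\}=\varnothing$ there is exactly one $s\in S$ with $A_1^s=A_2$ and $B_1^s=B_2$. For $A,B\in O$ the line $\ell_{A,B}$ is incident with $A$, $B$ and all $s\in S$ with $A^s=B$; it is \emph{secant} if $A\ne B$. It is \emph{Pascalian} if for any three $I,J,K\in S$ incident with it, $IJK$ is again an element of $S$ incident with it. \textbf{Theorem.} Suppose that $\mathcal I$ satisfies (A1)--(A7), (A10) and (A11). Then for every finite point the half-turn about it, and for every line the reflection in it, is a well-defined permutation of $\mathcal O$ (it exists and is unique), the set $T$ of all half-turns and all reflections makes $(\mathcal O,T)$ an abstract oval, and all secant lines of $(\mathcal O,T)$ are Pascalian. -/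

import Mathlib

namespace HypInc

universe u v

section Plane

variable {P : Type u} {L : Type v}

/-! Throughout, `I : P → L → Prop` is the incidence relation of an incidence structure with
(finite) points `P` and lines `L`. -/

/-- Two lines meet (intersect): they are distinct and have a common finite point. -/
def Meets (I : P → L → Prop) (a b : L) : Prop :=
  a ≠ b ∧ ∃ X, I X a ∧ I X b

/-- A set of finite points is collinear if some line contains all of it. -/
def Collin (I : P → L → Prop) (s : Set P) : Prop :=
  ∃ m, ∀ X ∈ s, I X m

/-- The point `B` has the defining property of betweenness relative to `A` and `C`: every line
through `B` meets at least one line of each pair of intersecting lines through `A` and `C`. -/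
def BtwProp (I : P → L → Prop) (A B C : P) : Prop :=
  ∀ k a c, I B k → I A a → I C c → Meets I a c → Meets I k a ∨ Meets I k c

/-- `B` is between `A` and `C` (three distinct collinear points). -/
def Btw (I : P → L → Prop) (A B C : P) : Prop :=
  A ≠ B ∧ B ≠ C ∧ A ≠ C ∧ Collin I {A, B, C} ∧ BtwProp I A B C

/-- The closed segment with endpoints `R` and `S`. -/
def segment (I : P → L → Prop) (R S : P) : Set P :=
  {X | X = R ∨ X = S ∨ Btw I R X S}

/-- The ray with endpoint `R` through `A` (meaningful for `A ≠ R`). -/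
def ray (I : P → L → Prop) (R A : P) : Set P :=
  {X | X = R ∨ X = A ∨ Btw I R X A ∨ Btw I R A X}

/-- `r` is a ray with endpoint `R`. -/
def IsRay (I : P → L → Prop) (r : Set P) (R : P) : Prop :=
  ∃ A, A ≠ R ∧ r = ray I R A

/-- The line `k` passes through a point of the set `s`. -/
def Hits (I : P → L → Prop) (k : L) (s : Set P) : Prop :=
  ∃ X ∈ s, I X k

/-- The line `m` contains the set `s`. -/
def Contains (I : P → L → Prop) (m : L) (s : Set P) : Prop :=
  ∀ X ∈ s, I X m

/-- (Strictly) parallel rays: noncollinear, and every line that meets one of them meets the other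
one or the segment joining the endpoints. -/
def RaysParallel (I : P → L → Prop) (r s : Set P) : Prop :=
  ∃ R S, IsRay I r R ∧ IsRay I s S ∧ ¬ Collin I (r ∪ s) ∧
    ∀ k, (Hits I k r → Hits I k s ∨ Hits I k (segment I R S)) ∧
      (Hits I k s → Hits I k r ∨ Hits I k (segment I R S))

/-- Two lines are parallel if they contain parallel rays. -/
def Parallel (I : P → L → Prop) (a b : L) : Prop :=
  ∃ r s, Contains I a r ∧ Contains I b s ∧ RaysParallel I r s

/-- A ray and a line are (strictly) parallel if they contain parallel rays. -/
def RayLineParallel (I : P → L → Prop) (r : Set P) (m : L) : Prop :=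
  ∃ r' s, r' ⊆ r ∧ Contains I m s ∧ RaysParallel I r' s

/-- The pair `(a, b)` represents a rimpoint: `a` and `b` are parallel, and there is a line parallel
to both such that some line meets all three. -/
def IsRimPair (I : P → L → Prop) (a b : L) : Prop :=
  Parallel I a b ∧
    ∃ m, Parallel I m a ∧ Parallel I m b ∧ ∃ t, Meets I t a ∧ Meets I t b ∧ Meets I t m

/-- The lines incident with the rimpoint `(a, b)`: `a`, `b`, and every line parallel to both such
that some line meets all three. -/
def pencil (I : P → L → Prop) (a b : L) : Set L :=
  {m | m = a ∨ m = b ∨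
    (Parallel I m a ∧ Parallel I m b ∧ ∃ t, Meets I t a ∧ Meets I t b ∧ Meets I t m)}

/-- The rimpoints. A rimpoint `(a, b)` is represented by the set of lines incident with it, so that
two pairs give the same rimpoint exactly when they determine the same pencil of pairwise identical
or parallel lines. -/
def Rim (I : P → L → Prop) : Type v :=
  {s : Set L // ∃ a b, IsRimPair I a b ∧ s = pencil I a b}

/-- The rimpoint `X` is incident with the line `m`. -/
def RimInc (I : P → L → Prop) (X : Rim I) (m : L) : Prop :=
  m ∈ X.1

/-- `m` is the line `XY` joining the distinct rimpoints `X` and `Y`. -/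
def Join (I : P → L → Prop) (X Y : Rim I) (m : L) : Prop :=
  X ≠ Y ∧ RimInc I X m ∧ RimInc I Y m

/-- `Y` is the rimpoint `X ^ A`: the other rimpoint on the line joining the rimpoint `X` and the
finite point `A`. -/
def Opp (I : P → L → Prop) (A : P) (X Y : Rim I) : Prop :=
  ∃ m, I A m ∧ Join I X Y m

/-- Two common parallels to `l` and `m` meet in a finite point of `n`. -/
def CommonParallelsMeetOn (I : P → L → Prop) (l m n : L) : Prop :=
  ∃ a b, Parallel I a l ∧ Parallel I a m ∧ Parallel I b l ∧ Parallel I b m ∧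
    a ≠ b ∧ ∃ T, I T a ∧ I T b ∧ I T n

/-- The axioms (A1)--(A7), (A10), (A11). -/
structure Axioms (I : P → L → Prop) : Prop where
  /-- Any two distinct points are incident with a unique line. -/
  A1 : ∀ A B, A ≠ B → ∃! m, I A m ∧ I B m
  /-- Each line is on at least one point. -/
  A2 : ∀ m, ∃ A, I A m
  /-- There exist three non-collinear points, and three collinear points. -/
  A3 : (∃ A B C, A ≠ B ∧ B ≠ C ∧ A ≠ C ∧ ¬ Collin I {A, B, C}) ∧
    ∃ A B C, A ≠ B ∧ B ≠ C ∧ A ≠ C ∧ Collin I {A, B, C}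
  /-- Betweenness. -/
  A4 : ∀ A B C, A ≠ B → B ≠ C → A ≠ C → Collin I {A, B, C} →
    BtwProp I B A C ∨ BtwProp I A B C ∨ BtwProp I A C B
  /-- Hyperbolicity. -/
  A5 : ∀ A l, ¬ I A l → ∃ m n, m ≠ n ∧ I A m ∧ I A n ∧ ¬ Meets I m l ∧ ¬ Meets I n l ∧
    ∀ k, Meets I k l → Meets I k m ∨ Meets I k n
  /-- Parallelism: any two noncollinear rays have a common parallel line, where a ray also counts
  as parallel to the line that contains it. -/
  A6 : ∀ r s R S, IsRay I r R → IsRay I s S → ¬ Collin I (r ∪ s) →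
    ∃ m, (Contains I m r ∨ RayLineParallel I r m) ∧ (Contains I m s ∨ RayLineParallel I s m)
  /-- Pascal's Theorem on rimpoints. -/
  A7 : ∀ (A B C D E F : Rim I), [A, B, C, D, E, F].Nodup →
    ∀ ab bc cd de ef fa, Join I A B ab → Join I B C bc → Join I C D cd →
      Join I D E de → Join I E F ef → Join I F A fa →
      ab ≠ de → bc ≠ ef → cd ≠ fa →
      ∀ X Y Z, I X ab → I X de → I Y bc → I Y ef → I Z cd → I Z fa → Collin I {X, Y, Z}
  /-- Given distinct finite points `A`, `B` there are lines `l` on `A` and `m` on `B` such that two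
  common parallels to `l` and `m` meet on `AB`. -/
  A10 : ∀ A B, A ≠ B → ∃ n l m, I A n ∧ I B n ∧ I A l ∧ I B m ∧ CommonParallelsMeetOn I l m n
  /-- For a rimpoint `X` not on a line `l` there is a unique finite point `R` on `l` such that for
  every finite point `S ≠ R` on `l`, two common parallels to `l` and to the line joining
  `X ^ (S R)` (here `Z`) and `X ^ (R S)` (here `Z'`) meet on `XR` (here `n`). -/
  A11 : ∀ (X : Rim I) l, ¬ RimInc I X l →
    ∃! R, I R l ∧ ∀ S, I S l → S ≠ R →
      ∃ (Y Z Y' Z' : Rim I) (m n : L),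
        Opp I S X Y ∧ Opp I R Y Z ∧ Opp I R X Y' ∧ Opp I S Y' Z' ∧
        Join I Z Z' m ∧ RimInc I X n ∧ I R n ∧ CommonParallelsMeetOn I l m n

/-- The permutation `σ` of the rimpoints is the half-turn about the finite point `A`. -/
def IsHalfTurn (I : P → L → Prop) (A : P) (σ : Equiv.Perm (Rim I)) : Prop :=
  ∀ X, Opp I A X (σ X)

/-- The separation relation `WX // YZ` on rimpoints: the lines `WX` and `YZ` meet in a finite
point. -/
def Sep (I : P → L → Prop) (W X Y Z : Rim I) : Prop :=
  ∃ a b, Join I W X a ∧ Join I Y Z b ∧ Meets I a b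

/-- A cyclic order on a set. -/
structure IsCyclicOrder {O : Type*} (C : O → O → O → Prop) : Prop where
  distinct : ∀ x y z, C x y z → x ≠ y ∧ y ≠ z ∧ z ≠ x
  total : ∀ x y z, x ≠ y → y ≠ z → z ≠ x →
    (C x y z ∨ C x z y) ∧ ¬ (C x y z ∧ C x z y)
  cycle : ∀ x y z, C x y z → C y z x
  trans : ∀ x y z t, C x y z → C x z t → C x y t

/-- The ternary relation `C` on rimpoints is compatible with the separation relation. -/
def Compatible (I : P → L → Prop) (C : Rim I → Rim I → Rim I → Prop) : Prop :=
  ∀ W X Y Z, Sep I W Y X Z ↔ (C W X Y ∧ C Y Z W) ∨ (C W Z Y ∧ C Y X W)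

/-- The rimpoints `X`, `Y` are on opposite sides of the line `l`. -/
def OppositeSides (I : P → L → Prop) (l : L) (X Y : Rim I) : Prop :=
  ¬ RimInc I X l ∧ ¬ RimInc I Y l ∧ ∃ m, Join I X Y m ∧ Meets I m l

/-- `α` is an order-preserving axial permutation of the rimpoints with axis `l`: it is not the
identity, it preserves a cyclic order compatible with the separation relation, the lines
`X (α Y)` and `Y (α X)` can only meet in a finite point of `l`, and they do meet whenever `X` and
`Y` are on opposite sides of `l`. -/
def IsAxial (I : P → L → Prop) (l : L) (α : Equiv.Perm (Rim I)) : Prop :=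
  α ≠ 1 ∧
  (∃ C, IsCyclicOrder C ∧ Compatible I C ∧ ∀ X Y Z, C X Y Z ↔ C (α X) (α Y) (α Z)) ∧
  (∀ X Y a b, Join I X (α Y) a → Join I Y (α X) b → a ≠ b → ∀ T, I T a → I T b → I T l) ∧
  (∀ X Y, OppositeSides I l X Y →
    ∃ a b, Join I X (α Y) a ∧ Join I Y (α X) b ∧ Meets I a b)

/-- `T` is the finite point `l ⋈ m`: if `L₁`, `L₂` are the rimpoints of `l` and `M₁`, `M₂` those of
`m`, labelled such that `L₁M₂` and `L₂M₁` meet in a finite point, this is that point. -/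
def IsBowtie (I : P → L → Prop) (l m : L) (T : P) : Prop :=
  ¬ Parallel I l m ∧ ∃ (L₁ L₂ M₁ M₂ : Rim I) (a b : L),
    Join I L₁ L₂ l ∧ Join I M₁ M₂ m ∧ Join I L₁ M₂ a ∧ Join I L₂ M₁ b ∧
    a ≠ b ∧ I T a ∧ I T b

/-- The permutation `σ` of the rimpoints is the reflection in the line `l`: it fixes the rimpoints
of `l`, and it maps a rimpoint `A` not on `l` to `A ^ T`, where `T` is the point
`l ⋈ (α A)(α⁻¹ A)` for an order-preserving axial permutation `α` with axis `l` (such `α` exist, and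
the image does not depend on the choice of `α`). -/
def IsReflection (I : P → L → Prop) (l : L) (σ : Equiv.Perm (Rim I)) : Prop :=
  (∀ X, RimInc I X l → σ X = X) ∧
  (∃ α, IsAxial I l α) ∧
  ∀ A, ¬ RimInc I A l → ∀ α, IsAxial I l α →
    ∃ m T, Join I (α A) (α⁻¹ A) m ∧ IsBowtie I l m T ∧ Opp I T A (σ A)

/-- The set of all half-turns and all line reflections, as permutations of the rimpoints. -/
def halfTurnsAndReflections (I : P → L → Prop) : Set (Equiv.Perm (Rim I)) :=
  {σ | (∃ A, IsHalfTurn I A σ) ∨ ∃ l, IsReflection I l σ}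

end Plane

section Oval

variable {O : Type u}

/-- `(O, S)` is an abstract oval. The identity is allowed as an involution. -/
structure IsAbstractOval (S : Set (Equiv.Perm O)) : Prop where
  card : 3 ≤ Cardinal.mk O
  invol : ∀ s ∈ S, s * s = 1
  existsUnique : ∀ A₁ A₂ B₁ B₂ : O, ({A₁, A₂} : Set O) ∩ {B₁, B₂} = ∅ →
    ∃! s, s ∈ S ∧ s A₁ = A₂ ∧ s B₁ = B₂

/-- The line determined by `A` and `B` in the incidence structure of `(O, S)`, whose points are the
elements of `O` and of `S`; it is secant if `A ≠ B`. -/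
def ovalLine (S : Set (Equiv.Perm O)) (A B : O) : Set (O ⊕ S) :=
  {x | x = Sum.inl A ∨ x = Sum.inl B ∨ ∃ s : S, x = Sum.inr s ∧ (s : Equiv.Perm O) A = B}

/-- A line `l` is Pascalian: the product of any three elements of `S` on `l` is again an element of
`S` on `l`. -/
def IsPascalian (S : Set (Equiv.Perm O)) (l : Set (O ⊕ S)) : Prop :=
  ∀ i j k : S, Sum.inr i ∈ l → Sum.inr j ∈ l → Sum.inr k ∈ l →
    ∃ s : S, (s : Equiv.Perm O) = i * j * k ∧ Sum.inr s ∈ l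

end Oval

end HypInc

/-! ### Incidence and betweenness: every line has at least five points. -/

namespace HypInc

universe u v

variable {P : Type u} {L : Type v} {I : P → L → Prop}

/-! The axioms describe a hyperbolic plane without a metric, and its motions are studied through
their action on the rim. The incidence axioms yield ordered geometry: betweenness is linear on each
line (`Axioms.btw_chain`), Pasch's axiom holds (`Axioms.pasch`), and a line has two sides
(`Axioms.opp_iff`). A direction of a line is the filter of its far points. Being asymptotic is an
equivalence relation on directions (`Asy.trans`) whose classes are the rimpoints; each line has
exactly two of them, and by (A6) two rimpoints have a joining line. Crossing of chords is then a
separation relation, so the rim carries a compatible cyclic order (`exists_cyclicOrder`).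

A half-turn interchanges the ends of every line through its centre, so incidence becomes algebra:
`A` is on the line `XY` exactly if its half-turn takes `X` to `Y`. Pascal's theorem (A7) turns into
the identity `XYZ = ZYX` for half-turns about collinear points (`pascal`). Hence products of two
half-turns about points of a line commute; they act simply transitively on the rimpoints of either
side of the line, and the product of three such half-turns is a half-turn (`exists_mul_three`).
Apart from the identity these translations are exactly the order-preserving axial maps
(`isAxial_iff`).

(A10) gives midpoints, that is, square roots of translations. (A11) gives each rimpoint off a line a
unique foot on it, and the reflection acts on that rimpoint as the half-turn about its foot. The
decisive fact is that the perpendicular `n` to `m` at `R` satisfies `reflect n = halfTurn R *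
reflect m` (`Foot.reflect_eq`); it rests on reflections normalizing the half-turns (`aut_reflect`).

For the oval, two crossing pairs of rimpoints are interchanged by the half-turn about the crossing
point, and in the other cases a reflection in a suitable line does it. Uniqueness comes from the
fact that two perpendiculars to a line do not meet. The elements on a secant line with join `m` are
the half-turns about points of `m` and their products with `reflect m`, which commutes with them, so
the Pascalian property reduces to `exists_mul_three`. -/

/-- Two lines have a common point. -/
def Tch (I : P → L → Prop) (a b : L) : Prop := ∃ X, I X a ∧ I X b

theorem Tch.symm {a b : L} (t : Tch I a b) : Tch I b a := by
  obtain ⟨X, h1, h2⟩ := t; exact ⟨X, h2, h1⟩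

theorem ntch {a b : L} (n : ¬ Tch I a b) {X : P} (h1 : I X a) : ¬ I X b := fun h2 => n ⟨X, h1, h2⟩

namespace Axioms

theorem tch_self (h : Axioms I) (a : L) : Tch I a a := by
  obtain ⟨X, hX⟩ := h.A2 a; exact ⟨X, hX, hX⟩

theorem eq_line (h : Axioms I) {A B : P} (hAB : A ≠ B) {m n : L} (h1 : I A m) (h2 : I B m)
    (h3 : I A n) (h4 : I B n) : m = n :=
  (h.A1 A B hAB).unique ⟨h1, h2⟩ ⟨h3, h4⟩

theorem eq_pt (h : Axioms I) {m n : L} (hmn : m ≠ n) {A B : P} (h1 : I A m) (h3 : I A n)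
    (h2 : I B m) (h4 : I B n) : A = B := by
  by_contra hAB; exact hmn (h.eq_line hAB h1 h2 h3 h4)

theorem exists_ne (h : Axioms I) (A : P) : ∃ B, B ≠ A := by
  obtain ⟨⟨X, Y, Z, h1, -⟩, -⟩ := h.A3
  by_cases hX : X = A
  · exact ⟨Y, fun hh => h1 (hX.trans hh.symm)⟩
  · exact ⟨X, hX⟩

theorem exists_line (h : Axioms I) (A B : P) : ∃ m, I A m ∧ I B m := by
  by_cases hAB : A = B
  · subst hAB
    obtain ⟨B, hB⟩ := h.exists_ne A
    obtain ⟨m, hm, -⟩ := h.A1 A B hB.symm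
    exact ⟨m, hm.1, hm.1⟩
  · exact (h.A1 A B hAB).exists

theorem exists_notMem (h : Axioms I) (m : L) : ∃ A, ¬ I A m := by
  obtain ⟨⟨X, Y, Z, -, -, -, h4⟩, -⟩ := h.A3
  by_contra hc
  push Not at hc
  exact h4 ⟨m, fun W _ => hc W⟩

theorem cover (h : Axioms I) {W : P} {b : L} (hW : ¬ I W b) :
    ∃ m n, m ≠ n ∧ I W m ∧ I W n ∧ ¬ Tch I m b ∧ ¬ Tch I n b ∧
      ∀ f, Tch I f b → f ≠ b → Tch I f m ∨ Tch I f n := by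
  obtain ⟨m, n, h1, h2, h3, h4, h5, h6⟩ := h.A5 W b hW
  have hm : m ≠ b := by rintro rfl; exact hW h2
  have hn : n ≠ b := by rintro rfl; exact hW h3
  exact ⟨m, n, h1, h2, h3, fun t => h4 ⟨hm, t⟩, fun t => h5 ⟨hn, t⟩,
    fun f hf hne => (h6 f ⟨hne, hf⟩).imp And.right And.right⟩

/-- The working form of (A5): of the two lines through `W` that miss `b`, one is met by `f`.
Disjoint lines built in this way drive all the early arguments on betweenness. -/
theorem avoid (h : Axioms I) {W : P} {b f : L} (hW : ¬ I W b) (hf : Tch I f b) (hne : f ≠ b) :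
    ∃ w, I W w ∧ ¬ Tch I w b ∧ Tch I w f := by
  obtain ⟨m, n, h1, h2, h3, h4, h5, h6⟩ := h.cover hW
  rcases h6 f hf hne with h7 | h7
  · exact ⟨m, h2, h4, h7.symm⟩
  · exact ⟨n, h3, h5, h7.symm⟩

theorem avoid_ne (h : Axioms I) {W : P} {b : L} (hW : ¬ I W b) (f : L) :
    ∃ w, I W w ∧ ¬ Tch I w b ∧ w ≠ f := by
  obtain ⟨m, n, h1, h2, h3, h4, h5, h6⟩ := h.cover hW
  by_cases hm : m = f
  · exact ⟨n, h3, h5, fun hn => h1 (hm.trans hn.symm)⟩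
  · exact ⟨m, h2, h4, hm⟩

theorem avoid_two (h : Axioms I) {W : P} {b : L} (hW : ¬ I W b) :
    ∃ w w', I W w ∧ I W w' ∧ ¬ Tch I w b ∧ ¬ Tch I w' b ∧ w ≠ w' := by
  obtain ⟨m, n, h1, h2, h3, h4, h5, h6⟩ := h.cover hW
  exact ⟨m, n, h2, h3, h4, h5, h1⟩

theorem exists_line_ne (h : Axioms I) (A : P) (n : L) : ∃ m, I A m ∧ m ≠ n := by
  by_cases hA : I A n
  · obtain ⟨B, hB⟩ := h.exists_notMem n
    obtain ⟨m, h1, h2⟩ := h.exists_line A B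
    exact ⟨m, h1, by rintro rfl; exact hB h2⟩
  · obtain ⟨m, h1, h2⟩ := h.exists_line A A
    exact ⟨m, h1, by rintro rfl; exact hA h2⟩

/-- A line is not the union of a point: there is a point on `n` other than `A`. -/
theorem exists_pt_ne (h : Axioms I) (A : P) (n : L) : ∃ B, I B n ∧ B ≠ A := by
  by_cases hA : I A n
  · obtain ⟨b, hb, hbn⟩ := h.exists_line_ne A n
    obtain ⟨W, hW⟩ := h.exists_notMem b
    obtain ⟨w, h1, h2, X, h3, h4⟩ := h.avoid hW ⟨A, hA, hb⟩ hbn.symm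
    exact ⟨X, h4, by rintro rfl; exact h2 ⟨X, h3, hb⟩⟩
  · obtain ⟨B, hB⟩ := h.A2 n
    exact ⟨B, hB, by rintro rfl; exact hA hB⟩

end Axioms

theorem Btw.line {A B C : P} (b : Btw I A B C) : ∃ n, I A n ∧ I B n ∧ I C n := by
  obtain ⟨-, -, -, ⟨m, hm⟩, -⟩ := b
  exact ⟨m, hm A (by simp), hm B (by simp), hm C (by simp)⟩

theorem Btw.symm {A B C : P} (b : Btw I A B C) : Btw I C B A := by
  obtain ⟨n, hA, hB, hC⟩ := b.line
  obtain ⟨h1, h2, h3, -, h4⟩ := b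
  refine ⟨h2.symm, h1.symm, h3.symm, ⟨n, by simp [hA, hB, hC]⟩, fun k a c hk ha hc hm => ?_⟩
  exact (h4 k c a hk hc ha ⟨hm.1.symm, hm.2.imp fun _ => And.symm⟩).symm

theorem btw_comm {A B C : P} : Btw I A B C ↔ Btw I C B A := ⟨Btw.symm, Btw.symm⟩

/-- The defining property of betweenness with the degenerate case `a = c` included, so that no
distinctness of the lines has to be tracked. -/
theorem Btw.apex {A B C : P} (t : Btw I A B C) (h : Axioms I) {a b c : L} (hb : I B b) (ha : I A a)
    (hc : I C c) (hac : Tch I a c) : Tch I b a ∨ Tch I b c := by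
  obtain ⟨n, hA, hB, hC⟩ := t.line
  obtain ⟨h1, h2, h3, -, h4⟩ := t
  by_cases e : a = c
  · subst e
    obtain rfl := h.eq_line h3 ha hc hA hC
    exact Or.inl ⟨B, hb, hB⟩
  · exact (h4 b a c hb ha hc ⟨e, hac⟩).imp And.right And.right

theorem Btw.mem2 {A B C : P} (t : Btw I A B C) (h : Axioms I) {n : L} (h1 : I A n) (h2 : I C n) :
    I B n := by
  obtain ⟨m, hA, hB, hC⟩ := t.line
  obtain rfl := h.eq_line t.2.2.1 h1 h2 hA hC; exact hB

theorem Btw.mem3 {A B C : P} (t : Btw I A B C) (h : Axioms I) {n : L} (h1 : I A n) (h2 : I B n) :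
    I C n := by
  obtain ⟨m, hA, hB, hC⟩ := t.line
  obtain rfl := h.eq_line t.1 h1 h2 hA hB; exact hC

theorem Btw.mem1 {A B C : P} (t : Btw I A B C) (h : Axioms I) {n : L} (h1 : I B n) (h2 : I C n) :
    I A n := t.symm.mem3 h h2 h1

namespace Axioms

theorem btw_total (h : Axioms I) {n : L} {A B C : P} (h1 : A ≠ B) (h2 : B ≠ C) (h3 : A ≠ C)
    (hA : I A n) (hB : I B n) (hC : I C n) : Btw I B A C ∨ Btw I A B C ∨ Btw I A C B := by
  have hc : ∀ X Y Z : P, I X n → I Y n → I Z n → Collin I {X, Y, Z} :=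
    fun X Y Z hX hY hZ => ⟨n, by simp [hX, hY, hZ]⟩
  rcases h.A4 A B C h1 h2 h3 (hc _ _ _ hA hB hC) with t | t | t
  · exact Or.inl ⟨h1.symm, h3, h2, hc _ _ _ hB hA hC, t⟩
  · exact Or.inr (Or.inl ⟨h1, h2, h3, hc _ _ _ hA hB hC, t⟩)
  · exact Or.inr (Or.inr ⟨h3, h2.symm, h1, hc _ _ _ hA hC hB, t⟩)

/-- For disjoint lines `u` on `U` and `v` on `V`, the two hypotheses together say that a line `w` on
`W` meets `u` if and only if it meets `v`. Along the chain `u2`, `v1`, `u1`, `v2` of consecutively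
disjoint lines, a line `w` meeting `u2` is thus forced to meet `v2`, which it was chosen to avoid.
-/
theorem btw_unique (h : Axioms I) {U V W : P} (t1 : Btw I U V W) (t2 : Btw I V U W) : False := by
  obtain ⟨n, hU, hV, hW⟩ := t1.line
  have hUV := t1.1
  have hUW := t1.2.2.1
  have hVW := t1.2.1
  obtain ⟨v1, hv1, hv1n⟩ := h.exists_line_ne V n
  have hUv1 : ¬ I U v1 := fun hh => hv1n (h.eq_line hUV hh hv1 hU hV)
  obtain ⟨u1, u2, hu1, hu2, a1, a2, hu⟩ := h.avoid_two hUv1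
  have hVu1 : ¬ I V u1 := fun hh => a1 ⟨V, hh, hv1⟩
  obtain ⟨v2, hv2, a3, a4⟩ := h.avoid hVu1 ⟨U, hu2, hu1⟩ hu.symm
  have hWv2 : ¬ I W v2 := fun hh => by
    obtain rfl := h.eq_line hVW hv2 hh hV hW
    exact a3 ⟨U, hU, hu1⟩
  obtain ⟨w, hw, a5, a6⟩ := h.avoid hWv2 a4.symm (by rintro rfl; exact a3 ⟨U, hu2, hu1⟩)
  have k1 : ∀ u v, I U u → I V v → ¬ Tch I u v → Tch I w u → Tch I w v := fun u v hu hv n t =>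
    (t1.apex h hv hu hw t.symm).elim (fun q => absurd q.symm n) Tch.symm
  have k2 : ∀ u v, I U u → I V v → ¬ Tch I u v → Tch I w v → Tch I w u := fun u v hu hv n t =>
    (t2.apex h hu hv hw t.symm).elim (fun q => absurd q n) Tch.symm
  have a3' : ¬ Tch I u1 v2 := fun t => a3 t.symm
  exact a5 (k1 _ _ hu1 hv2 a3' (k2 _ _ hu1 hv1 a1 (k1 _ _ hu2 hv1 a2 a6)))

theorem btw_fork_aux (h : Axioms I) {X Z W A : P} (t1 : Btw I X A Z) (t3 : Btw I Z A W)
    (t : Btw I X Z W) : False := by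
  obtain ⟨n, hX, hA, hZ⟩ := t1.line
  obtain ⟨a, ha, han⟩ := h.exists_line_ne A n
  have off : ∀ {Y}, I Y n → Y ≠ A → ¬ I Y a := fun hY hne hh => han (h.eq_line hne hh ha hY hA)
  have hW : I W n := t.mem3 h hX hZ
  obtain ⟨z, z', hz, hz', a1, a2, hzz⟩ := h.avoid_two (off hZ t1.2.1.symm)
  have hWz : ¬ I W z := fun hh => by
    obtain rfl := h.eq_line t3.2.2.1 hz hh hZ hW
    exact a1 ⟨A, hA, ha⟩
  obtain ⟨w, hw, b1, b2⟩ := h.avoid hWz ⟨Z, hz', hz⟩ hzz.symm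
  have c1 : Tch I a w := (t3.apex h ha hz' hw b2.symm).resolve_left fun t => a2 t.symm
  obtain ⟨x, hx, d1, d2⟩ := h.avoid (off hX t1.1) c1.symm (by rintro rfl; exact off hW t3.2.1.symm hw)
  have c2 : Tch I z x := (t.apex h hz hx hw d2).resolve_right fun t => b1 t.symm
  exact (t1.apex h ha hx hz c2.symm).elim (fun t => d1 t.symm) (fun t => a1 t.symm)

theorem btw_fork (h : Axioms I) {X Z W A : P} (t1 : Btw I X A Z) (t2 : Btw I X A W)
    (t3 : Btw I Z A W) : False := by
  obtain ⟨n, hX, hA, hZ⟩ := t1.line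
  have hW : I W n := t2.mem3 h hX hA
  rcases h.btw_total t1.2.2.1 t3.2.2.1 t2.2.2.1 hX hZ hW with t | t | t
  · exact h.btw_fork_aux t1.symm t2 t
  · exact h.btw_fork_aux t1 t3 t
  · exact h.btw_fork_aux t2 t3.symm t

theorem btw_path (h : Axioms I) {A B C D : P} (t1 : Btw I C B D) (t2 : Btw I A C D)
    (t3 : Btw I A D B) : False := by
  obtain ⟨n, hC, hB, hD⟩ := t1.line
  have hA := t2.mem1 h hC hD
  obtain ⟨d, hd, hdn⟩ := h.exists_line_ne D n
  have off : ∀ {Y}, I Y n → Y ≠ D → ¬ I Y d := fun hY hne hh => hdn (h.eq_line hne hh hd hY hD)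
  obtain ⟨b, b', hb, hb', a1, a2, hbb⟩ := h.avoid_two (off hB t1.2.1)
  have hCb : ¬ I C b := fun hh => by
    obtain rfl := h.eq_line t1.1 hh hb hC hB
    exact a1 ⟨D, hD, hd⟩
  obtain ⟨c, hc, b1, b2⟩ := h.avoid hCb ⟨B, hb', hb⟩ hbb.symm
  have c1 : ¬ Tch I c d := fun t => (t1.apex h hb hc hd t).elim (fun t => b1 t.symm) a1
  have hAc : ¬ I A c := fun hh => by
    obtain rfl := h.eq_line t2.1 hh hc hA hC
    exact c1 ⟨D, hD, hd⟩
  obtain ⟨a, ha, d1, d2⟩ := h.avoid hAc b2.symm (by rintro rfl; exact b1 ⟨B, hb', hb⟩)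
  have c2 : ¬ Tch I a d := fun t => (t2.apex h hc ha hd t).elim (fun t => d1 t.symm) c1
  exact (t3.apex h hd ha hb' d2).elim (fun t => c2 t.symm) (fun t => a2 t.symm)

/-- Through an end of a triple, a second line `w` has, for each of its other points `Y`, two more. -/
theorem end_points (h : Axioms I) {U V W Y : P} {n w : L} (t : Btw I U V W) (hU : I U n) (hW : I W n)
    (hw : I W w) (hwn : w ≠ n) (hY : I Y w) (hYW : Y ≠ W) :
    ∃ W1 W2, I W1 w ∧ I W2 w ∧ W1 ≠ W ∧ W2 ≠ W ∧ W1 ≠ Y ∧ W2 ≠ Y ∧ W1 ≠ W2 ∧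
      ∀ u, I U u → I Y u → ∀ v, I V v → (I W1 v ∨ I W2 v) → ¬ Tch I v u := by
  have hV := t.mem2 h hU hW
  obtain ⟨u, hu, hYu⟩ := h.exists_line U Y
  have hYn : ¬ I Y n := fun hh => hwn (h.eq_line hYW hY hw hh hW)
  have hUY : U ≠ Y := by rintro rfl; exact hYn hU
  have hVu : ¬ I V u := fun hh => by
    obtain rfl := h.eq_line t.1 hu hh hU hV
    exact hYn hYu
  obtain ⟨v1, v2, hv1, hv2, a1, a2, hvv⟩ := h.avoid_two hVu
  have key : ∀ v, I V v → ¬ Tch I v u → ∃ X, I X w ∧ I X v ∧ X ≠ W ∧ X ≠ Y := by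
    intro v hv hn
    obtain ⟨X, hX1, hX2⟩ := (t.apex h hv hu hw ⟨Y, hYu, hY⟩).resolve_left hn
    refine ⟨X, hX2, hX1, ?_, ?_⟩
    · rintro rfl
      obtain rfl := h.eq_line t.2.1 hv hX1 hV hW
      exact hn ⟨U, hU, hu⟩
    · rintro rfl; exact hn ⟨X, hX1, hYu⟩
  obtain ⟨W1, b1, b2, b3, b4⟩ := key v1 hv1 a1
  obtain ⟨W2, c1, c2, c3, c4⟩ := key v2 hv2 a2
  have hVw : ¬ I V w := fun hh => hwn (h.eq_line t.2.1 hh hw hV hW)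
  refine ⟨W1, W2, b1, c1, b3, c3, b4, c4, ?_, ?_⟩
  · rintro rfl
    exact hvv (h.eq_line (by rintro rfl; exact hVw b1) hv1 b2 hv2 c2)
  · intro u' hu' hYu' v hv hor
    obtain rfl := h.eq_line hUY hu' hYu' hu hYu
    rcases hor with o | o
    · obtain rfl := h.eq_line (by rintro rfl; exact hVw b1) hv o hv1 b2
      exact a1
    · obtain rfl := h.eq_line (by rintro rfl; exact hVw c1) hv o hv2 c2
      exact a2

/-- By `end_points` there are at least three points on `w` besides `W`. If there were no more, a
line from `V` to one of them would miss every line from `U` to another one; then none of the three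
could be between the other two. -/
theorem five_of_end (h : Axioms I) {U V W : P} {n w : L} (t : Btw I U V W) (hU : I U n) (hW : I W n)
    (hw : I W w) (hwn : w ≠ n) (B C D : P) :
    ∃ E, I E w ∧ E ≠ W ∧ E ≠ B ∧ E ≠ C ∧ E ≠ D := by
  by_contra hcon'
  have hcon : ∀ E, I E w → E ≠ W → E = B ∨ E = C ∨ E = D := fun E h1 h2 => by
    by_contra h3
    push Not at h3
    exact hcon' ⟨E, h1, h2, h3.1, h3.2.1, h3.2.2⟩
  have hV := t.mem2 h hU hW
  obtain ⟨Y, hY, hYW⟩ := h.exists_pt_ne W w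
  obtain ⟨W1, W2, b1, b2, b3, b4, b5, b6, b7, b8⟩ := h.end_points t hU hW hw hwn hY hYW
  have all : ∀ E, I E w → E ≠ W → E = Y ∨ E = W1 ∨ E = W2 := by
    intro E hE hEW
    have := hcon E hE hEW
    have := hcon Y hY hYW
    have := hcon W1 b1 b3
    have := hcon W2 b2 b4
    grind
  have key : ∀ X X', I X w → X ≠ W → I X' w → X' ≠ W → X ≠ X' → ∀ v, I V v → I X v →
      ∀ u, I U u → I X' u → ¬ Tch I v u := by
    intro X X' hX hXW hX' hXW' hne v hv hXv u hu hXu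
    obtain ⟨Z1, Z2, d1, d2, d3, d4, d5, d6, d7, d8⟩ := h.end_points t hU hW hw hwn hX' hXW'
    refine d8 u hu hXu v hv ?_
    have := all X hX hXW
    have := all X' hX' hXW'
    have := all Z1 d1 d3
    have := all Z2 d2 d4
    have : X = Z1 ∨ X = Z2 := by grind
    rcases this with e | e <;> subst e
    · exact Or.inl hXv
    · exact Or.inr hXv
  have fin : ∀ X Y Z, I X w → I Y w → I Z w → X ≠ W → Y ≠ W → Z ≠ W → Btw I X Y Z → False := by
    intro X Y Z hX hY hZ hXW hYW hZW t'
    obtain ⟨u, hu, hYu⟩ := h.exists_line U Y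
    obtain ⟨v1, hv1, hX1⟩ := h.exists_line V X
    obtain ⟨v2, hv2, hZ2⟩ := h.exists_line V Z
    rcases t'.apex h hYu hX1 hZ2 ⟨V, hv1, hv2⟩ with q | q
    · exact key X Y hX hXW hY hYW t'.1 v1 hv1 hX1 u hu hYu q.symm
    · exact key Z Y hZ hZW hY hYW t'.2.1.symm v2 hv2 hZ2 u hu hYu q.symm
  rcases h.btw_total b5 b6.symm b7 b1 hY b2 with q | q | q
  · exact fin _ _ _ hY b1 b2 hYW b3 b4 q
  · exact fin _ _ _ b1 hY b2 b3 hYW b4 q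
  · exact fin _ _ _ b1 b2 hY b3 b4 hYW q

/-- Being a two-point line spreads to intersecting lines. If `Y` and `Z` were further points of `q`,
then `B` would have to be between them, since otherwise `five_of_end` applies to `n`; lines through
`Z` that avoid a line through `Y` missing `n` must then pass through `X`, the only free point of
`n`, and so coincide. -/
theorem two_point_aux (h : Axioms I) {B X : P} {n q : L} (hn : ∀ Y, I Y n → Y = B ∨ Y = X)
    (hB : I B n) (hBq : I B q) (hqn : q ≠ n) : ∃ Y, ∀ Z, I Z q → Z = B ∨ Z = Y := by
  obtain ⟨Y, hY, hYB⟩ := h.exists_pt_ne B q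
  refine ⟨Y, fun Z hZ => ?_⟩
  by_contra hc
  push Not at hc
  obtain ⟨hZB, hZY⟩ := hc
  have hend : ∀ U V, I U q → Btw I U V B → False := fun U V hU t => by
    obtain ⟨E, hE, e1, e2, -⟩ := h.five_of_end t hU hBq hB hqn.symm X X X
    exact (hn E hE).elim e1 e2
  rcases h.btw_total hYB hZB.symm hZY.symm hY hBq hZ with t | t | t
  · exact hend Z Y hZ t.symm
  · have offn : ∀ {W}, I W q → W ≠ B → ¬ I W n := fun hW hne hh =>
      hqn (h.eq_line hne hW hBq hh hB)
    obtain ⟨y1, y2, hy1, hy2, a1, a2, hyy⟩ := h.avoid_two (offn hY hYB)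
    have hZy : ∀ y, I Y y → ¬ Tch I y n → ¬ I Z y := fun y hy ha hh => by
      obtain rfl := h.eq_line hZY hh hy hZ hY
      exact ha ⟨B, hBq, hB⟩
    obtain ⟨z1, hz1, b1, b2⟩ := h.avoid (hZy y1 hy1 a1) ⟨Y, hy2, hy1⟩ hyy.symm
    obtain ⟨z2, hz2, c1, c2⟩ := h.avoid (hZy y2 hy2 a2) ⟨Y, hy1, hy2⟩ hyy
    have key : ∀ y z y', I Y y → I Y y' → I Z z → ¬ Tch I y n → Tch I z y → ¬ Tch I z y' → I X z := by
      intro y z y' hy hy' hz ha hzy hzy'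
      obtain ⟨W, hW1, hW2⟩ := (t.apex h hB hy hz hzy.symm).resolve_left fun t => ha t.symm
      rcases hn W hW1 with rfl | rfl
      · obtain rfl := h.eq_line hZB hz hW2 hZ hBq
        exact absurd ⟨Y, hY, hy'⟩ hzy'
      · exact hW2
    have hX1 := key y2 z1 y1 hy2 hy1 hz1 a2 b2 b1
    have hX2 := key y1 z2 y2 hy1 hy2 hz2 a1 c2 c1
    have hXn : I X n := by
      obtain ⟨W, hW, hWB⟩ := h.exists_pt_ne B n
      rcases hn W hW with e | e
      · exact absurd e hWB
      · exact e ▸ hW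
    obtain rfl := h.eq_line (by rintro rfl; exact offn hZ hZB hXn) hz1 hX1 hz2 hX2
    exact b1 c2
  · exact hend Y Z hY t

theorem three_points (h : Axioms I) (n : L) (A B : P) : ∃ C, I C n ∧ C ≠ A ∧ C ≠ B := by
  by_contra hc
  push Not at hc
  have hn : ∀ Y, I Y n → Y = A ∨ Y = B := fun Y hY => by
    by_cases e : Y = A
    · exact Or.inl e
    · exact Or.inr (hc Y hY e)
  have hA : I A n := by
    obtain ⟨W, hW, hWB⟩ := h.exists_pt_ne B n
    rcases hn W hW with e | e
    · exact e ▸ hW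
    · exact absurd e hWB
  obtain ⟨-, U, V, W, h1, h2, h3, t, ht⟩ := h.A3
  have hU := ht U (by simp)
  have hV := ht V (by simp)
  have hW := ht W (by simp)
  -- The line `t` has three points, so no two-point line may meet it; any two-point line reaches `t`
  -- through at most one intermediate line.
  have main : ∀ n A B, (∀ Y, I Y n → Y = A ∨ Y = B) → I A n → I A t → False := by
    intro n A B hn hA hAt
    by_cases htn : t = n
    · subst htn
      have := hn U hU
      have := hn V hV
      have := hn W hW
      grind
    · obtain ⟨Y, hY⟩ := h.two_point_aux hn hA hAt htn
      have := hY U hU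
      have := hY V hV
      have := hY W hW
      grind
  by_cases hAt : I A t
  · exact main n A B hn hA hAt
  · obtain ⟨m, hAm, hUm⟩ := h.exists_line A U
    by_cases hmn : m = n
    · subst hmn
      rcases hn U hUm with rfl | rfl
      · exact hAt hU
      · exact main m U A (fun Y hY => (hn Y hY).symm) hUm hU
    · obtain ⟨Y, hY⟩ := h.two_point_aux hn hA hAm hmn
      rcases hY U hUm with rfl | rfl
      · exact hAt hU
      · exact main m U A (fun Z hZ => (hY Z hZ).symm) hUm hU

theorem five_points (h : Axioms I) (n : L) (A B C D : P) :
    ∃ E, I E n ∧ E ≠ A ∧ E ≠ B ∧ E ≠ C ∧ E ≠ D := by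
  by_contra hcon
  push Not at hcon
  -- On a line `q` crossing `n` at `W`, the point `W` is never an end of a triple, since this would
  -- give `n` five points. So `W` is the middle of every triple containing it, and `btw_fork` leaves
  -- no room for four points on `q`; a line `m` violating this is then exhibited.
  have noend : ∀ U V W q, I U q → I W q → I W n → q ≠ n → Btw I U V W → False := by
    intro U V W q hU hW hWn hq t
    have key := h.five_of_end t hU hW hWn hq.symm
    by_cases e1 : W = A
    · obtain ⟨E, k⟩ := key B C D; have := hcon E; grind
    by_cases e2 : W = B
    · obtain ⟨E, k⟩ := key A C D; have := hcon E; grind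
    by_cases e3 : W = C
    · obtain ⟨E, k⟩ := key A B D; have := hcon E; grind
    · obtain ⟨E, k⟩ := key A B C; have := hcon E; have := hcon W; grind
  have mid : ∀ U V W q, I U q → I V q → I W q → I W n → q ≠ n → U ≠ V → U ≠ W → V ≠ W →
      Btw I U W V := by
    intro U V W q hU hV hW hWn hq h1 h2 h3
    rcases h.btw_total h2 h3.symm h1 hU hW hV with t | t | t
    · exact (noend V U W q hV hW hWn hq t.symm).elim
    · exact t
    · exact (noend U V W q hU hW hWn hq t).elim
  have four : ∀ W q, I W q → I W n → q ≠ n → ∀ R S T, I R q → I S q → I T q → R ≠ W → S ≠ W →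
      T ≠ W → R ≠ S → R ≠ T → S ≠ T → False := by
    intro W q hW hWn hq R S T hR hS hT r1 r2 r3 r4 r5 r6
    exact h.btw_fork (mid R S W q hR hS hW hWn hq r4 r1 r2)
      (mid R T W q hR hT hW hWn hq r5 r1 r3) (mid S T W q hS hT hW hWn hq r6 r2 r3)
  obtain ⟨Q, hQ⟩ := h.A2 n
  obtain ⟨q, hq, hqn⟩ := h.exists_line_ne Q n
  obtain ⟨R, hR, hRQ⟩ := h.exists_pt_ne Q q
  obtain ⟨S, hS, hSQ, hSR⟩ := h.three_points q Q R
  have t := mid S R Q q hS hR hq hQ hqn hSR hSQ hRQ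
  obtain ⟨Q', hQ', hQQ⟩ := h.exists_pt_ne Q n
  obtain ⟨m, hm1, hm2⟩ := h.exists_line R Q'
  have hQ'q : ¬ I Q' q := fun hh => hqn (h.eq_line hQQ hh hq hQ' hQ)
  have hmq : m ≠ q := by rintro rfl; exact hQ'q hm2
  have hRn : ¬ I R n := fun hh => hqn (h.eq_line hRQ hR hq hh hQ)
  have hmn : m ≠ n := by rintro rfl; exact hRn hm1
  obtain ⟨E, e1, e2, e3, -, -⟩ := h.five_of_end t hS hR hm1 hmq Q' Q' Q'
  obtain ⟨F, f1, f2, f3, f4, -⟩ := h.five_of_end t hS hR hm1 hmq Q' E E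
  exact four Q' m hm2 hQ' hmn R E F hm1 e1 f1 (by rintro rfl; exact hQ'q hR) e3 f3 e2.symm f2.symm
    f4.symm

end Axioms
end HypInc

/-! ### Betweenness on a line is linear. -/

namespace HypInc

universe u v

variable {P : Type u} {L : Type v} {I : P → L → Prop}

theorem Btw.ne12 {A B C : P} (t : Btw I A B C) : A ≠ B := t.1
theorem Btw.ne23 {A B C : P} (t : Btw I A B C) : B ≠ C := t.2.1
theorem Btw.ne13 {A B C : P} (t : Btw I A B C) : A ≠ C := t.2.2.1

namespace Axioms

theorem btw_swap (h : Axioms I) {A B C : P} (t1 : Btw I A B C) (t2 : Btw I A C B) : False :=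
  h.btw_unique t1.symm t2.symm

theorem btw_swap' (h : Axioms I) {A B C : P} (t1 : Btw I A B C) (t2 : Btw I C A B) : False :=
  h.btw_unique t1 t2.symm

/-- `A-B-C` and `A-C-D` give `A-B-D` and `B-C-D`. -/
theorem btw_nest (h : Axioms I) {A B C D : P} (t1 : Btw I A B C) (t2 : Btw I A C D) :
    Btw I A B D ∧ Btw I B C D := by
  obtain ⟨n, hA, hB, hC⟩ := t1.line
  have hD := t2.mem3 h hA hC
  have hBD : B ≠ D := by rintro rfl; exact h.btw_swap t1 t2
  rcases h.btw_total t1.ne12 hBD t2.ne13 hA hB hD with a | a | a <;>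
  rcases h.btw_total t1.ne23 t2.ne23 hBD hB hC hD with b | b | b
  · exact (h.btw_path t1.symm t2.symm a.symm).elim
  · exact (h.btw_path t1.symm t2.symm a.symm).elim
  · exact (h.btw_path t1.symm t2.symm a.symm).elim
  · exact (h.btw_fork t1 a b).elim
  · exact ⟨a, b⟩
  · exact (h.btw_path b t1 t2).elim
  · exact (h.btw_path b t2 a).elim
  · exact (h.btw_path b.symm a t1).elim
  · exact (h.btw_path b t1 t2).elim

/-- No point lies on a side of a cyclic square of betweenness. -/
theorem btw_square_aux (h : Axioms I) {A B C D E : P} (t1 : Btw I C A D) (t2 : Btw I C B D)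
    (t3 : Btw I A C B) (t4 : Btw I A D B) (hEB : E ≠ B) (t : Btw I A E C) : False := by
  obtain ⟨n, hA, hE, hC⟩ := t.line
  have hB := t3.mem3 h hA hC
  have hD := t1.mem3 h hC hA
  obtain ⟨a1, a2⟩ := h.btw_nest t t3
  obtain ⟨b1, b2⟩ := h.btw_nest t.symm t1
  have hED : E ≠ D := by rintro rfl; exact h.btw_swap t1 t.symm
  rcases h.btw_total hEB t2.ne23 hED hE hB hD with q | q | q
  · exact h.btw_swap b2 (h.btw_nest q t4.symm).2
  · exact h.btw_unique a2 (h.btw_nest q.symm b1.symm).2.symm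
  · exact h.btw_swap' b2 (h.btw_nest q.symm a1.symm).2

/-- This cyclic arrangement of four points is compatible with `btw_fork` and `btw_path`, so a fifth
point is needed. It cannot lie on a side of the square, and from outside its position is carried
around the square until it contradicts itself. -/
theorem btw_square (h : Axioms I) {A B C D : P} (t1 : Btw I C A D) (t2 : Btw I C B D)
    (t3 : Btw I A C B) (t4 : Btw I A D B) : False := by
  obtain ⟨n, hA, hC, hB⟩ := t3.line
  have hD := t1.mem3 h hC hA
  obtain ⟨E, hE, hEA, hEB, hEC, hED⟩ := h.five_points n A B C D
  have s1 : ¬ Btw I A E C := h.btw_square_aux t1 t2 t3 t4 hEB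
  have s2 : ¬ Btw I C E B := h.btw_square_aux t3.symm t4.symm t2 t1 hED
  have s3 : ¬ Btw I B E D := h.btw_square_aux t2.symm t1.symm t4.symm t3.symm hEA
  have s4 : ¬ Btw I D E A := h.btw_square_aux t4 t3 t1.symm t2.symm hEC
  have dir : ∀ A B C D : P, I A n → I B n → I C n → I D n → E ≠ A → E ≠ B → E ≠ C → E ≠ D →
      Btw I C A D → Btw I C B D → Btw I A C B → Btw I A D B → ¬ Btw I C E B → ¬ Btw I B E D →
      ¬ Btw I D E A → Btw I E A C → False := by
    intro A B C D hA hB hC hD hEA hEB hEC hED t1 t2 t3 t4 s2 s3 s4 q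
    have q1 : Btw I E D A := by
      rcases h.btw_total hEA t1.ne23 hED hE hA hD with w | w | w
      · exact (s4 w.symm).elim
      · exact (h.btw_fork q w t1).elim
      · exact w
    have q2 : Btw I E B D := by
      rcases h.btw_total hEB t2.ne23 hED hE hB hD with w | w | w
      · exact (s3 w).elim
      · exact w
      · exact (h.btw_fork q1 w t4).elim
    have q3 : Btw I E C B := by
      rcases h.btw_total hEB t2.ne12.symm hEC hE hB hC with w | w | w
      · exact (s2 w.symm).elim
      · exact (h.btw_fork w q2 t2).elim
      · exact w
    obtain ⟨r, -⟩ := h.btw_nest q2 q1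
    obtain ⟨r, -⟩ := h.btw_nest q3 r
    exact h.btw_swap q r
  rcases h.btw_total hEA t3.ne12 hEC hE hA hC with w | w | w
  · exact s1 w
  · exact dir A B C D hA hB hC hD hEA hEB hEC hED t1 t2 t3 t4 s2 s3 s4 w
  · exact dir C D A B hC hD hA hB hEC hED hEA hEB t3 t4 t1 t2 (fun x => s4 x.symm)
      (fun x => s3 x.symm) (fun x => s2 x.symm) w

/-- `A-B-C` and `B-C-D` give `A-B-D` and `A-C-D`. -/
theorem btw_chain (h : Axioms I) {A B C D : P} (t1 : Btw I A B C) (t2 : Btw I B C D) :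
    Btw I A B D ∧ Btw I A C D := by
  obtain ⟨n, hA, hB, hC⟩ := t1.line
  have hD := t2.mem3 h hB hC
  have hAD : A ≠ D := by rintro rfl; exact h.btw_swap t1 t2.symm
  suffices Btw I A C D from ⟨(h.btw_nest t1 this).1, this⟩
  rcases h.btw_total t1.ne13 t2.ne23 hAD hA hC hD with q | q | q
  · exact (h.btw_unique t2 (h.btw_nest t1.symm q).1).elim
  · exact q
  · rcases h.btw_total t1.ne12 t2.ne13 hAD hA hB hD with a | a | a
    · exact (h.btw_square a t2 t1 q).elim
    · exact (h.btw_path t2 a q).elim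
    · exact (h.btw_path t2.symm a t1).elim

/-- Of `X-D-Z` and `Y-D-Z` one holds if `X-D-Y`. -/
theorem btw_split (h : Axioms I) {n : L} {X Y Z D : P} (t : Btw I X D Y) (hX : I X n) (hD : I D n)
    (hZ : I Z n) (hZD : Z ≠ D) : Btw I X D Z ∨ Btw I Y D Z := by
  by_cases e1 : Z = X
  · subst e1; exact Or.inr t.symm
  by_cases e2 : Z = Y
  · subst e2; exact Or.inl t
  rcases h.btw_total t.ne12 hZD.symm (Ne.symm e1) hX hD hZ with q | q | q
  · exact Or.inr (h.btw_chain q.symm t).2.symm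
  · exact Or.inl q
  · exact Or.inr (h.btw_nest q t).2.symm

/-- `X` and `Y` on the same side of `D` on a line. -/
theorem not_btw_trans (h : Axioms I) {n : L} {X Y Z D : P} (hX : I X n) (hD : I D n)
    (hY : I Y n) (hYD : Y ≠ D) (t1 : ¬ Btw I X D Y) (t2 : ¬ Btw I Y D Z) : ¬ Btw I X D Z := fun t =>
  (h.btw_split t hX hD hY hYD).elim t1 fun q => t2 q.symm

/-- A line through inner points of two sides of a triangle, counted from the common vertex `A`, and
the third side: `A-D-B`, `A-C-E` imply that `DE` and `BC` have a common point. -/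
theorem cross (h : Axioms I) {A B C D E : P} {k c : L} (t1 : Btw I A D B) (t2 : Btw I A C E)
    (hA : ¬ I A k) (hD : I D k) (hE : I E k) (hB : I B c) (hC : I C c) : Tch I k c := by
  by_contra n
  have hEc : ¬ I E c := fun hh => n ⟨E, hE, hh⟩
  obtain ⟨e, he, b1, b2⟩ := h.avoid_ne hEc k
  obtain ⟨a, ha, d1, d2⟩ := h.avoid hA ⟨E, he, hE⟩ b2
  have c1 : Tch I c a := (t2.apex h hC ha he d2).resolve_right fun t => b1 t.symm
  exact (t1.apex h hD ha hB c1.symm).elim (fun t => d1 t.symm) n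

end Axioms

/-- Four lines in general position. -/
structure Quad (I : P → L → Prop) (p q r s : L) (pq pr ps qr qs rs : P) : Prop where
  p1 : I pq p
  p2 : I pr p
  p3 : I ps p
  q1 : I pq q
  q2 : I qr q
  q3 : I qs q
  r1 : I pr r
  r2 : I qr r
  r3 : I rs r
  s1 : I ps s
  s2 : I qs s
  s3 : I rs s
  npq : p ≠ q
  n1 : ¬ I pq r
  n2 : ¬ I pq s
  n3 : ¬ I pr s
  n4 : ¬ I qr s

/-! ### Parity: a line crossing the three side lines of a triangle. -/

namespace Quad

variable {p q r s : L} {pq pr ps qr qs rs : P}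

theorem npr (Q : Quad I p q r s pq pr ps qr qs rs) : p ≠ r := by rintro rfl; exact Q.n1 Q.p1
theorem nqr (Q : Quad I p q r s pq pr ps qr qs rs) : q ≠ r := by rintro rfl; exact Q.n1 Q.q1
theorem nps (Q : Quad I p q r s pq pr ps qr qs rs) : p ≠ s := by rintro rfl; exact Q.n2 Q.p1
theorem nqs (Q : Quad I p q r s pq pr ps qr qs rs) : q ≠ s := by rintro rfl; exact Q.n2 Q.q1
theorem nrs (Q : Quad I p q r s pq pr ps qr qs rs) : r ≠ s := by rintro rfl; exact Q.n3 Q.r1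

/-- Exchange the first two lines. -/
theorem sw12 (Q : Quad I p q r s pq pr ps qr qs rs) (_ : Axioms I) :
    Quad I q p r s pq qr qs pr ps rs where
  p1 := Q.q1
  p2 := Q.q2
  p3 := Q.q3
  q1 := Q.p1
  q2 := Q.p2
  q3 := Q.p3
  r1 := Q.r2
  r2 := Q.r1
  r3 := Q.r3
  s1 := Q.s2
  s2 := Q.s1
  s3 := Q.s3
  npq := Q.npq.symm
  n1 := Q.n1
  n2 := Q.n2
  n3 := Q.n4
  n4 := Q.n3

/-- Exchange the middle two lines. -/
theorem sw23 (Q : Quad I p q r s pq pr ps qr qs rs) (h : Axioms I) :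
    Quad I p r q s pr pq ps qr rs qs where
  p1 := Q.p2
  p2 := Q.p1
  p3 := Q.p3
  q1 := Q.r1
  q2 := Q.r2
  q3 := Q.r3
  r1 := Q.q1
  r2 := Q.q2
  r3 := Q.q3
  s1 := Q.s1
  s2 := Q.s3
  s3 := Q.s2
  npq := Q.npr
  n1 := fun hh => Q.n1 (h.eq_pt Q.npq Q.p2 hh Q.p1 Q.q1 ▸ Q.r1)
  n2 := Q.n3
  n3 := Q.n2
  n4 := Q.n4

/-- Exchange the last two lines. -/
theorem sw34 (Q : Quad I p q r s pq pr ps qr qs rs) (h : Axioms I) :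
    Quad I p q s r pq ps pr qs qr rs where
  p1 := Q.p1
  p2 := Q.p3
  p3 := Q.p2
  q1 := Q.q1
  q2 := Q.q3
  q3 := Q.q2
  r1 := Q.s1
  r2 := Q.s2
  r3 := Q.s3
  s1 := Q.r1
  s2 := Q.r2
  s3 := Q.r3
  npq := Q.npq
  n1 := Q.n2
  n2 := Q.n1
  n3 := fun hh => Q.n3 (h.eq_pt Q.npr Q.p3 hh Q.p2 Q.r1 ▸ Q.s1)
  n4 := fun hh => Q.n4 (h.eq_pt Q.nqr Q.q3 hh Q.q2 Q.r2 ▸ Q.s2)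

/-- Lines missing `s` are constructed through `qr`, `pq` and `pr` in turn, the last one still
meeting the line `c'` through `qr`. Since `rs` is between `pr` and `qr`, the line `s` would have to
meet one of these two. -/
theorem path (Q : Quad I p q r s pq pr ps qr qs rs) (h : Axioms I) (t1 : Btw I pr pq ps)
    (t2 : Btw I pq qr qs) (t3 : Btw I pr rs qr) : False := by
  obtain ⟨c, c', hc, hc', a1, a2, hcc⟩ := h.avoid_two Q.n4
  have ka : ∀ {c a}, I qr c → ¬ Tch I c s → I pr a → ¬ Tch I a s → ¬ Tch I a c := fun hc n1 ha n2 t =>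
    (t3.apex h Q.s3 ha hc t).elim (fun t => n2 t.symm) (fun t => n1 t.symm)
  have hBc : ¬ I pq c := fun hh => by
    obtain rfl := h.eq_line t2.ne12 hh hc Q.q1 Q.q2
    exact a1 ⟨qs, Q.q3, Q.s2⟩
  obtain ⟨b, hb, b1, b2⟩ := h.avoid hBc ⟨qr, hc', hc⟩ hcc.symm
  have b3 : ¬ Tch I b s := fun t => (t2.apex h hc hb Q.s2 t).elim (fun t => b1 t.symm) a1
  have hAb : ¬ I pr b := fun hh => by
    obtain rfl := h.eq_line t1.ne12 hh hb Q.p2 Q.p1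
    exact b3 ⟨ps, Q.p3, Q.s1⟩
  obtain ⟨a, ha, d1, d2⟩ := h.avoid hAb b2.symm (by rintro rfl; exact b1 ⟨qr, hc', hc⟩)
  have d3 : ¬ Tch I a s := fun t => (t1.apex h hb ha Q.s1 t).elim (fun t => d1 t.symm) b3
  exact ka hc' a2 ha d3 d2

theorem double (Q : Quad I p q r s pq pr ps qr qs rs) (h : Axioms I) (t1 : Btw I pr pq ps)
    (t3 : Btw I pr rs qr) (t4 : Btw I ps rs qs) : False := by
  have hQ : ¬ I rs q := fun hh => Q.n4 (h.eq_pt Q.nqr Q.q2 Q.r2 hh Q.r3 ▸ Q.s3)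
  obtain ⟨x, y, hx, hy, a1, a2, hxy⟩ := h.avoid_two hQ
  have ka : ∀ {a x}, I pr a → I rs x → ¬ Tch I x q → ¬ Tch I a x → ¬ Tch I a q :=
    fun ha hx n1 n2 t => (t3.apex h hx ha Q.q2 t).elim (fun t => n2 t.symm) n1
  have kb : ∀ {a x}, I ps a → I rs x → ¬ Tch I x q → ¬ Tch I a x → ¬ Tch I a q :=
    fun ha hx n1 n2 t => (t4.apex h hx ha Q.q3 t).elim (fun t => n2 t.symm) n1
  have hAx : ¬ I pr x := fun hh => by
    obtain rfl := h.eq_line t3.ne12 hh hx Q.r1 Q.r3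
    exact a1 ⟨_, Q.r2, Q.q2⟩
  obtain ⟨a, ha, b1, b2⟩ := h.avoid hAx ⟨rs, hy, hx⟩ hxy.symm
  have hBy : ¬ I ps y := fun hh => by
    obtain rfl := h.eq_line t4.ne12 hh hy Q.s1 Q.s3
    exact a2 ⟨_, Q.s2, Q.q3⟩
  obtain ⟨b, hb, c1, c2⟩ := h.avoid hBy b2 (by rintro rfl; exact b1 ⟨rs, hy, hx⟩)
  exact (t1.apex h Q.q1 ha hb c2.symm).elim (fun t => ka ha hx a1 b1 t.symm)
    (fun t => kb hb hy a2 c1 t.symm)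

/-- The lines `m` from `qs` to `pr` and `n` from `rs` to `pq` cross at a point `G`, which the
earlier exclusions force to be between the ends on both of them. The four lines `s`, `p`, `m`, `n`
then contradict `double`. -/
theorem indeg (Q : Quad I p q r s pq pr ps qr qs rs) (h : Axioms I) (t1 : Btw I pq ps pr)
    (t2 : Btw I pq qs qr) (t3 : Btw I pr rs qr) (t4 : Btw I qs ps rs) : False := by
  obtain ⟨m, hm1, hm2⟩ := h.exists_line qs pr
  obtain ⟨n, hn1, hn2⟩ := h.exists_line rs pq
  have hBm : ¬ I qr m := fun hh => by
    obtain rfl := h.eq_line t2.ne23 hm1 hh Q.q3 Q.q2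
    exact Q.nqr (h.eq_line t3.ne13 hm2 hh Q.r1 Q.r2)
  obtain ⟨G, hG1, hG2⟩ := h.cross t2.symm t3.symm hBm hm1 hm2 hn2 hn1
  have hrq : ¬ I rs q := fun hh => Q.n4 (h.eq_pt Q.nqr Q.q2 Q.r2 hh Q.r3 ▸ Q.s3)
  have hpq : ¬ I pr q := fun hh => Q.nqr (h.eq_line t3.ne13 hh Q.q2 Q.r1 Q.r2)
  have hnq : n ≠ q := by rintro rfl; exact hrq hn1
  have hmq : m ≠ q := by rintro rfl; exact hpq hm2
  have hCn : ¬ I qs n := fun hh => hnq (h.eq_line t2.ne12.symm hh hn2 Q.q3 Q.q1)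
  have hmn : m ≠ n := by rintro rfl; exact hCn hm1
  have hFn : ¬ I pr n := fun hh => Q.n1 ((h.eq_line t3.ne12 hh hn1 Q.r1 Q.r3) ▸ hn2)
  have hBn : ¬ I qr n := fun hh => hrq ((h.eq_line t2.ne13 hn2 hh Q.q1 Q.q2) ▸ hn1)
  have Q1 : Quad I q r m n qr qs pq pr rs G :=
    ⟨Q.q2, Q.q3, Q.q1, Q.r2, Q.r1, Q.r3, hm1, hm2, hG1, hn2, hn1, hG2, Q.nqr, hBm, hBn, hCn, hFn⟩
  have hGC : G ≠ qs := by rintro rfl; exact hCn hG2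
  have hGF : G ≠ pr := by rintro rfl; exact hFn hG2
  have hDm : ¬ I pq m := fun hh => hmq (h.eq_line t2.ne12 hh hm1 Q.q1 Q.q3)
  have hAm : ¬ I rs m := fun hh => by
    have := h.eq_line t3.ne12 hm2 hh Q.r1 Q.r3
    subst this
    exact Q.n4 (h.eq_pt Q.nqr Q.q2 Q.r2 Q.q3 hm1 ▸ Q.s2)
  have hGD : G ≠ pq := by rintro rfl; exact hDm hG1
  have hGA : G ≠ rs := by rintro rfl; exact hAm hG1
  have hCF : qs ≠ pr := by rintro rfl; exact hpq Q.q3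
  have hDA : pq ≠ rs := by rintro rfl; exact Q.n1 Q.r3
  have e : Btw I qs G pr ∧ Btw I pq G rs := by
    rcases h.btw_total hGC.symm hGF hCF hm1 hG1 hm2 with u | u | u <;>
    rcases h.btw_total hGD.symm hGA hDA hn2 hG2 hn1 with w | w | w
    · exact ((((Q1.sw12 h).sw34 h).sw23 h).path h t3.symm w.symm t2.symm).elim
    · exact (((((Q1.sw12 h).sw23 h).sw34 h).sw23 h).path h t3 w.symm u.symm).elim
    · exact ((Q1.sw23 h).double h t2.symm t3.symm w).elim
    · exact ((((Q1.sw12 h).sw34 h).sw23 h).path h t3.symm w.symm t2.symm).elim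
    · exact ⟨u, w⟩
    · exact (((Q1.sw23 h).sw34 h).path h t2 u w).elim
    all_goals exact ((Q1.sw23 h).path h t2.symm u t3.symm).elim
  have hps : ¬ I ps m := fun hh => by
    obtain rfl := h.eq_line t1.ne23 hh hm2 Q.p3 Q.p2
    exact Q.n2 (h.eq_pt Q.npq Q.p1 Q.q1 hm1 Q.q3 ▸ Q.s2)
  have hps' : ¬ I ps n := fun hh => by
    obtain rfl := h.eq_line t1.ne12 hn2 hh Q.p1 Q.p3
    exact Q.n3 (h.eq_pt Q.npr Q.p2 Q.r1 hn1 Q.r3 ▸ Q.s3)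
  have hsp := Q.nps.symm
  exact Quad.double (⟨Q.s1, Q.s2, Q.s3, Q.p3, Q.p2, Q.p1, hm1, hm2, hG1, hn1, hn2, hG2, hsp, hps, hps',
    hCn, hFn⟩ : Quad I s p m n ps qs rs pr pq G) h t4 e.1 e.2.symm

/-- One of the three points on `s` is between the other two, and relabelling the sides reduces every
choice to `indeg`. -/
theorem not_three (Q : Quad I p q r s pq pr ps qr qs rs) (h : Axioms I) (t1 : Btw I pq ps pr)
    (t2 : Btw I pq qs qr) (t3 : Btw I pr rs qr) : False := by
  have e1 : ps ≠ qs := by rintro e; exact Q.n2 (h.eq_pt Q.npq Q.p3 (e ▸ Q.q3) Q.p1 Q.q1 ▸ Q.s1)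
  have e2 : qs ≠ rs := by rintro e; exact Q.n4 (h.eq_pt Q.nqr Q.q3 (e ▸ Q.r3) Q.q2 Q.r2 ▸ Q.s2)
  have e3 : ps ≠ rs := by rintro e; exact Q.n3 (h.eq_pt Q.npr Q.p3 (e ▸ Q.r3) Q.p2 Q.r1 ▸ Q.s1)
  rcases h.btw_total e1 e2 e3 Q.s1 Q.s2 Q.s3 with u | u | u
  · exact Q.indeg h t1 t2 t3 u
  · exact (Q.sw12 h).indeg h t2 t1 t3.symm u
  · exact ((Q.sw23 h).sw12 h).indeg h t3 t1.symm t2.symm u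

/-- If `s` left the triangle through neither of the other two sides, the positions of the middle
points on `q`, `r` and `s` would, up to relabelling, give one of the forbidden patterns `path`,
`double` and `not_three`. -/
theorem two (Q : Quad I p q r s pq pr ps qr qs rs) (h : Axioms I) (t : Btw I pq ps pr) :
    Btw I pq qs qr ∨ Btw I pr rs qr := by
  have e1 : ps ≠ qs := by rintro e; exact Q.n2 (h.eq_pt Q.npq Q.p3 (e ▸ Q.q3) Q.p1 Q.q1 ▸ Q.s1)
  have e2 : qs ≠ rs := by rintro e; exact Q.n4 (h.eq_pt Q.nqr Q.q3 (e ▸ Q.r3) Q.q2 Q.r2 ▸ Q.s2)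
  have e3 : ps ≠ rs := by rintro e; exact Q.n3 (h.eq_pt Q.npr Q.p3 (e ▸ Q.r3) Q.p2 Q.r1 ▸ Q.s1)
  have e4 : pq ≠ qr := by rintro e; exact Q.n1 (e ▸ Q.r2)
  have e5 : pr ≠ qr := by rintro e; exact Q.n1 (h.eq_pt Q.npq Q.p2 (e ▸ Q.q2) Q.p1 Q.q1 ▸ Q.r1)
  have e6 : pq ≠ qs := by rintro e; exact Q.n2 (e ▸ Q.s2)
  have e7 : qr ≠ qs := by rintro e; exact Q.n4 (e ▸ Q.s2)
  have e8 : pr ≠ rs := by rintro e; exact Q.n3 (e ▸ Q.s3)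
  have e9 : qr ≠ rs := by rintro e; exact Q.n4 (e ▸ Q.s3)
  by_contra hc
  push Not at hc
  rcases h.btw_total e4 e7 e6 Q.q1 Q.q2 Q.q3 with u | u | u <;>
  rcases h.btw_total e5 e9 e8 Q.r1 Q.r2 Q.r3 with v | v | v
  · rcases h.btw_total e1 e2 e3 Q.s1 Q.s2 Q.s3 with w | w | w
    · exact (((Q.sw12 h).sw23 h).sw34 h).not_three h u v w
    · exact (((Q.sw23 h).sw12 h).sw34 h).path h v.symm t.symm w.symm
    · exact ((Q.sw12 h).sw34 h).path h u.symm t w.symm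
  · exact (((Q.sw12 h).sw23 h).sw12 h).path h v u t.symm
  · exact hc.2 v
  · exact ((Q.sw12 h).sw23 h).path h u v t
  · rcases h.btw_total e1 e2 e3 Q.s1 Q.s2 Q.s3 with w | w | w
    · exact ((Q.sw12 h).sw23 h).double h u t w
    · exact ((Q.sw34 h).sw23 h).path h t w u
    · exact (((Q.sw23 h).sw34 h).sw23 h).path h t.symm w v
  · exact hc.2 v
  all_goals exact hc.1 u

/-- A line cutting the three sides of a triangle cuts an even number of them internally. -/
theorem xor (Q : Quad I p q r s pq pr ps qr qs rs) (h : Axioms I) (t : Btw I pq ps pr) :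
    Btw I pq qs qr ↔ ¬ Btw I pr rs qr :=
  ⟨fun t2 t3 => Q.not_three h t t2 t3, fun n => (Q.two h t).resolve_right n⟩

theorem iff (Q : Quad I p q r s pq pr ps qr qs rs) (h : Axioms I) (t : ¬ Btw I pq ps pr) :
    Btw I pq qs qr ↔ Btw I pr rs qr :=
  ⟨fun t2 => (((Q.sw12 h).two h t2).resolve_left t).symm,
    fun t3 => (((Q.sw23 h).sw12 h).two h t3).elim (fun u => (t u.symm).elim) fun u => u.symm⟩

theorem even (Q : Quad I p q r s pq pr ps qr qs rs) (h : Axioms I) :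
    Btw I pq ps pr ↔ ¬ (Btw I pq qs qr ↔ Btw I pr rs qr) := by
  have a := Q.xor h
  have b := Q.iff h
  tauto

/-- Which of the three points on each of the four lines is the middle one. -/
theorem table (Q : Quad I p q r s pq pr ps qr qs rs) (h : Axioms I) :
    ((Btw I pq ps pr ↔ ¬ (Btw I pq qs qr ↔ Btw I pr rs qr)) ∧
     (Btw I pq pr ps ↔ ¬ (Btw I pq qr qs ↔ Btw I ps rs qs)) ∧
     (Btw I pr pq ps ↔ ¬ (Btw I pr qr rs ↔ Btw I ps qs rs)) ∧
     (Btw I qr pq qs ↔ ¬ (Btw I qr pr rs ↔ Btw I qs ps rs))) ∧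
    ((Btw I pr pq ps ∨ Btw I pq pr ps ∨ Btw I pq ps pr) ∧
     (Btw I qr pq qs ∨ Btw I pq qr qs ∨ Btw I pq qs qr) ∧
     (Btw I qr pr rs ∨ Btw I pr qr rs ∨ Btw I pr rs qr) ∧
     (Btw I qs ps rs ∨ Btw I ps qs rs ∨ Btw I ps rs qs)) ∧
    ((¬ (Btw I pr pq ps ∧ Btw I pq pr ps) ∧ ¬ (Btw I pr pq ps ∧ Btw I pq ps pr) ∧
      ¬ (Btw I pq pr ps ∧ Btw I pq ps pr)) ∧
     (¬ (Btw I qr pq qs ∧ Btw I pq qr qs) ∧ ¬ (Btw I qr pq qs ∧ Btw I pq qs qr) ∧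
      ¬ (Btw I pq qr qs ∧ Btw I pq qs qr)) ∧
     (¬ (Btw I qr pr rs ∧ Btw I pr qr rs) ∧ ¬ (Btw I qr pr rs ∧ Btw I pr rs qr) ∧
      ¬ (Btw I pr qr rs ∧ Btw I pr rs qr)) ∧
     (¬ (Btw I qs ps rs ∧ Btw I ps qs rs) ∧ ¬ (Btw I qs ps rs ∧ Btw I ps rs qs) ∧
      ¬ (Btw I ps qs rs ∧ Btw I ps rs qs))) := by
  have e1 : ps ≠ qs := by rintro e; exact Q.n2 (h.eq_pt Q.npq Q.p3 (e ▸ Q.q3) Q.p1 Q.q1 ▸ Q.s1)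
  have e2 : qs ≠ rs := by rintro e; exact Q.n4 (h.eq_pt Q.nqr Q.q3 (e ▸ Q.r3) Q.q2 Q.r2 ▸ Q.s2)
  have e3 : ps ≠ rs := by rintro e; exact Q.n3 (h.eq_pt Q.npr Q.p3 (e ▸ Q.r3) Q.p2 Q.r1 ▸ Q.s1)
  have e4 : pq ≠ qr := by rintro e; exact Q.n1 (e ▸ Q.r2)
  have e5 : pr ≠ qr := by rintro e; exact Q.n1 (h.eq_pt Q.npq Q.p2 (e ▸ Q.q2) Q.p1 Q.q1 ▸ Q.r1)
  have e6 : pq ≠ qs := by rintro e; exact Q.n2 (e ▸ Q.s2)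
  have e7 : qr ≠ qs := by rintro e; exact Q.n4 (e ▸ Q.s2)
  have e8 : pr ≠ rs := by rintro e; exact Q.n3 (e ▸ Q.s3)
  have e9 : qr ≠ rs := by rintro e; exact Q.n4 (e ▸ Q.s3)
  have e10 : pq ≠ pr := by rintro e; exact Q.n1 (e ▸ Q.r1)
  have e11 : pq ≠ ps := by rintro e; exact Q.n2 (e ▸ Q.s1)
  have e12 : pr ≠ ps := by rintro e; exact Q.n3 (e ▸ Q.s1)
  have tot : ∀ {n : L} {X Y Z : P}, X ≠ Y → Y ≠ Z → X ≠ Z → I X n → I Y n → I Z n →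
      Btw I Y X Z ∨ Btw I X Y Z ∨ Btw I X Z Y := fun a b c d e f => h.btw_total a b c d e f
  have uni : ∀ X Y Z : P, ¬ (Btw I Y X Z ∧ Btw I X Y Z) ∧ ¬ (Btw I Y X Z ∧ Btw I X Z Y) ∧
      ¬ (Btw I X Y Z ∧ Btw I X Z Y) := fun X Y Z =>
    ⟨fun ⟨a, b⟩ => h.btw_unique a b, fun ⟨a, b⟩ => h.btw_swap a b.symm, fun ⟨a, b⟩ =>
      h.btw_swap a b⟩
  have c := @btw_comm P L I
  refine ⟨⟨Q.even h, (Q.sw34 h).even h, ?_, ?_⟩,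
    ⟨tot e10 e12 e11 Q.p1 Q.p2 Q.p3, tot e4 e7 e6 Q.q1 Q.q2 Q.q3, tot e5 e9 e8 Q.r1 Q.r2 Q.r3,
      tot e1 e2 e3 Q.s1 Q.s2 Q.s3⟩, ⟨uni _ _ _, uni _ _ _, uni _ _ _, uni _ _ _⟩⟩
  · simpa only [c (A := rs)] using ((Q.sw23 h).sw34 h).even h
  · exact (((Q.sw12 h).sw23 h).sw34 h).even h

/-- If neither on `p` nor on `q` the common point is the middle one. -/
theorem mids (Q : Quad I p q r s pq pr ps qr qs rs) (h : Axioms I) (hp : ¬ Btw I pr pq ps)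
    (hq : ¬ Btw I qr pq qs) :
    (Btw I pr rs qr ↔ Btw I ps rs qs) ∧ (Btw I pr rs qr → (Btw I pq pr ps ↔ Btw I pq qs qr)) ∧
      (¬ Btw I pr rs qr → (Btw I pq pr ps ↔ Btw I pq qr qs)) := by
  have := Q.table h
  grind

end Quad
end HypInc

/-! ### A failure of Pasch's axiom is contradictory. -/

namespace HypInc

universe u v

variable {P : Type u} {L : Type v} {I : P → L → Prop}

/-- A configuration violating Pasch's axiom: `k` meets the sides `AC` and the extension of `BC`
but misses `AB`. -/
structure NonPasch (I : P → L → Prop) where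
  h : Axioms I
  (A B C D E : P)
  (k l a p q c1 c2 r1 r2 u1 u2 : L)
  tE : Btw I C E A
  tD : Btw I B C D
  Dk : I D k
  Ek : I E k
  Al : I A l
  Bl : I B l
  Aa : I A a
  Ap : I A p
  Cp : I C p
  Bq : I B q
  Cq : I C q
  npq : p ≠ q
  kl : ¬ Tch I k l
  ka : ¬ Tch I k a
  al : a ≠ l
  cov : ∀ f, Tch I f k → f ≠ k → Tch I f l ∨ Tch I f a
  Cc1 : I C c1
  Cc2 : I C c2
  kc1 : ¬ Tch I k c1
  kc2 : ¬ Tch I k c2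
  nc : c1 ≠ c2
  Dr1 : I D r1
  Dr2 : I D r2
  r1c1 : ¬ Tch I r1 c1
  r1c2 : Tch I r1 c2
  r2c2 : ¬ Tch I r2 c2
  r2c1 : Tch I r2 c1
  Au1 : I A u1
  Au2 : I A u2
  u1c1 : ¬ Tch I u1 c1
  u1c2 : Tch I u1 c2
  u2c2 : ¬ Tch I u2 c2
  u2c1 : Tch I u2 c1

namespace NonPasch

/-- Exchange the indices 1 and 2. -/
def swap (F : NonPasch I) : NonPasch I where
  h := F.h
  A := F.A
  B := F.B
  C := F.C
  D := F.D
  E := F.E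
  k := F.k
  l := F.l
  a := F.a
  p := F.p
  q := F.q
  c1 := F.c2
  c2 := F.c1
  r1 := F.r2
  r2 := F.r1
  u1 := F.u2
  u2 := F.u1
  tE := F.tE
  tD := F.tD
  Dk := F.Dk
  Ek := F.Ek
  Al := F.Al
  Bl := F.Bl
  Aa := F.Aa
  Ap := F.Ap
  Cp := F.Cp
  Bq := F.Bq
  Cq := F.Cq
  npq := F.npq
  kl := F.kl
  ka := F.ka
  al := F.al
  cov := F.cov
  Cc1 := F.Cc2
  Cc2 := F.Cc1
  kc1 := F.kc2
  kc2 := F.kc1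
  nc := F.nc.symm
  Dr1 := F.Dr2
  Dr2 := F.Dr1
  r1c1 := F.r2c2
  r1c2 := F.r2c1
  r2c2 := F.r1c1
  r2c1 := F.r1c2
  Au1 := F.Au2
  Au2 := F.Au1
  u1c1 := F.u2c2
  u1c2 := F.u2c1
  u2c2 := F.u1c1
  u2c1 := F.u1c2

variable (F : NonPasch I)

theorem Ep : I F.E F.p := F.tE.mem2 F.h F.Cp F.Ap
theorem Dq : I F.D F.q := F.tD.mem3 F.h F.Bq F.Cq
theorem Dp : ¬ I F.D F.p := fun hh => F.npq (F.h.eq_line F.tD.ne23 F.Cp hh F.Cq F.Dq)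
theorem nkp : F.k ≠ F.p := fun e => F.Dp (e ▸ F.Dk)
theorem Ak : ¬ I F.A F.k := fun hh => F.nkp (F.h.eq_line F.tE.ne23 F.Ek hh F.Ep F.Ap)
/-- A line through `C` missing `k` misses every line through `A` missing `k`. -/
theorem miss {c x : L} (hc : I F.C c) (kc : ¬ Tch I F.k c) (hx : I F.A x) (kx : ¬ Tch I F.k x) :
    ¬ Tch I c x := fun t => (F.tE.apex F.h F.Ek hc hx t).elim kc kx

theorem lc1 : ¬ Tch I F.l F.c1 := fun t => F.miss F.Cc1 F.kc1 F.Al F.kl t.symm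
theorem lc2 : ¬ Tch I F.l F.c2 := F.swap.lc1
theorem ac1 : ¬ Tch I F.a F.c1 := fun t => F.miss F.Cc1 F.kc1 F.Aa F.ka t.symm
theorem ac2 : ¬ Tch I F.a F.c2 := F.swap.ac1

theorem lr1 : ¬ Tch I F.l F.r1 := fun t =>
  (F.tD.apex F.h F.Cc1 F.Bl F.Dr1 t).elim (fun t => F.lc1 t.symm) (fun t => F.r1c1 t.symm)
theorem lr2 : ¬ Tch I F.l F.r2 := F.swap.lr1

theorem ku1 : Tch I F.k F.u1 := by
  by_contra n
  exact F.miss F.Cc2 F.kc2 F.Au1 n F.u1c2.symm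
theorem ku2 : Tch I F.k F.u2 := F.swap.ku1

theorem nr1k : F.r1 ≠ F.k := fun e => F.kc2 (e ▸ F.r1c2)
theorem ar1 : Tch I F.a F.r1 :=
  ((F.cov _ ⟨_, F.Dr1, F.Dk⟩ F.nr1k).resolve_left fun t => F.lr1 t.symm).symm

theorem Ac1 : ¬ I F.A F.c1 := fun hh => F.kc1 (F.h.eq_line F.tE.ne13 F.Cc1 hh F.Cp F.Ap ▸ ⟨_, F.Ek, F.Ep⟩)
theorem Dc1 : ¬ I F.D F.c1 := fun hh => F.kc1 ⟨_, F.Dk, hh⟩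

/-- An intersection `S` of `x` with `q` would have `C` between it and `B` or between it and `D`. The
line `c` through `C` would then have to meet `l` or `x`, respectively `d` or `x`, and it misses all
of them. -/
theorem miss_q {x c d : L} (hx : I F.A x) (hc : I F.C c) (kc : ¬ Tch I F.k c) (xc : ¬ Tch I x c)
    (hd : I F.D d) (cd : ¬ Tch I c d) (xd : Tch I x d) : ¬ Tch I x F.q := by
  rintro ⟨S, hS1, hS2⟩
  have hSC : S ≠ F.C := by rintro rfl; exact xc ⟨_, hS1, hc⟩
  rcases F.h.btw_split F.tD F.Bq F.Cq hS2 hSC with t | t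
  · exact (t.apex F.h hc F.Bl hS1 ⟨_, F.Al, hx⟩).elim (F.miss hc kc F.Al F.kl) fun t => xc t.symm
  · exact (t.apex F.h hc hd hS1 xd.symm).elim cd fun t => xc t.symm

theorem u1q : ¬ Tch I F.u1 F.q := F.miss_q F.Au1 F.Cc1 F.kc1 F.u1c1 F.Dk (fun t => F.kc1 t.symm) F.ku1.symm
theorem u2q : ¬ Tch I F.u2 F.q := F.swap.u1q
theorem aq : ¬ Tch I F.a F.q := F.miss_q F.Aa F.Cc1 F.kc1 F.ac1 F.Dr1 (fun t => F.r1c1 t.symm) F.ar1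

theorem Ar1 : ¬ I F.A F.r1 := fun hh => F.lr1 ⟨_, F.Al, hh⟩
theorem Ar2 : ¬ I F.A F.r2 := F.swap.Ar1
theorem Du1 : ¬ I F.D F.u1 := fun hh => F.u1q ⟨_, hh, F.Dq⟩
theorem Du2 : ¬ I F.D F.u2 := F.swap.Du1
theorem Da : ¬ I F.D F.a := fun hh => F.ka ⟨_, F.Dk, hh⟩
theorem nr : F.r1 ≠ F.r2 := fun e => F.r1c1 (e ▸ F.r2c1)
theorem nu : F.u1 ≠ F.u2 := fun e => F.u1c1 (e ▸ F.u2c1)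
theorem npu1 : F.p ≠ F.u1 := fun e => F.u1c1 ⟨F.C, e ▸ F.Cp, F.Cc1⟩
theorem npa : F.p ≠ F.a := fun e => F.ka ⟨_, F.Ek, e ▸ F.Ep⟩

/-- The line `AD` meets `c1` at a point `G` with `D` between `A` and `G`. As `r1` passes through `D`
and misses `c1`, it must leave the triangle `ACG` through the side `AC`. -/
theorem exists_E1 : ∃ X, Btw I F.A X F.C ∧ I X F.r1 := by
  obtain ⟨g, hg1, hg2⟩ := F.h.exists_line F.A F.D
  obtain ⟨G, hG1, hG2⟩ := (F.tD.apex F.h F.Cc1 F.Bl hg2 ⟨_, F.Al, hg1⟩).resolve_left fun t => F.lc1 t.symm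
  have hAD : F.A ≠ F.D := fun e => F.Du1 (e ▸ F.Au1)
  have hAG : F.A ≠ G := by rintro e; exact F.Ac1 (e ▸ hG1)
  have hDG : F.D ≠ G := by rintro e; exact F.Dc1 (e ▸ hG1)
  have t : Btw I F.A F.D G := by
    rcases F.h.btw_total hAD hDG hAG hg1 hg2 hG2 with t | t | t
    · have hDl : ¬ I F.D F.l := fun hh => F.kl ⟨_, F.Dk, hh⟩
      have : ¬ I F.D F.l := hDl
      exact (F.lc1 (F.h.cross t F.tD.symm hDl F.Al F.Bl hG1 F.Cc1)).elim
    · exact t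
    · have hAk := F.Ak
      exact (F.kc1 (F.h.cross F.tE.symm t hAk F.Ek F.Dk F.Cc1 hG1)).elim
  obtain ⟨X, hX1, hX2⟩ := (t.apex F.h F.Dr1 F.Ap hG1 ⟨_, F.Cp, F.Cc1⟩).resolve_right F.r1c1
  have hXA : F.A ≠ X := by rintro e; exact F.Ar1 (e ▸ hX1)
  have hXC : X ≠ F.C := by rintro rfl; exact F.r1c1 ⟨_, hX1, F.Cc1⟩
  refine ⟨X, ?_, hX1⟩
  rcases F.h.btw_total hXA hXC F.tE.ne13.symm F.Ap hX2 F.Cp with w | w | w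
  · exact ((w.apex F.h F.Al hX1 F.Cc2 F.r1c2).elim F.lr1 F.lc2).elim
  · exact w
  · exact (F.r1c1 (F.h.cross t w F.Ar1 F.Dr1 hX1 hG1 F.Cc1)).elim

/-- The intersection of `r1` with `AC`. -/
noncomputable def E1 : P := F.exists_E1.choose
theorem tE1 : Btw I F.A F.E1 F.C := F.exists_E1.choose_spec.1
theorem E1r : I F.E1 F.r1 := F.exists_E1.choose_spec.2
theorem E1p : I F.E1 F.p := F.tE1.mem2 F.h F.Ap F.Cp
noncomputable def E2 : P := F.swap.E1
theorem tE2 : Btw I F.A F.E2 F.C := F.swap.tE1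
theorem E2r : I F.E2 F.r2 := F.swap.E1r
theorem E2p : I F.E2 F.p := F.swap.E1p

theorem exists_T1 : Tch I F.r1 F.u2 :=
  (F.tE1.apex F.h F.E1r F.Au2 F.Cc1 F.u2c1).resolve_right F.r1c1

noncomputable def T1 : P := F.exists_T1.choose
theorem T1r : I F.T1 F.r1 := F.exists_T1.choose_spec.1
theorem T1u : I F.T1 F.u2 := F.exists_T1.choose_spec.2
noncomputable def T2 : P := F.swap.T1
theorem T2r : I F.T2 F.r2 := F.swap.T1r
theorem T2u : I F.T2 F.u1 := F.swap.T1u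

noncomputable def R1 : P := F.ar1.choose
theorem R1a : I F.R1 F.a := F.ar1.choose_spec.1
theorem R1r : I F.R1 F.r1 := F.ar1.choose_spec.2
noncomputable def R2 : P := F.swap.R1
theorem R2a : I F.R2 F.a := F.swap.R1a
theorem R2r : I F.R2 F.r2 := F.swap.R1r

noncomputable def K1 : P := F.ku1.choose
theorem K1k : I F.K1 F.k := F.ku1.choose_spec.1
theorem K1u : I F.K1 F.u1 := F.ku1.choose_spec.2
noncomputable def K2 : P := F.swap.K1
theorem K2k : I F.K2 F.k := F.swap.K1k
theorem K2u : I F.K2 F.u2 := F.swap.K1u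

/-- The intersection of `r1` and `c2`. -/
noncomputable def Q2 : P := F.r1c2.choose
theorem Q2r : I F.Q2 F.r1 := F.r1c2.choose_spec.1
theorem Q2c : I F.Q2 F.c2 := F.r1c2.choose_spec.2
noncomputable def Q1 : P := F.swap.Q2
theorem Q1r : I F.Q1 F.r2 := F.swap.Q2r
theorem Q1c : I F.Q1 F.c1 := F.swap.Q2c

/-- The intersection of `u2` and `c1`. -/
noncomputable def P2 : P := F.u2c1.choose
theorem P2u : I F.P2 F.u2 := F.u2c1.choose_spec.1
theorem P2c : I F.P2 F.c1 := F.u2c1.choose_spec.2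
theorem Q2DR1 : Btw I F.Q2 F.D F.R1 := by
  have h1 : F.Q2 ≠ F.D := fun e => F.swap.Dc1 (show I F.D F.c2 from e ▸ F.Q2c)
  have h2 : F.D ≠ F.R1 := fun e => F.Da (e ▸ F.R1a)
  have h3 : F.Q2 ≠ F.R1 := fun e => F.ac2 ⟨_, F.R1a, e ▸ F.Q2c⟩
  rcases F.h.btw_total h1 h2 h3 F.Q2r F.Dr1 F.R1r with t | t | t
  · exact ((t.apex F.h F.Q2c F.Dr2 F.R1a F.swap.ar1.symm).elim (fun t => F.r2c2 t.symm)
      fun t => F.ac2 t.symm).elim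
  · exact t
  · exact ((t.apex F.h F.R1a F.Q2c F.Dq ⟨_, F.Cc2, F.Cq⟩).elim F.ac2 F.aq).elim

theorem Q2DT1 : Btw I F.Q2 F.D F.T1 := by
  have h1 : F.Q2 ≠ F.D := fun e => F.swap.Dc1 (show I F.D F.c2 from e ▸ F.Q2c)
  have h2 : F.D ≠ F.T1 := fun e => F.Du2 (e ▸ F.T1u)
  have h3 : F.Q2 ≠ F.T1 := fun e => F.u2c2 ⟨_, F.T1u, e ▸ F.Q2c⟩
  rcases F.h.btw_total h1 h2 h3 F.Q2r F.Dr1 F.T1r with t | t | t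
  · exact ((t.apex F.h F.Q2c F.Dk F.T1u F.ku2).elim (fun t => F.kc2 t.symm)
      fun t => F.u2c2 t.symm).elim
  · exact t
  · exact ((t.apex F.h F.T1u F.Q2c F.Dq ⟨_, F.Cc2, F.Cq⟩).elim F.u2c2 F.u2q).elim

theorem Q1DT2 : Btw I F.Q1 F.D F.T2 := F.swap.Q2DT1

theorem nK : ¬ Btw I F.K1 F.D F.K2 := fun t =>
  (t.apex F.h F.Dq F.K1u F.K2u ⟨_, F.Au1, F.Au2⟩).elim (fun t => F.u1q t.symm) fun t => F.u2q t.symm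

theorem nKAT : ¬ Btw I F.K2 F.A F.T1 := fun t =>
  (t.apex F.h F.Al F.K2k F.T1r ⟨_, F.Dk, F.Dr1⟩).elim (fun t => F.kl t.symm) F.lr1

theorem nAPK : ¬ Btw I F.A F.P2 F.K2 := fun t =>
  F.kc1 (F.h.cross F.tE.symm t F.Ak F.Ek F.K2k F.Cc1 F.P2c)

theorem nAPT : ¬ Btw I F.A F.P2 F.T1 := fun t =>
  F.r1c1 (F.h.cross F.tE1 t F.Ar1 F.E1r F.T1r F.Cc1 F.P2c)

theorem nRAR : ¬ Btw I F.R1 F.A F.R2 := fun t =>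
  (t.apex F.h F.Al F.R1r F.R2r ⟨_, F.Dr1, F.Dr2⟩).elim F.lr1 F.lr2

theorem AT1 : F.A ≠ F.T1 := fun e => F.Ar1 (e ▸ F.T1r)
theorem AK2 : F.A ≠ F.K2 := fun e => F.Ak (e ▸ F.K2k)
theorem DT1 : F.D ≠ F.T1 := fun e => F.Du2 (e ▸ F.T1u)
theorem DR1 : F.D ≠ F.R1 := fun e => F.Da (e ▸ F.R1a)
theorem DK2 : F.D ≠ F.K2 := fun e => F.Du2 (e ▸ F.K2u)
theorem nau1 : F.a ≠ F.u1 := fun e => F.ka (e ▸ F.ku1)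
theorem T1k : ¬ I F.T1 F.k := fun hh => F.DT1 (F.h.eq_pt F.nr1k F.Dr1 F.Dk F.T1r hh)
theorem T1K2 : F.T1 ≠ F.K2 := fun e => F.T1k (e ▸ F.K2k)

/-- Order on `u2`. -/
theorem DTR (t : Btw I F.A F.K2 F.T1) : Btw I F.D F.T1 F.R1 := by
  have h1 : F.T1 ≠ F.R1 := fun e => F.AT1 (F.h.eq_pt F.swap.nau1 F.Aa F.Au2 (e ▸ F.R1a) F.T1u)
  rcases F.h.btw_total F.DT1 h1 F.DR1 F.Dr1 F.T1r F.R1r with w | w | w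
  · exact (F.h.btw_fork F.Q2DT1 F.Q2DR1 w).elim
  · exact w
  · exact (F.ka (F.h.cross t.symm w.symm F.T1k F.K2k F.Dk F.Aa F.R1a)).elim

theorem E1k : ¬ I F.E1 F.k := fun hh => F.nr1k (F.h.eq_line (by rintro e; exact F.Dp (e ▸ F.E1p)) F.E1r F.Dr1 hh F.Dk)

theorem quad1 : Quad I F.p F.u2 F.r1 F.k F.A F.E1 F.E F.T1 F.K2 F.D :=
  ⟨F.Ap, F.E1p, F.Ep, F.Au2, F.T1u, F.K2u, F.E1r, F.T1r, F.Dr1, F.Ek, F.K2k, F.Dk, F.swap.npu1,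
    F.Ar1, F.Ak, F.E1k, F.T1k⟩

theorem nEAE {X Y : P} (hX : Btw I F.A X F.C) (hY : Btw I F.A Y F.C) : ¬ Btw I X F.A Y := fun t =>
  (F.h.btw_split t (hX.mem2 F.h F.Ap F.Cp) F.Ap F.Cp F.tE.ne13).elim
    (fun w => F.h.btw_unique hX w) fun w => F.h.btw_unique hY w

theorem mids1 : (Btw I F.E1 F.D F.T1 ↔ Btw I F.E F.D F.K2) ∧
    (Btw I F.E1 F.D F.T1 → (Btw I F.A F.E1 F.E ↔ Btw I F.A F.K2 F.T1)) ∧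
    (¬ Btw I F.E1 F.D F.T1 → (Btw I F.A F.E1 F.E ↔ Btw I F.A F.T1 F.K2)) :=
  F.quad1.mids F.h (F.nEAE F.tE1 F.tE.symm) fun t => F.nKAT t.symm

theorem mids2 : (Btw I F.E2 F.D F.T2 ↔ Btw I F.E F.D F.K1) ∧
    (Btw I F.E2 F.D F.T2 → (Btw I F.A F.E2 F.E ↔ Btw I F.A F.K1 F.T2)) ∧
    (¬ Btw I F.E2 F.D F.T2 → (Btw I F.A F.E2 F.E ↔ Btw I F.A F.T2 F.K1)) := F.swap.mids1

theorem Dr12 {X : P} (h1 : I X F.r1) (h2 : I X F.r2) : X = F.D := F.h.eq_pt F.nr h1 h2 F.Dr1 F.Dr2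
theorem E1D : F.E1 ≠ F.D := fun e => F.Dp (e ▸ F.E1p)
theorem E1E2 : F.E1 ≠ F.E2 := fun e => F.E1D (F.Dr12 F.E1r (e ▸ F.E2r))
theorem E1E : F.E1 ≠ F.E := fun e => F.E1k (e ▸ F.Ek)
theorem quad0 : Quad I F.p F.a F.r1 F.r2 F.A F.E1 F.E2 F.R1 F.R2 F.D :=
  ⟨F.Ap, F.E1p, F.E2p, F.Aa, F.R1a, F.R2a, F.E1r, F.R1r, F.Dr1, F.E2r, F.R2r, F.Dr2, F.npa,
    F.Ar1, F.Ar2, fun hh => F.E1D (F.Dr12 F.E1r hh), fun hh => F.DR1 (F.Dr12 F.R1r hh).symm⟩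

theorem mids0 : (Btw I F.E1 F.D F.R1 ↔ Btw I F.E2 F.D F.R2) ∧
    (Btw I F.E1 F.D F.R1 → (Btw I F.A F.E1 F.E2 ↔ Btw I F.A F.R2 F.R1)) ∧
    (¬ Btw I F.E1 F.D F.R1 → (Btw I F.A F.E1 F.E2 ↔ Btw I F.A F.R1 F.R2)) :=
  F.quad0.mids F.h (F.nEAE F.tE1 F.tE2) F.nRAR

/-- The lines `p`, `u2`, `c1`, `r2` are in general position. That `c2` misses `u2` and `r2`, `l`
misses `c1` and `r2`, and `u2` misses `q` excludes all middle points in `Quad.table` but the stated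
ones. -/
theorem pt_S {S : P} (h1 : I S F.r2) (h2 : I S F.u2) (t : Btw I F.Q1 F.D S) :
    Btw I F.A F.P2 S ∧ Btw I F.E2 F.Q1 S := by
  have npc : F.u2 ≠ F.c1 := fun e => F.Ac1 (e ▸ F.Au2)
  have nrc : F.r2 ≠ F.c1 := fun e => F.Dc1 (e ▸ F.Dr2)
  have hP2 : ¬ I F.P2 F.r2 := fun hh => by
    have e1 : F.P2 = F.Q1 := F.h.eq_pt nrc hh F.P2c F.Q1r F.Q1c
    have nur : F.u2 ≠ F.r2 := fun e => F.Ar2 (e ▸ F.Au2)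
    have e2 : F.P2 = S := F.h.eq_pt nur F.P2u hh h2 h1
    exact t.ne13 (e1.symm.trans e2)
  have hC : ¬ I F.C F.r2 := fun hh => F.r2c2 ⟨_, hh, F.Cc2⟩
  have Q : Quad I F.p F.u2 F.c1 F.r2 F.A F.C F.E2 F.P2 S F.Q1 :=
    ⟨F.Ap, F.Cp, F.E2p, F.Au2, F.P2u, h2, F.Cc1, F.P2c, F.Q1c, F.E2r, h1, F.Q1r, F.swap.npu1,
      F.Ac1, F.Ar2, hC, hP2⟩
  have T := Q.table F.h
  have a1 := F.tE2
  have a2 : ¬ Btw I F.P2 F.C F.Q1 := fun t =>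
    (t.apex F.h F.Cc2 F.P2u F.Q1r ⟨S, h2, h1⟩).elim (fun t => F.u2c2 t.symm) fun t => F.r2c2 t.symm
  have a3 : ¬ Btw I F.P2 F.A S := fun t =>
    (t.apex F.h F.Al F.P2c h1 F.r2c1.symm).elim F.lc1 F.lr2
  have a4 : ¬ Btw I F.C F.P2 F.Q1 := fun t' => by
    have hQ1 : ¬ I F.Q1 F.u2 := fun hh => by
      have nur : F.u2 ≠ F.r2 := fun e => F.Ar2 (e ▸ F.Au2)
      exact t.ne13 (F.h.eq_pt nur hh F.Q1r h2 h1)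
    exact F.u2q (F.h.cross t'.symm t hQ1 F.P2u h2 F.Cq F.Dq)
  clear Q
  grind

theorem no_S {S : P} (h1 : I S F.r2) (h2 : I S F.u2) (t : Btw I F.Q1 F.D S) :
    ¬ Btw I F.A S F.K2 ∧ ¬ Btw I F.A S F.T1 := by
  have a := (F.pt_S h1 h2 t).1
  exact ⟨fun w => F.nAPK (F.h.btw_nest a w).1, fun w => F.nAPT (F.h.btw_nest a w).1⟩

theorem no_cross2 (t1 : Btw I F.A F.T2 F.K1) (t2 : Btw I F.D F.K2 F.K1) : False := by
  have K1k2 : ¬ I F.K1 F.u2 := fun hh => F.Ak (F.h.eq_pt F.nu F.K1u hh F.Au1 F.Au2 ▸ F.K1k)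
  have nkr : F.k ≠ F.r2 := F.swap.nr1k.symm
  obtain ⟨S, hS2, hS1⟩ := F.h.cross t2.symm t1.symm K1k2 F.K2u F.Au2 F.Dr2 F.T2r
  have Q : Quad I F.k F.u1 F.u2 F.r2 F.K1 F.K2 F.D F.A F.T2 S :=
    ⟨F.K1k, F.K2k, F.Dk, F.K1u, F.Au1, F.T2u, F.K2u, F.Au2, hS2, F.Dr2, F.T2r, hS1,
      fun e => F.Ak (e ▸ F.Au1), K1k2,
      fun hh => F.swap.DK2 (F.h.eq_pt nkr F.Dk F.Dr2 F.K1k hh),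
      fun hh => F.DK2 (F.h.eq_pt nkr F.Dk F.Dr2 F.K2k hh), F.Ar2⟩
  have T := Q.table F.h
  have t1' := t1.symm
  have t2' := t2.symm
  have e : Btw I F.D S F.T2 ∧ Btw I F.K2 S F.A := by
    clear Q t1 t2
    rw [btw_comm (A := F.T2)] at T
    grind
  exact (F.no_S hS1 hS2 (F.h.btw_nest e.1.symm F.Q1DT2.symm).2.symm).1 e.2.symm

/-- The parity statements `mids0`, `mids1`, `mids2` tie the order of `E1`, `E2`, `E` on `AC` to the
orders on `a`, `u1` and `u2`. The assumption on `E1` and `E2` costs nothing, because `swap`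
exchanges the indices. -/
theorem not_ordered (o : Btw I F.A F.E1 F.E2) : False := by
  have K12 : F.K1 ≠ F.K2 := fun e => F.Ak (F.h.eq_pt F.nu F.K1u (e ▸ F.K2u) F.Au1 F.Au2 ▸ F.K1k)
  have hA2 : ¬ Btw I F.A F.E1 F.E → Btw I F.A F.E F.E1 := fun n => by
    rcases F.h.btw_total F.tE1.ne12 F.E1E F.tE.ne23.symm F.Ap F.E1p F.Ep with w | w | w
    · exact (F.nEAE F.tE1 F.tE.symm w).elim
    · exact (n w).elim
    · exact w
  have hA3 : ¬ Btw I F.A F.E F.E2 → Btw I F.A F.E2 F.E := fun n => by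
    rcases F.h.btw_total F.tE2.ne12 F.swap.E1E F.tE.ne23.symm F.Ap F.E2p F.Ep with w | w | w
    · exact (F.nEAE F.tE2 F.tE.symm w).elim
    · exact w
    · exact (n w).elim
  have ordK : ¬ Btw I F.A F.K2 F.T1 → Btw I F.A F.T1 F.K2 := fun n => by
    rcases F.h.btw_total F.AK2 F.T1K2.symm F.AT1 F.Au2 F.K2u F.T1u with w | w | w
    · exact (F.nKAT w).elim
    · exact (n w).elim
    · exact w
  have ordK' : ¬ Btw I F.A F.K1 F.T2 → Btw I F.A F.T2 F.K1 := fun n => by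
    rcases F.h.btw_total F.swap.AK2 F.swap.T1K2.symm F.swap.AT1 F.Au1 F.K1u F.T2u with w | w | w
    · exact (F.swap.nKAT w).elim
    · exact (n w).elim
    · exact w
  have fin : Btw I F.A F.T1 F.K2 → Btw I F.A F.T2 F.K1 → False := fun w1 w2 => by
    rcases F.h.btw_total F.DK2 K12.symm F.swap.DK2 F.Dk F.K2k F.K1k with w | w | w
    · exact F.nK w.symm
    · exact F.no_cross2 w2 w
    · exact F.swap.no_cross2 w1 w
  obtain ⟨m1, m2, m3⟩ := F.mids1
  obtain ⟨m4, m5, m6⟩ := F.mids2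
  obtain ⟨m7, m8, m9⟩ := F.mids0
  have RT : Btw I F.E1 F.D F.T1 ↔ Btw I F.E1 F.D F.R1 := by
    constructor <;> intro w
    · exact (F.h.btw_split w F.E1r F.Dr1 F.R1r F.DR1.symm).resolve_right fun x =>
        F.h.btw_fork F.Q2DT1 F.Q2DR1 x
    · exact (F.h.btw_split w F.E1r F.Dr1 F.T1r F.DT1.symm).resolve_right fun x =>
        F.h.btw_fork F.Q2DR1 F.Q2DT1 x
  have KK : Btw I F.E F.D F.K2 ↔ Btw I F.E F.D F.K1 := by
    constructor <;> intro w
    · exact (F.h.btw_split w F.Ek F.Dk F.K1k F.swap.DK2.symm).resolve_right fun x => F.nK x.symm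
    · exact (F.h.btw_split w F.Ek F.Dk F.K2k F.DK2.symm).resolve_right fun x => F.nK x
  -- By `KK` the point `D` separates `E` from both or from none of `K1`, `K2`. In either case the
  -- place of `E` on `AC` decides: one position creates a crossing point `S` of `u2`, `r2` or of
  -- `u1`, `r1` that conflicts with `pt_S`, the other is excluded by `fin`.
  by_cases b : Btw I F.E F.D F.K2
  · have b1 := m1.2 b
    have b2 := m4.2 (KK.1 b)
    by_cases e : Btw I F.A F.E1 F.E
    · have w1 := (m2 b1).1 e
      have w2 := F.DTR w1
      have w3 := (m8 (RT.1 b1)).1 o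
      have hR1 : ¬ I F.R1 F.r2 := fun hh => F.DR1 (F.Dr12 F.R1r hh).symm
      obtain ⟨S, hS1, hS2⟩ := F.h.cross w3.symm w2.symm hR1 F.R2r F.Dr2 F.Au2 F.T1u
      have Q : Quad I F.u2 F.r2 F.r1 F.p S F.T1 F.A F.D F.E2 F.E1 :=
        ⟨hS2, F.T1u, F.Au2, hS1, F.Dr2, F.E2r, F.T1r, F.Dr1, F.E1r, F.Ap, F.E2p, F.E1p,
          fun e => F.Ar2 (e ▸ F.Au2),
          fun hh => F.Du2 (F.Dr12 hh hS1 ▸ hS2),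
          fun hh => F.Ar2 (F.h.eq_pt F.swap.npu1 F.Ap F.Au2 hh hS2 ▸ hS1),
          fun hh => F.AT1 (F.h.eq_pt F.swap.npu1 F.Ap F.Au2 hh F.T1u), F.Dp⟩
      have T := Q.table F.h
      have b1' := b1.symm
      have o' := o
      have e2 : Btw I S F.D F.E2 ∧ Btw I F.T1 S F.A := by
        clear Q m1 m2 m3 m4 m5 m6 m7 m8 m9 RT KK fin
        grind
      have e3 : Btw I F.Q1 F.D S :=
        (F.h.btw_split F.Q1DT2 F.Q1r F.Dr2 hS1 e2.1.ne12).resolve_right fun x =>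
          F.h.btw_fork b2 e2.1.symm x
      exact (F.no_S hS1 hS2 e3).2 e2.2.symm
    · have e' := hA2 e
      have e'' := (F.h.btw_nest e' o).1
      exact fin (ordK fun w => e ((m2 b1).2 w)) (ordK' fun w => F.h.btw_swap e'' ((m5 b2).2 w))
  · have b1 : ¬ Btw I F.E1 F.D F.T1 := fun w => b (m1.1 w)
    have b2 : ¬ Btw I F.E2 F.D F.T2 := fun w => b (KK.2 (m4.1 w))
    have b3 : ¬ Btw I F.E1 F.D F.R1 := fun w => b1 (RT.2 w)
    have w3 := (m9 b3).1 o
    by_cases e : Btw I F.A F.E F.E2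
    · have w1 : Btw I F.A F.K1 F.T2 := by
        by_contra n
        exact F.h.btw_swap e ((m6 b2).2 (ordK' n))
      have w2 : Btw I F.D F.T2 F.R2 := F.swap.DTR w1
      have hR2 : ¬ I F.R2 F.r1 := fun hh => F.swap.DR1 (F.Dr12 hh F.R2r).symm
      obtain ⟨S, hS1, hS2⟩ := F.h.cross w3.symm w2.symm hR2 F.R1r F.Dr1 F.Au1 F.T2u
      have Q : Quad I F.u1 F.r1 F.r2 F.a S F.T2 F.A F.D F.R1 F.R2 :=
        ⟨hS2, F.T2u, F.Au1, hS1, F.Dr1, F.R1r, F.T2r, F.Dr2, F.R2r, F.Aa, F.R1a, F.R2a,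
          fun e => F.Ar1 (e ▸ F.Au1),
          fun hh => F.Du1 (F.Dr12 hS1 hh ▸ hS2),
          fun hh => F.Ar1 (F.h.eq_pt F.nau1 F.Aa F.Au1 hh hS2 ▸ hS1),
          fun hh => F.swap.AT1 (F.h.eq_pt F.nau1 F.Aa F.Au1 hh F.T2u), F.Da⟩
      have T := Q.table F.h
      have w2' := w2.symm
      have e2 : Btw I F.D S F.R1 := by
        clear Q m1 m2 m3 m4 m5 m6 m7 m8 m9 RT KK fin
        rw [btw_comm (A := S) (B := F.T2), btw_comm (A := F.T2) (C := F.R2)] at T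
        grind
      have e3 := (F.h.btw_nest e2.symm F.Q2DR1.symm).2.symm
      have e4 : Btw I F.E1 F.Q2 S := (F.swap.pt_S hS1 hS2 e3).2
      exact b3 (F.h.btw_chain (F.h.btw_nest e3.symm e4.symm).1.symm e2).1
    · have e' := hA3 e
      have e'' := (F.h.btw_nest o e').1
      exact fin ((m3 b1).1 e'') ((m6 b2).1 e')

theorem false (F : NonPasch I) : False := by
  rcases F.h.btw_total F.tE1.ne12 F.E1E2 F.tE2.ne12 F.Ap F.E1p F.E2p with w | w | w
  · exact F.nEAE F.tE1 F.tE2 w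
  · exact F.not_ordered w
  · exact F.swap.not_ordered w

end NonPasch

namespace Axioms

/-- A line through `E` between `A` and `C`, and `D` beyond `C` on `BC`, meets `AB`. -/
theorem pasch_ext (h : Axioms I) {A B C D E : P} {k l : L} (tE : Btw I C E A) (tD : Btw I B C D)
    (hC : ¬ I C k) (Dk : I D k) (Ek : I E k) (Al : I A l) (Bl : I B l) : Tch I k l := by
  by_contra kl
  obtain ⟨p, Cp, -, Ap⟩ := tE.line
  obtain ⟨q, Bq, Cq, Dq⟩ := tD.line
  have Ep := tE.mem2 h Cp Ap
  have nkp : k ≠ p := fun e => hC (e ▸ Cp)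
  have nkq : k ≠ q := fun e => hC (e ▸ Cq)
  have npq : p ≠ q := by
    rintro rfl
    have e : E = D := h.eq_pt nkp Ek Ep Dk Dq
    have hAB : A ≠ B := by rintro rfl; rw [e] at tE; exact h.btw_swap tD tE.symm
    have := h.eq_line hAB Al Bl Ap Bq
    exact kl ⟨E, Ek, this ▸ Ep⟩
  have Ak : ¬ I A k := fun hh => nkp (h.eq_line tE.ne23 Ek hh Ep Ap)
  have Aq : ¬ I A q := fun hh => npq (h.eq_line tE.ne13 Cp Ap Cq hh)
  obtain ⟨m, n, mn, Am, An, mk, nk, cov⟩ := h.cover Ak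
  -- The point `B` is exchanged for the intersection `B'` of `q` with one of the two lines that (A5)
  -- supplies at `A` for `k`. Now `AB'` is one of a covering pair, as `NonPasch` demands.
  have main : ∀ m n, m ≠ n → I A m → I A n → ¬ Tch I m k → ¬ Tch I n k →
      (∀ f, Tch I f k → f ≠ k → Tch I f m ∨ Tch I f n) → Tch I q m → False := by
    intro m n mn Am An mk nk cov ⟨B', B'q, B'm⟩
    have hB'C : B' ≠ C := by
      rintro rfl
      exact mk ⟨E, h.eq_line tE.ne13 Cp Ap B'm Am ▸ Ep, Ek⟩
    have hB'D : B' ≠ D := by rintro rfl; exact mk ⟨_, B'm, Dk⟩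
    have tD' : Btw I B' C D := by
      rcases h.btw_total hB'C tD.ne23 hB'D B'q Cq Dq with w | w | w
      · exact (mk (h.cross tE w hC Ek Dk Am B'm).symm).elim
      · exact w
      · exact (((h.btw_chain tD w.symm).2.apex h Dk Bl B'm ⟨_, Al, Am⟩).elim kl
          fun t => mk t.symm).elim
    have hAC := tE.ne13
    have Ac : ∀ c, I C c → ¬ Tch I c k → ¬ I A c := fun c hc n hh =>
      n ⟨E, h.eq_line hAC Cp Ap hc hh ▸ Ep, Ek⟩
    obtain ⟨c1, c2, Cc1, Cc2, kc1, kc2, nc⟩ := h.avoid_two hC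
    obtain ⟨r1, a1, a2, a3⟩ := h.avoid (fun hh => kc1 ⟨D, hh, Dk⟩) ⟨C, Cc2, Cc1⟩ nc.symm
    obtain ⟨r2, b1, b2, b3⟩ := h.avoid (fun hh => kc2 ⟨D, hh, Dk⟩) ⟨C, Cc1, Cc2⟩ nc
    obtain ⟨u1, d1, d2, d3⟩ := h.avoid (Ac c1 Cc1 kc1) ⟨C, Cc2, Cc1⟩ nc.symm
    obtain ⟨u2, e1, e2, e3⟩ := h.avoid (Ac c2 Cc2 kc2) ⟨C, Cc1, Cc2⟩ nc
    exact NonPasch.false (I := I) {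
      h := h, A := A, B := B', C := C, D := D, E := E, k := k, l := m, a := n, p := p, q := q,
      c1 := c1, c2 := c2, r1 := r1, r2 := r2, u1 := u1, u2 := u2
      tE := tE, tD := tD', Dk := Dk, Ek := Ek, Al := Am, Bl := B'm, Aa := An, Ap := Ap, Cp := Cp
      Bq := B'q, Cq := Cq, npq := npq, kl := fun t => mk t.symm, ka := fun t => nk t.symm
      al := mn.symm, cov := cov, Cc1 := Cc1, Cc2 := Cc2, kc1 := fun t => kc1 t.symm
      kc2 := fun t => kc2 t.symm, nc := nc, Dr1 := a1, Dr2 := b1, r1c1 := a2, r1c2 := a3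
      r2c2 := b2, r2c1 := b3, Au1 := d1, Au2 := e1, u1c1 := d2, u1c2 := d3, u2c2 := e2
      u2c1 := e3 }
  rcases cov q ⟨D, Dq, Dk⟩ nkq.symm with t | t
  · exact main m n mn Am An mk nk cov t
  · exact main n m mn.symm An Am nk mk (fun f h1 h2 => (cov f h1 h2).symm) t

end Axioms
end HypInc

/-! ### Pasch's axiom, the two sides of a line, and angles. -/

namespace HypInc

universe u v

variable {P : Type u} {L : Type v} {I : P → L → Prop}

/-- `X` and `Y` are separated by `k`. -/
def OppS (I : P → L → Prop) (k : L) (X Y : P) : Prop := ∃ Z, I Z k ∧ Btw I X Z Y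

theorem OppS.symm {k : L} {X Y : P} : OppS I k X Y → OppS I k Y X := fun ⟨Z, h1, h2⟩ => ⟨Z, h1, h2.symm⟩

/-- A side of the line `k`, as a predicate. -/
noncomputable def side (I : P → L → Prop) (k : L) (X : P) : Prop :=
  OppS I k (@Classical.epsilon P ⟨X⟩ fun W => ¬ I W k) X

namespace Axioms

/-- Betweenness of `D` makes `k` meet one of the lines `AC`, `BC`. If the intersection is not inside
that side, `pasch_ext` or `cross` makes `k` meet the other line too, and then parity (`Quad.two`)
puts one of the intersections inside its side. -/
theorem pasch (h : Axioms I) {A B C D : P} {k : L} (t : Btw I A D B) (hD : I D k) (hC : ¬ I C k)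
    (hA : ¬ I A k) (hB : ¬ I B k) : OppS I k A C ∨ OppS I k B C := by
  obtain ⟨m, Am, Dm, Bm⟩ := t.line
  by_cases hCm : I C m
  · have : C ≠ D := by rintro rfl; exact hC hD
    exact (h.btw_split t Am Dm hCm this).imp (fun w => ⟨D, hD, w⟩) (fun w => ⟨D, hD, w⟩)
  obtain ⟨p, Ap, Cp⟩ := h.exists_line A C
  obtain ⟨q, Bq, Cq⟩ := h.exists_line B C
  have hAq : ¬ I A q := fun hh => hCm (h.eq_line t.ne13 hh Bq Am Bm ▸ Cq)
  have hBp : ¬ I B p := fun hh => hCm (h.eq_line t.ne13 Ap hh Am Bm ▸ Cp)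
  have AC : A ≠ C := by rintro rfl; exact hCm Am
  have BC : B ≠ C := by rintro rfl; exact hCm Bm
  have hDp : ¬ I D p := fun hh => hBp (t.mem3 h Ap hh)
  have hDq : ¬ I D q := fun hh => hAq (t.mem1 h hh Bq)
  have npq : p ≠ q := by rintro rfl; exact hBp Bq
  have main : ∀ A B p q, Btw I A D B → I A m → I B m → ¬ I C m → ¬ I A k → ¬ I B k → I A p → I C p → I B q →
      I C q → A ≠ C → B ≠ C → ¬ I B p → ¬ I A q → ¬ I D p → ¬ I D q → p ≠ q → Tch I k p →
      OppS I k A C ∨ OppS I k B C := by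
    intro A B p q t Am Bm hCm hA hB Ap Cp Bq Cq AC BC hBp hAq hDp hDq npq ⟨E, Ek, Ep⟩
    have AE : A ≠ E := by rintro rfl; exact hA Ek
    have EC : E ≠ C := by rintro rfl; exact hC Ek
    by_contra hcon
    push Not at hcon
    have hE : ¬ Btw I A E C := fun w => hcon.1 ⟨E, Ek, w⟩
    have kq : Tch I k q := by
      rcases h.btw_total AE EC AC Ap Ep Cp with w | w | w
      · exact h.pasch_ext t w.symm hA Ek hD Bq Cq
      · exact (hE w).elim
      · exact h.cross t w hA hD Ek Bq Cq
    obtain ⟨F, Fk, Fq⟩ := kq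
    have Q : Quad I m p q k A B D C E F :=
      ⟨Am, Bm, Dm, Ap, Cp, Ep, Bq, Cq, Fq, hD, Ek, Fk, fun e => hCm (e ▸ Cp), hAq, hA, hB, hC⟩
    rcases Q.two h t with w | w
    · exact hE w
    · exact hcon.2 ⟨F, Fk, w⟩
  rcases t.apex h hD Ap Bq ⟨C, Cp, Cq⟩ with w | w
  · exact main A B p q t Am Bm hCm hA hB Ap Cp Bq Cq AC BC hBp hAq hDp hDq npq w
  · exact (main B A q p t.symm Bm Am hCm hB hA Bq Cq Ap Cp BC AC hAq hBp hDq hDp npq.symm w).symm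

theorem opp_three (h : Axioms I) {X Y Z : P} {k : L} (hX : ¬ I X k) (hY : ¬ I Y k) (hZ : ¬ I Z k)
    (t1 : OppS I k X Y) (t2 : OppS I k X Z) (t3 : OppS I k Y Z) : False := by
  obtain ⟨D, Dk, t1⟩ := t1
  obtain ⟨E, Ek, t2⟩ := t2
  obtain ⟨F, Fk, t3⟩ := t3
  obtain ⟨m, Xm, Dm, Ym⟩ := t1.line
  obtain ⟨p, Xp, Ep, Zp⟩ := t2.line
  obtain ⟨q, Yq, Fq, Zq⟩ := t3.line
  have nmk : m ≠ k := by rintro rfl; exact hX Xm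
  by_cases hZm : I Z m
  · obtain rfl := h.eq_line t2.ne13 Xp Zp Xm hZm
    obtain rfl := h.eq_line t3.ne13 Yq Zq Ym hZm
    obtain rfl := h.eq_pt nmk Dm Dk Ep Ek
    obtain rfl := h.eq_pt nmk Dm Dk Fq Fk
    exact h.btw_fork t1 t2 t3
  · have Q : Quad I m p q k X Y D Z E F :=
      ⟨Xm, Ym, Dm, Xp, Zp, Ep, Yq, Zq, Fq, Dk, Ek, Fk, fun e => hZm (e ▸ Zp),
        fun hh => hZm (h.eq_line t1.ne13 hh Yq Xm Ym ▸ Zq), hX, hY, hZ⟩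
    exact Q.not_three h t1 t2 t3

/-- By `pasch` and `opp_three`, not being separated by `k` is an equivalence relation with at most
two classes. Comparing `X` and `Y` with the reference point of `side`, which depends on `k` only,
therefore decides whether `k` separates them. -/
theorem opp_iff (h : Axioms I) {X Y : P} {k : L} (hX : ¬ I X k) (hY : ¬ I Y k) :
    OppS I k X Y ↔ ¬ (side I k X ↔ side I k Y) := by
  have hW := @Classical.epsilon_spec P (fun W => ¬ I W k) ⟨X, hX⟩
  unfold side
  generalize (@Classical.epsilon P ⟨X⟩ fun W => ¬ I W k) = W at hW ⊢
  constructor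
  · intro t e
    have t' := t
    obtain ⟨D, Dk, t'⟩ := t'
    rcases h.pasch t' Dk hW hX hY with w | w
    · exact h.opp_three hW hX hY w.symm (e.1 w.symm) t
    · exact h.opp_three hW hX hY (e.2 w.symm) w.symm t
  · intro n
    by_cases w : OppS I k W X
    · have : ¬ OppS I k W Y := fun w' => n ⟨fun _ => w', fun _ => w⟩
      obtain ⟨D, Dk, t'⟩ := w
      rcases h.pasch t' Dk hY hW hX with w | w
      · exact (this w).elim
      · exact w
    · have : OppS I k W Y := by tauto
      obtain ⟨D, Dk, t'⟩ := this
      rcases h.pasch t' Dk hX hW hY with w' | w'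
      · exact (w w').elim
      · exact w'.symm

theorem side_of_miss (h : Axioms I) {X Y : P} {k a : L} (n : ¬ Tch I a k) (hX : I X a) (hY : I Y a) :
    side I k X ↔ side I k Y := by
  by_contra hc
  obtain ⟨Z, h1, h2⟩ := (h.opp_iff (fun hh => n ⟨X, hX, hh⟩) fun hh => n ⟨Y, hY, hh⟩).2 hc
  exact n ⟨Z, h2.mem2 h hX hY, h1⟩

theorem side_btw (h : Axioms I) {X Y Z : P} {k a : L} (hX : ¬ I X k) (hY : ¬ I Y k) (hZ : I Z k)
    (Xa : I X a) (Ya : I Y a) (Za : I Z a) : Btw I X Z Y ↔ ¬ (side I k X ↔ side I k Y) := by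
  rw [← h.opp_iff hX hY]
  constructor
  · exact fun t => ⟨Z, hZ, t⟩
  · rintro ⟨W, hW, t⟩
    have : a ≠ k := by rintro rfl; exact hX Xa
    rwa [h.eq_pt this Za hZ (t.mem2 h Xa Ya) hW]

/-- The segment from a point of `k` to `X` lies on the side of `X`. -/
theorem side_open (h : Axioms I) {X W Z : P} {k : L} (hZ : I Z k) (t : Btw I Z W X) (hX : ¬ I X k) :
    ¬ I W k ∧ (side I k W ↔ side I k X) := by
  obtain ⟨a, Za, Wa, Xa⟩ := t.line
  have hW : ¬ I W k := fun hh => hX (t.mem3 h hZ hh)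
  refine ⟨hW, ?_⟩
  by_contra n
  exact h.btw_unique t ((h.side_btw hW hX hZ Wa Xa Za).2 n)

theorem side_seg (h : Axioms I) {X Y W : P} {k : L} (t : Btw I X W Y) (hX : ¬ I X k) (hY : ¬ I Y k)
    (e : side I k X ↔ side I k Y) : ¬ I W k ∧ (side I k W ↔ side I k X) := by
  have hW : ¬ I W k := fun hh => (h.opp_iff hX hY).1 ⟨W, hh, t⟩ e
  refine ⟨hW, ?_⟩
  by_contra n
  obtain ⟨Z, hZ, t1⟩ := (h.opp_iff hW hX).2 n
  obtain ⟨Z', hZ', t2⟩ := (h.opp_iff hW hY).2 fun e' => n (e'.trans e.symm)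
  obtain ⟨m, Xm, Wm, Ym⟩ := t.line
  have : m ≠ k := by rintro rfl; exact hW Wm
  obtain rfl := h.eq_pt this (t1.mem2 h Wm Xm) hZ (t2.mem2 h Wm Ym) hZ'
  exact (h.opp_iff hX hY).1 ⟨Z, hZ, (h.btw_nest t1.symm t).1⟩ e

theorem exists_triple (h : Axioms I) (A : P) (q : L) (hA : I A q) : ∃ Z Y, Btw I A Z Y ∧ I Z q := by
  obtain ⟨X, hX, hXA, -⟩ := h.five_points q A A A A
  obtain ⟨Y, hY, hYA, hYX, -⟩ := h.five_points q A X X X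
  obtain ⟨Z, hZ, hZA, hZX, hZY, -⟩ := h.five_points q A X Y Y
  by_contra hc
  push Not at hc
  have key : ∀ X Y, I X q → I Y q → X ≠ A → Y ≠ A → X ≠ Y → Btw I X A Y := by
    intro X Y hX hY hXA hYA hXY
    rcases h.btw_total hXA.symm hXY hYA.symm hA hX hY with t | t | t
    · exact t
    · exact (hc _ _ t hX).elim
    · exact (hc _ _ t hY).elim
  exact h.btw_fork (key X Y hX hY hXA hYA hYX.symm) (key X Z hX hZ hXA hZA hZX.symm)
    (key Y Z hY hZ hYA hZA hZY.symm)

/-- On another line through `A` there is a triple `A`, `Z`, `Y`. The line `ZB` enters the triangle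
`AYX` at `Z` and cannot leave it through `YX`, which was chosen to miss it, so it leaves through
`AX`, at `B`. -/
theorem extend (h : Axioms I) {A B : P} (hAB : A ≠ B) : ∃ X, Btw I A B X := by
  obtain ⟨n, An, Bn⟩ := h.exists_line A B
  obtain ⟨q, Aq, qn⟩ := h.exists_line_ne A n
  obtain ⟨Z, Y, t, Zq⟩ := h.exists_triple A q Aq
  have Yq := t.mem3 h Aq Zq
  obtain ⟨b, Zb, Bb⟩ := h.exists_line Z B
  have hBq : ¬ I B q := fun hh => qn (h.eq_line hAB Aq hh An Bn)
  have nbq : b ≠ q := by rintro rfl; exact hBq Bb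
  have hYb : ¬ I Y b := fun hh => nbq (h.eq_line t.ne23 Zb hh Zq Yq)
  have hAb : ¬ I A b := fun hh => nbq (h.eq_line t.ne12 hh Zb Aq Zq)
  obtain ⟨y, Yy, yb, X, Xy, Xn⟩ := h.avoid hYb ⟨B, Bn, Bb⟩ (by rintro rfl; exact hAb An)
  have hXb : ¬ I X b := fun hh => yb ⟨X, Xy, hh⟩
  refine ⟨X, ?_⟩
  rcases h.pasch t Zb hXb hAb hYb with ⟨W, Wb, w⟩ | ⟨W, Wb, w⟩
  · have : n ≠ b := by rintro rfl; exact hAb An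
    rwa [h.eq_pt this Bn Bb (w.mem2 h An Xn) Wb]
  · exact (yb ⟨W, w.mem2 h Yy Xy, Wb⟩).elim

/-- If `k` and `k'` are disjoint and `S` is not on the same side of `k` as `k'`, then it is on the
same side of `k'` as `k`. -/
theorem nested (h : Axioms I) {k k' : L} {S X Y : P} (n : ¬ Tch I k k') (hX : I X k') (hY : I Y k)
    (hS : ¬ I S k) (hSX : ¬ (side I k S ↔ side I k X)) : ¬ I S k' ∧ (side I k' S ↔ side I k' Y) := by
  have hS' : ¬ I S k' := fun hh => hSX (h.side_of_miss (fun t => n t.symm) hh hX)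
  refine ⟨hS', ?_⟩
  by_contra hc
  obtain ⟨W, hW, t⟩ := (h.opp_iff hS' fun hh => n ⟨Y, hY, hh⟩).2 hc
  exact hSX ((h.side_open hY t.symm hS).2.symm.trans (h.side_of_miss (fun t => n t.symm) hW hX))

/-- The crossbar theorem: a ray inside an angle separates its legs. If it did not, the line `a`
would separate `C` from a point `D` on the extension of `BA` beyond `A`, and the crossing point
would lie on neither ray of `a`. -/
theorem trio_aux (h : Axioms I) {A B C Y : P} {t s a : L} (At : I A t) (As : I A s) (Aa : I A a)
    (Bt : I B t) (Cs : I C s) (Ya : I Y a) (hB : B ≠ A) (hC : C ≠ A) (hY : Y ≠ A) (nts : t ≠ s)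
    (nta : t ≠ a) (nsa : s ≠ a) (e1 : side I t C ↔ side I t Y) (e2 : side I s B ↔ side I s Y) :
    ¬ (side I a B ↔ side I a C) := by
  have off : ∀ {X : P} {m n : L}, I A m → I A n → m ≠ n → I X m → X ≠ A → ¬ I X n :=
    fun hm hn hmn hX hXA hh => hXA (h.eq_pt hmn hX hh hm hn)
  obtain ⟨D, hD⟩ := h.extend hB
  have Dt := hD.mem3 h Bt At
  have hDA := hD.ne23.symm
  have dflip := (h.side_btw (off At As nts Bt hB) (off At As nts Dt hDA) As Bt Dt At).1 hD
  have aflip := (h.side_btw (off At Aa nta Bt hB) (off At Aa nta Dt hDA) Aa Bt Dt At).1 hD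
  intro e
  have hCa := off As Aa nsa Cs hC
  have hCD : ¬ (side I a C ↔ side I a D) := fun e' => aflip (e.trans e')
  obtain ⟨Z, Za, w⟩ := (h.opp_iff hCa (off At Aa nta Dt hDA)).2 hCD
  have z1 := h.side_open Dt w.symm (off As At nts.symm Cs hC)
  have z2 := h.side_open Cs w (off At As nts Dt hDA)
  have hZA : Z ≠ A := by rintro rfl; exact z1.1 At
  have z3 : ¬ Btw I Z A Y := fun w' =>
    (h.side_btw z1.1 (off Aa At nta.symm Ya hY) At Za Ya Aa).1 w' (z1.2.trans e1)
  have z4 := mt (h.side_btw z2.1 (off Aa As nsa.symm Ya hY) As Za Ya Aa).2 z3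
  exact dflip (e2.trans ((not_not.1 z4).symm.trans z2.2))

/-- For three rays from `A` on three lines, the number of lines separating the other two rays is
odd. -/
theorem trio (h : Axioms I) {A B C Y : P} {t s a : L} (At : I A t) (As : I A s) (Aa : I A a)
    (Bt : I B t) (Cs : I C s) (Ya : I Y a) (hB : B ≠ A) (hC : C ≠ A) (hY : Y ≠ A) (nts : t ≠ s)
    (nta : t ≠ a) (nsa : s ≠ a) : (side I t C ↔ side I t Y) ↔ ((side I s B ↔ side I s Y) ↔
      ¬ (side I a B ↔ side I a C)) := by
  have off : ∀ {X : P} {m n : L}, I A m → I A n → m ≠ n → I X m → X ≠ A → ¬ I X n :=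
    fun hm hn hmn hX hXA hh => hXA (h.eq_pt hmn hX hh hm hn)
  -- Passing to an opposite ray flips its side with respect to both other lines. Applying `trio_aux`
  -- to the four choices of rays on `t` and `s` therefore covers every combination of signs.
  obtain ⟨B', hB'⟩ := h.extend hB
  have B't := hB'.mem3 h Bt At
  have hB'A := hB'.ne23.symm
  have f1 := (h.side_btw (off At As nts Bt hB) (off At As nts B't hB'A) As Bt B't At).1 hB'
  have f2 := (h.side_btw (off At Aa nta Bt hB) (off At Aa nta B't hB'A) Aa Bt B't At).1 hB'
  obtain ⟨C', hC'⟩ := h.extend hC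
  have C's := hC'.mem3 h Cs As
  have hC'A := hC'.ne23.symm
  have f3 := (h.side_btw (off As At nts.symm Cs hC) (off As At nts.symm C's hC'A) At Cs C's As).1 hC'
  have f4 := (h.side_btw (off As Aa nsa Cs hC) (off As Aa nsa C's hC'A) Aa Cs C's As).1 hC'
  have g1 := h.trio_aux At As Aa Bt Cs Ya hB hC hY nts nta nsa
  have g2 := h.trio_aux At As Aa B't Cs Ya hB'A hC hY nts nta nsa
  have g3 := h.trio_aux At As Aa Bt C's Ya hB hC'A hY nts nta nsa
  have g4 := h.trio_aux At As Aa B't C's Ya hB'A hC'A hY nts nta nsa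
  clear off
  grind

end Axioms
end HypInc

/-! ### Directions of a line as filters of far points. -/

namespace HypInc

universe u v

variable {P : Type u} {L : Type v} {I : P → L → Prop}

open Filter

/-- `X` lies on the open ray from `O` through `A`. -/
def OnRay (I : P → L → Prop) (O A X : P) : Prop :=
  X ≠ O ∧ (∃ m, I O m ∧ I A m ∧ I X m) ∧ ¬ Btw I X O A

/-- The filter of subsets of the ray from `O` through `A` that contain all far points. -/
def rayEnd (I : P → L → Prop) (O A : P) : Filter P :=
  ⨅ X ∈ {X | OnRay I O A X}, 𝓟 {Y | Btw I O X Y}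

/-- `F` is the filter of one of the two directions of the line `a`. -/
def Dir (I : P → L → Prop) (F : Filter P) (a : L) : Prop :=
  ∃ O A, O ≠ A ∧ I O a ∧ I A a ∧ F = rayEnd I O A

/-- The side of `k` that contains the far points of `F`. -/
def Tail (I : P → L → Prop) (F : Filter P) (k : L) : Prop := ∀ᶠ Y in F, side I k Y

namespace Axioms

theorem onRay_self (h : Axioms I) {O A : P} (hA : A ≠ O) : OnRay I O A A := by
  obtain ⟨m, h1, h2⟩ := h.exists_line O A
  exact ⟨hA, ⟨m, h1, h2, h2⟩, fun t => t.ne13 rfl⟩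

theorem onRay_iff (h : Axioms I) {O A X : P} {m : L} (hO : I O m) (hA : I A m) (hAO : A ≠ O) :
    OnRay I O A X ↔ X ≠ O ∧ I X m ∧ ¬ Btw I X O A := by
  constructor
  · rintro ⟨h1, ⟨n, h2, h3, h4⟩, h5⟩
    obtain rfl := h.eq_line hAO hA hO h3 h2
    exact ⟨h1, h4, h5⟩
  · rintro ⟨h1, h2, h3⟩
    exact ⟨h1, ⟨m, hO, hA, h2⟩, h3⟩

theorem onRay_trans (h : Axioms I) {O A B X : P} (hA : A ≠ O) (h1 : OnRay I O A B) (h2 : OnRay I O B X) :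
    OnRay I O A X := by
  obtain ⟨m, hO, hAm⟩ := h.exists_line O A
  rw [h.onRay_iff hO hAm hA] at h1 ⊢
  rw [h.onRay_iff hO h1.2.1 h1.1] at h2
  exact ⟨h2.1, h2.2.1, h.not_btw_trans h2.2.1 hO h1.2.1 h1.1 h2.2.2 h1.2.2⟩

theorem onRay_symm (_ : Axioms I) {O A B : P} (hA : A ≠ O) (h1 : OnRay I O A B) : OnRay I O B A :=
  ⟨hA, h1.2.1.imp fun _ ⟨a, b, c⟩ => ⟨a, c, b⟩, fun t => h1.2.2 t.symm⟩

theorem onRay_congr (h : Axioms I) {O A B X : P} (hA : A ≠ O) (h1 : OnRay I O A B) :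
    OnRay I O B X ↔ OnRay I O A X :=
  ⟨h.onRay_trans hA h1, h.onRay_trans h1.1 (h.onRay_symm hA h1)⟩

theorem onRay_of_btw (h : Axioms I) {O X Y : P} (t : Btw I O X Y) : OnRay I O X Y := by
  obtain ⟨m, h1, h2, h3⟩ := t.line
  exact (h.onRay_iff h1 h2 t.ne12.symm).2 ⟨t.ne13.symm, h3, fun t' => h.btw_unique t t'.symm⟩

theorem rayEnd_congr (h : Axioms I) {O A B : P} (hA : A ≠ O) (h1 : OnRay I O A B) :
    rayEnd I O B = rayEnd I O A := by
  unfold rayEnd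
  have : {X | OnRay I O B X} = {X | OnRay I O A X} := Set.ext fun X => h.onRay_congr hA h1
  rw [this]

theorem onRay_cases (h : Axioms I) {O A X Y : P} (hA : A ≠ O) (h1 : OnRay I O A X)
    (h2 : OnRay I O A Y) : X = Y ∨ Btw I O X Y ∨ Btw I O Y X := by
  by_cases e : X = Y
  · exact Or.inl e
  obtain ⟨m, hO, hAm⟩ := h.exists_line O A
  have h3 := (h.onRay_congr hA h1).2 h2
  rw [h.onRay_iff hO hAm hA] at h1 h2
  rw [h.onRay_iff hO h1.2.1 h1.1] at h3
  rcases h.btw_total h1.1.symm e h2.1.symm hO h1.2.1 h2.2.1 with t | t | t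
  · exact (h3.2.2 t.symm).elim
  · exact Or.inr (Or.inl t)
  · exact Or.inr (Or.inr t)

theorem mem_rayEnd (h : Axioms I) {O A : P} (hA : A ≠ O) {s : Set P} :
    s ∈ rayEnd I O A ↔ ∃ X, OnRay I O A X ∧ ∀ Y, Btw I O X Y → Y ∈ s := by
  unfold rayEnd
  rw [mem_biInf_of_directed]
  · simp only [mem_principal, Set.mem_ofPred_eq]; rfl
  · intro X hX Y hY
    rcases h.onRay_cases hA hX hY with e | t | t
    · subst e; exact ⟨X, hX, le_refl _, le_refl _⟩
    · exact ⟨Y, hY, principal_mono.2 fun Z hZ => (h.btw_nest t hZ).1, le_refl _⟩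
    · exact ⟨X, hX, le_refl _, principal_mono.2 fun Z hZ => (h.btw_nest t hZ).1⟩
  · exact ⟨A, h.onRay_self hA⟩

theorem rayEnd_neBot (h : Axioms I) {O A : P} (hA : A ≠ O) : (rayEnd I O A).NeBot := by
  rw [neBot_iff]
  intro e
  have : (∅ : Set P) ∈ rayEnd I O A := e ▸ mem_bot
  obtain ⟨X, hX, hs⟩ := (h.mem_rayEnd hA).1 this
  obtain ⟨Y, hY⟩ := h.extend hX.1.symm
  exact hs Y hY

theorem ev_onRay (h : Axioms I) {O A : P} (hA : A ≠ O) : ∀ᶠ Y in rayEnd I O A, OnRay I O A Y :=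
  (h.mem_rayEnd hA).2 ⟨A, h.onRay_self hA, fun _ t => h.onRay_of_btw t⟩

theorem ev_btw (h : Axioms I) {O A X : P} (hA : A ≠ O) (hX : OnRay I O A X) :
    ∀ᶠ Y in rayEnd I O A, Btw I O X Y :=
  (h.mem_rayEnd hA).2 ⟨X, hX, fun _ t => t⟩

/-- The filter forgets the origin of the ray; this is what makes a direction belong to the line
rather than to a chosen ray. -/
theorem rayEnd_shift (h : Axioms I) {O X A : P} (t : Btw I O X A) : rayEnd I X A = rayEnd I O A := by
  obtain ⟨m, Om, Xm, Am⟩ := t.line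
  have hA : A ≠ O := t.ne13.symm
  have hAX : A ≠ X := t.ne23.symm
  ext s
  rw [h.mem_rayEnd hA, h.mem_rayEnd hAX]
  constructor
  · rintro ⟨Z, hZ, hs⟩
    have hZ' := (h.onRay_iff Xm Am hAX).1 hZ
    have hXZ : Btw I O X Z :=
      (h.btw_split t Om Xm hZ'.2.1 hZ'.1).resolve_right fun w => hZ'.2.2 w.symm
    refine ⟨Z, ?_, fun Y hY => hs Y (h.btw_nest hXZ hY).2⟩
    exact h.onRay_trans hA (h.onRay_symm t.ne12.symm (h.onRay_of_btw t)) (h.onRay_of_btw hXZ)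
  · rintro ⟨Z, hZ, hs⟩
    rcases h.onRay_cases hA (h.onRay_self hA) hZ with e | w | w
    · subst e
      exact ⟨A, h.onRay_self hAX, fun Y hY => hs Y (h.btw_chain t hY).2⟩
    · have w' := (h.btw_nest t w)
      exact ⟨Z, h.onRay_of_btw w'.2, fun Y hY => hs Y (h.btw_chain w'.1 hY).2⟩
    · refine ⟨A, h.onRay_self hAX, fun Y hY => hs Y ?_⟩
      exact (h.btw_nest w (h.btw_chain t hY).2).1

end Axioms

namespace Dir

variable {F G : Filter P} {a b k : L}

theorem neBot (d : Dir I F a) (h : Axioms I) : F.NeBot := by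
  obtain ⟨O, A, hOA, -, -, rfl⟩ := d; exact h.rayEnd_neBot hOA.symm

theorem base (d : Dir I F a) (h : Axioms I) {X : P} (hX : I X a) :
    ∃ Y, I Y a ∧ Y ≠ X ∧ F = rayEnd I X Y := by
  obtain ⟨O, A, hOA, Oa, Aa, rfl⟩ := d
  by_cases e : X = O
  · subst e; exact ⟨A, Aa, hOA.symm, rfl⟩
  by_cases t : Btw I X O A
  · exact ⟨A, Aa, t.ne13.symm, h.rayEnd_shift t⟩
  · obtain ⟨B, hB⟩ := h.extend (Ne.symm e)
    have hX' : OnRay I O A X := (h.onRay_iff Oa Aa hOA.symm).2 ⟨e, hX, t⟩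
    refine ⟨B, hB.mem3 h Oa hX, hB.ne23.symm, ?_⟩
    rw [h.rayEnd_shift hB, h.rayEnd_congr e (h.onRay_of_btw hB), h.rayEnd_congr hOA.symm hX']

theorem ev_mem (d : Dir I F a) (h : Axioms I) : ∀ᶠ Y in F, I Y a := by
  obtain ⟨O, A, hOA, Oa, Aa, rfl⟩ := d
  filter_upwards [h.ev_onRay hOA.symm] with Y hY using ((h.onRay_iff Oa Aa hOA.symm).1 hY).2.1

theorem ev_base (d : Dir I F a) (h : Axioms I) {X : P} (hX : I X a) :
    ∀ᶠ Y in F, I Y a ∧ Y ≠ X ∧ F = rayEnd I X Y := by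
  obtain ⟨A, Aa, hA, rfl⟩ := d.base h hX
  filter_upwards [h.ev_onRay hA] with Y hY
  exact ⟨((h.onRay_iff hX Aa hA).1 hY).2.1, hY.1, (h.rayEnd_congr hA hY).symm⟩

theorem line_unique (d : Dir I F a) (d' : Dir I F b) (h : Axioms I) : a = b := by
  obtain ⟨X, hX⟩ := h.A2 a
  have := d.neBot h
  obtain ⟨Y, ⟨h1, h2, -⟩, h3⟩ := ((d.ev_base h hX).and (d'.ev_mem h)).exists
  obtain ⟨Z, ⟨h4, h5, -⟩, h6⟩ := ((d.ev_base h h1).and (d'.ev_mem h)).exists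
  exact h.eq_line h5 h4 h1 h6 h3

theorem far (d : Dir I F a) (h : Axioms I) {X Y : P} (hX : I X a) (hY : I Y a) (hXY : X ≠ Y) :
    ∀ᶠ Z in F, Btw I X Y Z ∨ Btw I Y X Z := by
  obtain ⟨A, Aa, hA, rfl⟩ := d.base h hX
  by_cases t : Btw I Y X A
  · filter_upwards [h.ev_onRay hA] with Z hZ
    have hZ' := (h.onRay_iff hX Aa hA).1 hZ
    exact Or.inr ((h.btw_split t hY hX hZ'.2.1 hZ'.1).resolve_right fun w => hZ'.2.2 w.symm)
  · filter_upwards [h.ev_btw hA ((h.onRay_iff hX Aa hA).2 ⟨hXY.symm, hY, t⟩)] with Z hZ using Or.inl hZ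

end Dir

namespace Axioms

theorem side_onRay (h : Axioms I) {O A X : P} {k a : L} (hA : A ≠ O) (Oa : I O a) (Aa : I A a)
    (Ok : I O k) (n : k ≠ a) (hX : OnRay I O A X) : ¬ I X k ∧ (side I k X ↔ side I k A) := by
  rw [h.onRay_iff Oa Aa hA] at hX
  have h1 : ¬ I X k := fun hh => n (h.eq_line hX.1 hh Ok hX.2.1 Oa)
  have h2 : ¬ I A k := fun hh => n (h.eq_line hA hh Ok Aa Oa)
  exact ⟨h1, not_not.1 fun e => hX.2.2 ((h.side_btw h1 h2 Ok hX.2.1 Aa Oa).2 e)⟩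

theorem tail_rayEnd (h : Axioms I) {O A : P} {k a : L} (hA : A ≠ O) (Oa : I O a) (Aa : I A a)
    (Ok : I O k) (n : k ≠ a) : Tail I (rayEnd I O A) k ↔ side I k A := by
  have := h.rayEnd_neBot hA
  constructor
  · intro t
    obtain ⟨Y, h1, h2⟩ := (t.and (h.ev_onRay hA)).exists
    exact (h.side_onRay hA Oa Aa Ok n h2).2.1 h1
  · intro s
    filter_upwards [h.ev_onRay hA] with Y hY using (h.side_onRay hA Oa Aa Ok n hY).2.2 s

end Axioms

namespace Dir

variable {F G : Filter P} {a b k : L}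

theorem tail_miss (d : Dir I F a) (h : Axioms I) (n : ¬ Tch I k a) {X : P} (hX : I X a) :
    Tail I F k ↔ side I k X := by
  have := d.neBot h
  constructor
  · intro t
    obtain ⟨Y, h1, h2⟩ := (t.and (d.ev_mem h)).exists
    exact (h.side_of_miss (fun t => n t.symm) h2 hX).1 h1
  · intro s
    filter_upwards [d.ev_mem h] with Y hY using (h.side_of_miss (fun t => n t.symm) hY hX).2 s

theorem tail_ev (d : Dir I F a) (h : Axioms I) (n : k ≠ a) :
    ∀ᶠ Y in F, I Y a ∧ ¬ I Y k ∧ (side I k Y ↔ Tail I F k) := by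
  by_cases t : Tch I k a
  · obtain ⟨X, h1, h2⟩ := t
    obtain ⟨A, Aa, hA, rfl⟩ := d.base h h2
    filter_upwards [h.ev_onRay hA] with Y hY
    have := h.side_onRay hA h2 Aa h1 n hY
    exact ⟨((h.onRay_iff h2 Aa hA).1 hY).2.1, this.1, this.2.trans (h.tail_rayEnd hA h2 Aa h1 n).symm⟩
  · filter_upwards [d.ev_mem h] with Y hY
    exact ⟨hY, fun hh => t ⟨Y, hh, hY⟩, (d.tail_miss h t hY).symm⟩

/-- A point on the ray of `F` from `X`. -/
theorem pt (d : Dir I F a) (h : Axioms I) {X : P} (hX : I X a) : ∃ Y, I Y a ∧ Y ≠ X ∧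
    F = rayEnd I X Y ∧ ∀ k, I X k → k ≠ a → (Tail I F k ↔ side I k Y) := by
  obtain ⟨A, Aa, hA, rfl⟩ := d.base h hX
  exact ⟨A, Aa, hA, rfl, fun k hk n => h.tail_rayEnd hA hX Aa hk n⟩

/-- Along a ray starting off `k` the side with respect to `k` changes at the intersection and
nowhere else. -/
theorem hit (d : Dir I F a) (h : Axioms I) {Z : P} (hZ : I Z a) (hZk : ¬ I Z k) (n : k ≠ a) :
    (∃ X, I X k ∧ I X a ∧ F = rayEnd I Z X) ↔ ¬ (Tail I F k ↔ side I k Z) := by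
  have := d.neBot h
  constructor
  · rintro ⟨X, Xk, Xa, e⟩ e'
    have hXZ : X ≠ Z := by rintro rfl; exact hZk Xk
    have e1 := h.ev_btw hXZ (h.onRay_self hXZ)
    rw [← e] at e1
    obtain ⟨Y, h1, h2, h3, h4⟩ := (e1.and (d.tail_ev h n)).exists
    exact (h.side_btw hZk h3 Xk hZ h2 Xa).1 h1 (e'.symm.trans h4.symm)
  · intro e
    by_cases t : Tch I k a
    · obtain ⟨X, Xk, Xa⟩ := t
      refine ⟨X, Xk, Xa, ?_⟩
      have hXZ : X ≠ Z := by rintro rfl; exact hZk Xk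
      obtain ⟨Y, ⟨y1, y2, y3⟩, h2, h3, h4⟩ := ((d.ev_base h hZ).and (d.tail_ev h n)).exists
      have := (h.side_btw hZk h3 Xk hZ h2 Xa).2 fun e' => e (h4.symm.trans e'.symm)
      rw [y3, h.rayEnd_congr hXZ (h.onRay_of_btw this)]
    · exact (e (d.tail_miss h t hZ)).elim

theorem ext (d : Dir I F a) (d' : Dir I G a) (h : Axioms I) (n : k ≠ a) (t : Tch I k a)
    (e : Tail I F k ↔ Tail I G k) : F = G := by
  obtain ⟨X, Xk, Xa⟩ := t
  obtain ⟨Y, Ya, hY, rfl, eY⟩ := d.pt h Xa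
  obtain ⟨Z, Za, hZ, rfl, eZ⟩ := d'.pt h Xa
  rw [eY k Xk n, eZ k Xk n] at e
  refine (h.rayEnd_congr hY ((h.onRay_iff Xa Ya hY).2 ⟨hZ, Za, fun w => ?_⟩)).symm
  have h1 : ¬ I Y k := fun hh => n (h.eq_line hY hh Xk Ya Xa)
  have h2 : ¬ I Z k := fun hh => n (h.eq_line hZ hh Xk Za Xa)
  exact (h.side_btw h2 h1 Xk Za Ya Xa).1 w e.symm

theorem exists_with (h : Axioms I) (n : k ≠ a) (t : Tch I k a) (p : Prop) :
    ∃ F, Dir I F a ∧ (Tail I F k ↔ p) := by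
  obtain ⟨X, Xk, Xa⟩ := t
  obtain ⟨Y, Ya, hY⟩ := h.exists_pt_ne X a
  obtain ⟨Z, t⟩ := h.extend hY
  have Za := t.mem3 h Ya Xa
  have h1 : ¬ I Y k := fun hh => n (h.eq_line hY hh Xk Ya Xa)
  have h2 : ¬ I Z k := fun hh => n (h.eq_line t.ne23.symm hh Xk Za Xa)
  have e := (h.side_btw h1 h2 Xk Ya Za Xa).1 t
  by_cases q : side I k Y ↔ p
  · exact ⟨_, ⟨X, Y, hY.symm, Xa, Ya, rfl⟩, (h.tail_rayEnd hY Xa Ya Xk n).trans q⟩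
  · refine ⟨_, ⟨X, Z, t.ne23, Xa, Za, rfl⟩, (h.tail_rayEnd t.ne23.symm Xa Za Xk n).trans ?_⟩
    tauto

theorem exists_opp (_ : Dir I F a) (h : Axioms I) : ∃ G, Dir I G a ∧ G ≠ F := by
  obtain ⟨X, hX⟩ := h.A2 a
  obtain ⟨k, hk, n⟩ := h.exists_line_ne X a
  obtain ⟨G, hG, e⟩ := exists_with h n ⟨X, hk, hX⟩ (¬ Tail I F k)
  exact ⟨G, hG, fun e' => by rw [e'] at e; tauto⟩

theorem tail_opp (d : Dir I F a) (d' : Dir I G a) (h : Axioms I) (hFG : F ≠ G) (n : k ≠ a)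
    (t : Tch I k a) : Tail I F k ↔ ¬ Tail I G k := by
  have := mt (d.ext d' h n t) hFG
  tauto

theorem eq_or (d : Dir I F a) (d' : Dir I G a) {H : Filter P} (d'' : Dir I H a) (h : Axioms I)
    (hFG : F ≠ G) : H = F ∨ H = G := by
  obtain ⟨X, hX⟩ := h.A2 a
  obtain ⟨k, hk, n⟩ := h.exists_line_ne X a
  have t : Tch I k a := ⟨X, hk, hX⟩
  by_contra hc
  push Not at hc
  have h1 := d.tail_opp d' h hFG n t
  have h2 := d''.tail_opp d h hc.1 n t
  have h3 := d''.tail_opp d' h hc.2 n t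
  tauto

theorem exists_dir (h : Axioms I) (a : L) : ∃ F, Dir I F a := by
  obtain ⟨X, hX⟩ := h.A2 a
  obtain ⟨k, hk, n⟩ := h.exists_line_ne X a
  exact (exists_with h n ⟨X, hk, hX⟩ True).imp fun _ => And.left

end Dir
end HypInc

/-! ### Being asymptotic is an equivalence relation. -/

namespace HypInc

universe u v

variable {P : Type u} {L : Type v} {I : P → L → Prop}

open Filter

variable {F G H : Filter P} {a b c k : L}

theorem Axioms.off (h : Axioms I) {A X : P} {m n : L} (hm : I A m) (hn : I A n) (hmn : m ≠ n)
    (hX : I X m) (hXA : X ≠ A) : ¬ I X n := fun hh => hXA (h.eq_pt hmn hX hh hm hn)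

/-- The directions `F` of `a` and `G` of `b` are equal or asymptotic. -/
def Asy (I : P → L → Prop) (a : L) (F : Filter P) (b : L) (G : Filter P) : Prop :=
  Dir I F a ∧ Dir I G b ∧ (F = G ∨ (¬ Tch I a b ∧
    ∀ k, k ≠ a → k ≠ b → (Tch I k a ∨ Tch I k b) → (Tail I F k ↔ Tail I G k)))

/-- The transversal turns about `A` from `t` to `t'`. For `F` the change of side is governed by
`trio` at `A`; for `G` by the fact that far points of `b` lie beyond `B'` from `B` or beyond `B`
from `B'`. -/
theorem Dir.compat_pivot (dF : Dir I F a) (dG : Dir I G b) (h : Axioms I) (nab : ¬ Tch I a b)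
    {A B B' : P} {t t' : L} (Aa : I A a) (At : I A t) (At' : I A t') (Bt : I B t) (Bb : I B b)
    (Bt' : I B' t') (Bb' : I B' b) :
    (Tail I F t ↔ Tail I G t) ↔ (Tail I F t' ↔ Tail I G t') := by
  have nA : ∀ {X}, I X b → X ≠ A := by rintro X hX rfl; exact nab ⟨X, Aa, hX⟩
  by_cases e : B = B'
  · subst e
    obtain rfl := h.eq_line (nA Bb) Bt At Bt' At'
    exact Iff.rfl
  have hta : t ≠ a := by rintro rfl; exact nab ⟨B, Bt, Bb⟩
  have hta' : t' ≠ a := by rintro rfl; exact nab ⟨B', Bt', Bb'⟩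
  have htb : t ≠ b := by rintro rfl; exact nab ⟨A, Aa, At⟩
  have htb' : t' ≠ b := by rintro rfl; exact nab ⟨A, Aa, At'⟩
  have htt : t ≠ t' := by rintro rfl; exact htb (h.eq_line e Bt Bt' Bb Bb')
  obtain ⟨Y, Ya, hY, -, eY⟩ := dF.pt h Aa
  have T := h.trio At At' Aa Bt Bt' Ya (nA Bb) (nA Bb') hY htt hta hta'
  have s := h.side_of_miss (fun t => nab t.symm) Bb Bb'
  have := dG.neBot h
  obtain ⟨Z, ⟨z1, z2, z3⟩, ⟨-, z5, z6⟩, z7⟩ :=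
    (((dG.tail_ev h htb).and (dG.tail_ev h htb')).and (dG.far h Bb Bb' e) |>.mono
      fun Z hZ => (⟨hZ.1.1, hZ.1.2, hZ.2⟩ : _ ∧ _ ∧ _)).exists
  have hB't := h.off Bb Bt htb.symm Bb' (Ne.symm e)
  have hBt' := h.off Bb' Bt' htb'.symm Bb e
  have w1 := h.side_btw hB't z2 Bt Bb' z1 Bb
  have w2 := h.side_btw hBt' z5 Bt' Bb z1 Bb'
  have w3 : ¬ (Btw I B B' Z ∧ Btw I B' B Z) := fun ⟨x, y⟩ => h.btw_unique x y
  rw [eY t At hta, eY t' At' hta']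
  clear eY
  grind

/-- If `F` and `G` agree on one transversal, they agree on all of them. -/
theorem Dir.compat (dF : Dir I F a) (dG : Dir I G b) (h : Axioms I) (nab : ¬ Tch I a b) {t t' : L}
    (ta : Tch I t a) (tb : Tch I t b) (ta' : Tch I t' a) (tb' : Tch I t' b)
    (e : Tail I F t ↔ Tail I G t) : Tail I F t' ↔ Tail I G t' := by
  obtain ⟨A, At, Aa⟩ := ta
  obtain ⟨B, Bt, Bb⟩ := tb
  obtain ⟨A', At', Aa'⟩ := ta'
  obtain ⟨B', Bt', Bb'⟩ := tb'
  obtain ⟨s, As, Bs⟩ := h.exists_line A B'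
  have e1 := (dF.compat_pivot dG h nab Aa At As Bt Bb Bs Bb').1 e
  have e2 := (dG.compat_pivot dF h (fun t => nab t.symm) Bb' Bs Bt' As Aa At' Aa').1 e1.symm
  exact e2.symm

namespace Asy

theorem refl (d : Dir I F a) : Asy I a F a F := ⟨d, d, Or.inl rfl⟩

theorem symm (s : Asy I a F b G) : Asy I b G a F :=
  ⟨s.2.1, s.1, s.2.2.imp Eq.symm fun ⟨n, e⟩ =>
    ⟨fun t => n t.symm, fun k h1 h2 h3 => (e k h2 h1 h3.symm).symm⟩⟩

theorem mk (dF : Dir I F a) (dG : Dir I G b) (n : ¬ Tch I a b)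
    (e : ∀ k, k ≠ a → k ≠ b → (Tch I k a ∨ Tch I k b) → (Tail I F k ↔ Tail I G k)) :
    Asy I a F b G := ⟨dF, dG, Or.inr ⟨n, e⟩⟩

theorem miss (s : Asy I a F b G) (h : Axioms I) (n : a ≠ b) : ¬ Tch I a b := by
  obtain ⟨dF, dG, rfl | ⟨s, -⟩⟩ := s
  · exact (n (dF.line_unique dG h)).elim
  · exact s

theorem tail (s : Asy I a F b G) (h1 : k ≠ a) (h2 : k ≠ b) (t : Tch I k a ∨ Tch I k b) :
    Tail I F k ↔ Tail I G k := by
  obtain ⟨dF, dG, rfl | ⟨-, e⟩⟩ := s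
  · exact Iff.rfl
  · exact e k h1 h2 t

theorem eq (s : Asy I a F a G) (h : Axioms I) : F = G := by
  obtain ⟨dF, dG, e | ⟨n, -⟩⟩ := s
  · exact e
  · exact (n (h.tch_self a)).elim

/-- At most one line through a point is asymptotic to a given direction. -/
theorem unique (h : Axioms I) (s1 : Asy I a F b G) (s2 : Asy I c H b G) {Q : P} (Qa : I Q a)
    (Qc : I Q c) : a = c := by
  by_contra nac
  by_cases eab : a = b
  · subst eab; exact s2.miss h (Ne.symm nac) ⟨Q, Qc, Qa⟩
  by_cases ecb : c = b
  · subst ecb; exact s1.miss h nac ⟨Q, Qa, Qc⟩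
  have n1 := s1.miss h eab
  have n2 := s2.miss h ecb
  obtain ⟨B, hB⟩ := h.A2 b
  obtain ⟨t, Qt, Bt⟩ := h.exists_line Q B
  have nta : t ≠ a := by rintro rfl; exact n1 ⟨B, Bt, hB⟩
  have ntc : t ≠ c := by rintro rfl; exact n2 ⟨B, Bt, hB⟩
  have ntb : t ≠ b := by rintro rfl; exact n1 ⟨Q, Qa, Qt⟩
  have hBQ : B ≠ Q := by rintro rfl; exact n1 ⟨B, Qa, hB⟩
  have e1 := s1.tail nta ntb (Or.inl ⟨Q, Qt, Qa⟩)
  have e2 := s2.tail ntc ntb (Or.inl ⟨Q, Qt, Qc⟩)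
  have e3 := s1.tail (Ne.symm nac) ecb (Or.inl ⟨Q, Qc, Qa⟩)
  have e4 := s2.tail nac eab (Or.inl ⟨Q, Qa, Qc⟩)
  obtain ⟨Y, Ya, hY, -, eY⟩ := s1.1.pt h Qa
  obtain ⟨Z, Zc, hZ, -, eZ⟩ := s2.1.pt h Qc
  have T := h.trio Qt Qa Qc Bt Ya Zc hBQ hY hZ nta ntc nac
  rw [eY _ Qt nta] at e1
  rw [eZ _ Qt ntc] at e2
  rw [eY _ Qc (Ne.symm nac), s1.2.1.tail_miss h n2 hB] at e3
  rw [eZ _ Qa nac, s1.2.1.tail_miss h n1 hB] at e4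
  clear eY eZ
  grind

/-- A line `f` through `B` that misses `g` but reaches `k` has `c`, which is beyond `g`, on its
`Z`-side; since `F` and `G` have the same tail, this fixes the side of `F`. The same holds with `k`
and `g` exchanged, and the two results contradict `trio` at `B`. -/
theorem not_separate (h : Axioms I) (s : Asy I b F c G) {k g : L} {B C Z : P} (Bb : I B b) (Cc : I C c)
    (Zk : I Z k) (Zg : I Z g) (nkg : k ≠ g) (kb : ¬ Tch I k b) (kc : ¬ Tch I k c) (gb : ¬ Tch I g b)
    (gc : ¬ Tch I g c) (h1 : ¬ (side I k B ↔ side I k C)) (h2 : ¬ (side I g B ↔ side I g C)) :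
    False := by
  have main : ∀ k g : L, I Z k → I Z g → k ≠ g → ¬ Tch I k b → ¬ Tch I k c → ¬ Tch I g b →
      ¬ Tch I g c → ¬ (side I k B ↔ side I k C) → ¬ (side I g B ↔ side I g C) →
      ∃ f K, I B f ∧ ¬ Tch I f g ∧ I K f ∧ I K k ∧ f ≠ b ∧ f ≠ c ∧ K ≠ B ∧
        (Tail I F f ↔ side I f Z) := by
    intro k g Zk Zg nkg kb kc gb gc h1 h2
    obtain ⟨f, Bf, fg, K, Kf, Kk⟩ := h.avoid (ntch (fun t => gb t.symm) Bb) ⟨Z, Zk, Zg⟩ nkg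
    have nfb : f ≠ b := by rintro rfl; exact kb ⟨K, Kk, Kf⟩
    have fc : ¬ Tch I f c := by
      rintro ⟨X, Xf, Xc⟩
      exact h2 ((h.side_of_miss fg Bf Xf).trans (h.side_of_miss (fun t => gc t.symm) Xc Cc))
    have nfc : f ≠ c := by rintro rfl; exact fc (h.tch_self f)
    refine ⟨f, K, Bf, fg, Kf, Kk, nfb, nfc, ?_, ?_⟩
    · rintro rfl; exact kb ⟨K, Kk, Bb⟩
    · rw [s.tail nfb nfc (Or.inl ⟨B, Bf, Bb⟩), s.2.1.tail_miss h fc Cc]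
      exact (h.nested (fun t => fg t.symm) Bf Zg (fun hh => gc ⟨C, hh, Cc⟩)
        fun e => h2 e.symm).2
  obtain ⟨f, K, Bf, fg, Kf, Kk, nfb, nfc, hK, e1⟩ := main k g Zk Zg nkg kb kc gb gc h1 h2
  obtain ⟨f', K', Bf', fk', Kf', Kg', nfb', nfc', hK', e2⟩ :=
    main g k Zg Zk nkg.symm gb gc kb kc h2 h1
  obtain ⟨Y, Yb, hY, -, eY⟩ := s.1.pt h Bb
  have nff : f ≠ f' := by rintro rfl; exact fg ⟨K', Kf', Kg'⟩
  have T := h.trio Bf Bf' Bb Kf Kf' Yb hK hK' hY nff nfb nfb'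
  rw [eY f Bf nfb] at e1
  rw [eY f' Bf' nfb'] at e2
  have a1 := h.side_of_miss (fun t => fg t.symm) Kg' Zg
  have a2 := h.side_of_miss (fun t => fk' t.symm) Kk Zk
  have a3 := h.side_of_miss kb Kk Zk
  have a4 := h.side_of_miss gb Kg' Zg
  clear main eY
  grind

/-- The critical case is a line `k` through a point `R` of `a` that misses both `b` and `c` and
separates them. It then crosses a segment from `b` to a far point of `c`, and `trio` at `R`
contradicts the tails of `F` and `H`. -/
theorem trans_aux (h : Axioms I) (s1 : Asy I a F b G) (s2 : Asy I b G c H) (nab : a ≠ b) (nbc : b ≠ c)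
    (nac : a ≠ c) (ac : ¬ Tch I a c) (ka : k ≠ a) (kc : k ≠ c) (t : Tch I k a) :
    Tail I F k ↔ Tail I H k := by
  have ab := s1.miss h nab
  have bc := s2.miss h nbc
  have kb : k ≠ b := by rintro rfl; exact ab t.symm
  have e1 := s1.tail ka kb (Or.inl t)
  by_cases tb : Tch I k b
  · exact e1.trans (s2.tail kb kc (Or.inl tb))
  by_cases tc : Tch I k c
  · exact e1.trans (s2.tail kb kc (Or.inr tc))
  obtain ⟨R, Rk, Ra⟩ := t
  obtain ⟨B, hB⟩ := h.A2 b
  obtain ⟨g, Rg, Bg⟩ := h.exists_line R B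
  have hBR : B ≠ R := by rintro rfl; exact ab ⟨B, Ra, hB⟩
  have nga : g ≠ a := by rintro rfl; exact ab ⟨B, Bg, hB⟩
  have ngb : g ≠ b := by rintro rfl; exact ab ⟨R, Ra, Rg⟩
  have ngk : g ≠ k := by rintro rfl; exact tb ⟨B, Bg, hB⟩
  have ngc : g ≠ c := by rintro rfl; exact bc ⟨B, hB, Bg⟩
  have e2 := s1.tail nga ngb (Or.inl ⟨R, Rg, Ra⟩)
  have e3 := s2.tail ngb ngc (Or.inl ⟨B, Bg, hB⟩)
  have := s2.2.1.neBot h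
  obtain ⟨W, Wc, Wg, eW⟩ := (s2.2.1.tail_ev h ngc).exists
  rw [e1, s1.2.1.tail_miss h tb hB, s2.2.1.tail_miss h tc Wc]
  rw [s1.2.1.tail_miss h tb hB] at e1
  by_contra sep
  have hBk : ¬ I B k := fun hh => tb ⟨B, hh, hB⟩
  have hWk : ¬ I W k := fun hh => tc ⟨W, hh, Wc⟩
  have hBa : ¬ I B a := fun hh => ab ⟨B, hh, hB⟩
  have hWa : ¬ I W a := fun hh => ac ⟨W, hh, Wc⟩
  -- Both `k` and `a` pass through `R` and miss `b` and `c`, so by `not_separate` they cannot both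
  -- separate the two.
  have asep : side I a B ↔ side I a W := by
    by_contra n
    exact s2.not_separate h hB Wc Rk Ra ka tb tc ab ac sep n
  obtain ⟨K, Kk, w⟩ := (h.opp_iff hBk hWk).2 sep
  have k1 := h.side_open Bg w Wg
  have k2 := h.side_seg w hBa hWa asep
  have hKR : K ≠ R := by rintro rfl; exact k1.1 Rg
  obtain ⟨Y, Ya, hY, -, eY⟩ := s1.1.pt h Ra
  have T := h.trio Rg Ra Rk Bg Ya Kk hBR hY hKR nga ngk (Ne.symm ka)
  rw [eY k Rk ka] at e1
  rw [eY g Rg nga] at e2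
  clear eY
  grind

theorem trans (h : Axioms I) (s1 : Asy I a F b G) (s2 : Asy I b G c H) : Asy I a F c H := by
  by_cases nab : a = b
  · subst nab; rw [s1.eq h]; exact s2
  by_cases nbc : b = c
  · subst nbc; rw [← s2.eq h]; exact s1
  have ab := s1.miss h nab
  have bc := s2.miss h nbc
  by_cases nac : a = c
  · subst nac
    obtain ⟨A, hA⟩ := h.A2 a
    obtain ⟨B, hB⟩ := h.A2 b
    obtain ⟨k, Ak, Bk⟩ := h.exists_line A B
    have ka : k ≠ a := by rintro rfl; exact ab ⟨B, Bk, hB⟩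
    have kb : k ≠ b := by rintro rfl; exact ab ⟨A, hA, Ak⟩
    have e := (s1.tail ka kb (Or.inl ⟨A, Ak, hA⟩)).trans (s2.tail kb ka (Or.inl ⟨B, Bk, hB⟩))
    rw [s1.1.ext s2.2.1 h ka ⟨A, Ak, hA⟩ e]
    exact refl s2.2.1
  have ac : ¬ Tch I a c := fun ⟨Q, Qa, Qc⟩ => nac (unique h s1 s2.symm Qa Qc)
  refine mk s1.1 s2.2.1 ac fun k ka kc t => ?_
  rcases t with t | t
  · exact trans_aux h s1 s2 nab nbc nac ac ka kc t
  · exact (trans_aux h s2.symm s1.symm (Ne.symm nbc) (Ne.symm nab) (Ne.symm nac)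
      (fun t => ac t.symm) kc ka t).symm

end Asy
end HypInc

/-! ### Existence of asymptotes; asymptotic directions are parallel rays. -/

namespace HypInc

universe u v

variable {P : Type u} {L : Type v} {I : P → L → Prop}

open Filter

variable {F G H : Filter P} {a b c k l m n : L}

/-- The lines `m`, `n` are the pair that (A5) supplies at `A` for `l`, and `low` says that `m` is
the one next to `l` in the direction `G`. This extremal line is the asymptote. -/
theorem asy_exists_aux (h : Axioms I) {A : P} (dG : Dir I G l) {Fm Fn : Filter P} (dm : Dir I Fm m)
    (dn : Dir I Fn n) (nmn : m ≠ n) (Am : I A m) (An : I A n) (ml : ¬ Tch I m l) (nl : ¬ Tch I n l)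
    (cov : ∀ f, Tch I f l → f ≠ l → Tch I f m ∨ Tch I f n) {X0 : P} (hX0 : I X0 l)
    {t : L} (At : I A t) (X0t : I X0 t) (em : Tail I Fm t ↔ Tail I G t) (en : Tail I Fn t ↔ Tail I G t)
    (low : ¬ (side I m X0 ↔ Tail I Fn m)) : Asy I m Fm l G := by
  -- A line that meets `l` but not `m` has to meet `n`. By `low` it can do so only with `A` on the
  -- same side as the far end of `l`.
  have key : ∀ k, k ≠ l → Tch I k l → ¬ Tch I k m → (Tail I G k ↔ side I k A) := by
    intro k kl ⟨X, Xk, Xl⟩ km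
    have kA : ¬ I A k := fun hh => km ⟨A, hh, Am⟩
    obtain ⟨x, Ax, Xx⟩ := h.exists_line A X
    have e1 := dm.compat dG h ml ⟨A, At, Am⟩ ⟨X0, X0t, hX0⟩ ⟨A, Ax, Am⟩ ⟨X, Xx, Xl⟩ em
    have e2 := dn.compat dG h nl ⟨A, At, An⟩ ⟨X0, X0t, hX0⟩ ⟨A, Ax, An⟩ ⟨X, Xx, Xl⟩ en
    obtain ⟨N, Nk, Nn⟩ := (cov k ⟨X, Xk, Xl⟩ kl).resolve_left km
    have hAX : A ≠ X := by rintro rfl; exact ml ⟨A, Am, Xl⟩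
    have hNX : N ≠ X := by rintro rfl; exact nl ⟨N, Nn, Xl⟩
    have hNA : N ≠ A := by rintro rfl; exact kA Nk
    have nxl : x ≠ l := by rintro rfl; exact ml ⟨A, Am, Ax⟩
    have nxk : x ≠ k := by rintro rfl; exact kA Ax
    have nxm : x ≠ m := by rintro rfl; exact ml ⟨X, Xx, Xl⟩
    have nxn : x ≠ n := by rintro rfl; exact nl ⟨X, Xx, Xl⟩
    obtain ⟨Y, Yl, hY, -, eY⟩ := dG.pt h Xl
    obtain ⟨Z, Zn, hZ, -, eZ⟩ := dn.pt h An
    have T := h.trio Xx Xl Xk Ax Yl Nk hAX hY hNX nxl nxk kl.symm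
    have s1 := h.side_of_miss nl An Nn
    have s2 := h.side_of_miss (fun t => ml t.symm) hX0 Xl
    have s3 := h.side_of_miss km Xk Nk
    have w1 := h.side_btw (h.off An Am nmn.symm Nn hNA) (h.off An Am nmn.symm Zn hZ) Am Nn Zn An
    have w2 := h.side_btw (h.off An Ax nxn.symm Nn hNA) (h.off An Ax nxn.symm Zn hZ) Ax Nn Zn An
    rw [eZ _ Am nmn] at low
    rw [eZ _ Ax nxn] at e2
    rw [eY _ Xx nxl] at e2
    rw [eY _ Xk kl]
    clear eY eZ e1 cov en em
    grind
  refine Asy.mk dm dG ml fun k km kl tk => ?_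
  by_cases t1 : Tch I k m <;> by_cases t2 : Tch I k l
  · exact dm.compat dG h ml ⟨A, At, Am⟩ ⟨X0, X0t, hX0⟩ t1 t2 em
  · obtain ⟨Y0, Y0k, Y0m⟩ := t1
    rw [dG.tail_miss h t2 hX0]
    have hX0m : ¬ I X0 m := fun hh => ml ⟨X0, hh, hX0⟩
    obtain ⟨x, Xx, xm, Z, Zx, Zk⟩ : ∃ x, I X0 x ∧ ¬ Tch I x m ∧ Tch I x k := by
      obtain ⟨w, w1, w2, w3⟩ := h.avoid hX0m ⟨Y0, Y0k, Y0m⟩ km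
      exact ⟨w, w1, w2, w3⟩
    have nxl : x ≠ l := by rintro rfl; exact t2 ⟨Z, Zk, Zx⟩
    have kx := key x nxl ⟨X0, Xx, hX0⟩ xm
    have hXY : X0 ≠ Y0 := by rintro rfl; exact hX0m Y0m
    obtain ⟨s, Xs, Ys⟩ := h.exists_line X0 Y0
    have e1 := dm.compat dG h ml ⟨A, At, Am⟩ ⟨X0, X0t, hX0⟩ ⟨Y0, Ys, Y0m⟩ ⟨X0, Xs, hX0⟩ em
    have nsm : s ≠ m := by rintro rfl; exact hX0m Xs
    have nsl : s ≠ l := by rintro rfl; exact ml ⟨Y0, Y0m, Ys⟩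
    have nsx : s ≠ x := by rintro rfl; exact xm ⟨Y0, Ys, Y0m⟩
    have nsk : s ≠ k := by rintro rfl; exact t2 ⟨X0, Xs, hX0⟩
    have hZX : Z ≠ X0 := by rintro rfl; exact t2 ⟨_, Zk, hX0⟩
    have hZY : Z ≠ Y0 := by rintro rfl; exact xm ⟨_, Zx, Y0m⟩
    obtain ⟨Y, Yl, hY, -, eY⟩ := dG.pt h hX0
    obtain ⟨Y', Ym, hY', -, eY'⟩ := dm.pt h Y0m
    have T1 := h.trio Xs hX0 Xx Ys Yl Zx hXY.symm hY hZX nsl nsx nxl.symm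
    have T2 := h.trio Ys Y0m Y0k Xs Ym Zk hXY hY' hZY nsm nsk km.symm
    have s1 := h.side_of_miss t2 Y0k Zk
    have s2 := h.side_of_miss xm Xx Zx
    have s3 := h.side_of_miss (fun t => xm t.symm) Am Y0m
    rw [eY _ Xx nxl] at kx
    rw [eY _ Xs nsl, eY' _ Ys nsm] at e1
    rw [eY' _ Y0k km]
    clear eY eY' key cov
    grind
  · rw [dm.tail_miss h t1 Am]
    exact (key k kl t2 t1).symm
  · exact (tk.elim t1 t2).elim

theorem asy_exists (h : Axioms I) (dG : Dir I G l) (A : P) : ∃ m F, I A m ∧ Asy I m F l G := by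
  by_cases hA : I A l
  · exact ⟨l, G, hA, Asy.refl dG⟩
  obtain ⟨m, n, nmn, Am, An, ml, nl, cov⟩ := h.cover hA
  obtain ⟨X0, hX0⟩ := h.A2 l
  obtain ⟨t, At, X0t⟩ := h.exists_line A X0
  have htm : t ≠ m := by rintro rfl; exact ml ⟨X0, X0t, hX0⟩
  have htn : t ≠ n := by rintro rfl; exact nl ⟨X0, X0t, hX0⟩
  have hXA : X0 ≠ A := by rintro rfl; exact hA hX0
  obtain ⟨Fm, dm, em⟩ := Dir.exists_with h htm ⟨A, At, Am⟩ (Tail I G t)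
  obtain ⟨Fn, dn, en⟩ := Dir.exists_with h htn ⟨A, At, An⟩ (Tail I G t)
  obtain ⟨Y, Ym, hY, -, eY⟩ := dm.pt h Am
  obtain ⟨Z, Zn, hZ, -, eZ⟩ := dn.pt h An
  -- By `trio` at `A`, if `m` is not next to `l` then `n` is.
  by_cases low : side I m X0 ↔ Tail I Fn m
  · refine ⟨n, Fn, An, asy_exists_aux h dG dn dm nmn.symm An Am nl ml
      (fun f h1 h2 => (cov f h1 h2).symm) hX0 At X0t en em ?_⟩
    have T := h.trio At Am An X0t Ym Zn hXA hY hZ htm htn nmn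
    rw [eY _ At htm] at em
    rw [eZ _ At htn] at en
    rw [eZ _ Am nmn] at low
    rw [eY _ An nmn.symm]
    clear eY eZ cov
    grind
  · exact ⟨m, Fm, Am, asy_exists_aux h dG dm dn nmn Am An ml nl cov hX0 At X0t em en low⟩

theorem Axioms.mem_ray (h : Axioms I) {R A X : P} (hA : A ≠ R) :
    X ∈ ray I R A ↔ X = R ∨ OnRay I R A X := by
  constructor
  · rintro (e | e | t | t)
    · exact Or.inl e
    · subst e; exact Or.inr (h.onRay_self hA)
    · exact Or.inr (h.onRay_symm t.ne12.symm (h.onRay_of_btw t))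
    · exact Or.inr (h.onRay_of_btw t)
  · rintro (e | t)
    · exact Or.inl e
    · rcases h.onRay_cases hA (h.onRay_self hA) t with e | e | e
      · exact Or.inr (Or.inl e.symm)
      · exact Or.inr (Or.inr (Or.inr e))
      · exact Or.inr (Or.inr (Or.inl e))

section Rays

variable {R A S B : P}

/-- If the lines met at `Q`, a line through a point `X` of the ray missing `b` could meet only the
segment `RS`, so it would separate `R` from `S` and hence from `Q`. All points of the ray except `Q`
would be between `R` and `Q`, but the far ones are not. -/
theorem rays_disjoint (h : Axioms I) (Ra : I R a) (Aa : I A a) (Sb : I S b) (Bb : I B b) (hA : A ≠ R)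
    (hB : B ≠ S) (nab : a ≠ b) (hits : ∀ k, Hits I k (ray I R A) → Hits I k (ray I S B) ∨
      Hits I k (segment I R S)) : ¬ Tch I a b := by
  rintro ⟨Q, Qa, Qb⟩
  have dF : Dir I (rayEnd I R A) a := ⟨R, A, hA.symm, Ra, Aa, rfl⟩
  have key : ∀ X, OnRay I R A X → X ≠ Q → Btw I R X Q := by
    intro X hX hXQ
    have hX' := (h.onRay_iff Ra Aa hA).1 hX
    have hXb : ¬ I X b := h.off Qa Qb nab hX'.2.1 hXQ
    obtain ⟨x, Xx, xb, -⟩ := h.avoid_ne hXb a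
    have nxa : x ≠ a := by rintro rfl; exact xb ⟨Q, Qa, Qb⟩
    have hRx : ¬ I R x := h.off hX'.2.1 Xx nxa.symm Ra hX.1.symm
    have hSx : ¬ I S x := fun hh => xb ⟨S, hh, Sb⟩
    have hQx : ¬ I Q x := fun hh => xb ⟨Q, hh, Qb⟩
    have sep : ¬ (side I x R ↔ side I x S) := by
      rcases hits x ⟨X, (h.mem_ray hA).2 (Or.inr hX), Xx⟩ with ⟨W, hW, Wx⟩ | ⟨W, hW, Wx⟩
      · rcases (h.mem_ray hB).1 hW with e | w
        · exact (hSx (e ▸ Wx)).elim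
        · exact (xb ⟨W, Wx, ((h.onRay_iff Sb Bb hB).1 w).2.1⟩).elim
      · rcases hW with e | e | w
        · exact (hRx (e ▸ Wx)).elim
        · exact (hSx (e ▸ Wx)).elim
        · exact (h.opp_iff hRx hSx).1 ⟨W, Wx, w⟩
    have := h.side_of_miss (fun t => xb t.symm) Sb Qb
    exact (h.side_btw hRx hQx Xx Ra Qa hX'.2.1).2 fun e => sep (e.trans this.symm)
  have := dF.neBot h
  by_cases e : R = Q
  · subst e
    exact (key A (h.onRay_self hA) hA).ne13 rfl
  · obtain ⟨X, hX, hX2, hX3, -⟩ :=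
      ((h.ev_onRay hA).and ((dF.far h Ra Qa e).and ((dF.ev_base h Qa).mono fun _ w => w.2))).exists
    have w := key X hX hX3
    rcases hX2 with w' | w'
    · exact h.btw_swap w w'
    · exact h.btw_unique w'.symm w

/-- If `k` meets the ray, it must separate `R` from `S`, and the ray changes side at `k`. Otherwise
a wrong tail is refuted by a second line `k'`, disjoint from `k`, through a far point of the ray: it
would separate `R` from the point of `k` on `a`, and so put that point on the ray. -/
theorem rays_tail (h : Axioms I) (Ra : I R a) (Aa : I A a) (Sb : I S b) (Bb : I B b) (hA : A ≠ R)
    (hB : B ≠ S) (ab : ¬ Tch I a b) (hits : ∀ k, Hits I k (ray I R A) → Hits I k (ray I S B) ∨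
      Hits I k (segment I R S)) (nka : k ≠ a) (ka : Tch I k a) (kb : ¬ Tch I k b) :
    Tail I (rayEnd I R A) k ↔ side I k S := by
  have dF : Dir I (rayEnd I R A) a := ⟨R, A, hA.symm, Ra, Aa, rfl⟩
  obtain ⟨Y, Yk, Ya⟩ := ka
  have hSk : ¬ I S k := fun hh => kb ⟨S, hh, Sb⟩
  have hits' : ∀ {k}, ¬ I R k → ¬ I S k → ¬ (Hits I k (ray I S B)) → Hits I k (ray I R A) →
      ¬ (side I k R ↔ side I k S) := by
    intro k hR hS n hk
    obtain ⟨W, hW, Wk⟩ := (hits k hk).resolve_left n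
    rcases hW with e | e | w
    · exact (hR (e ▸ Wk)).elim
    · exact (hS (e ▸ Wk)).elim
    · exact (h.opp_iff hR hS).1 ⟨W, Wk, w⟩
  have mem_b : ∀ {W}, W ∈ ray I S B → I W b := by
    intro W hW
    rcases (h.mem_ray hB).1 hW with e | w
    · exact e ▸ Sb
    · exact ((h.onRay_iff Sb Bb hB).1 w).2.1
  by_cases o : OnRay I R A Y
  · have hRk : ¬ I R k := h.off Ya Yk (Ne.symm nka) Ra o.1.symm
    have s1 := hits' hRk hSk (fun ⟨W, hW, Wk⟩ => kb ⟨W, Wk, mem_b hW⟩)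
      ⟨Y, (h.mem_ray hA).2 (Or.inr o), Yk⟩
    have s2 := (dF.hit h Ra hRk nka).1 ⟨Y, Yk, Ya, (h.rayEnd_congr hA o).symm⟩
    tauto
  · by_contra n
    have := dF.neBot h
    obtain ⟨X, oX, Xa, Xk, eX⟩ := ((h.ev_onRay hA).and (dF.tail_ev h nka)).exists
    rw [← eX] at n
    obtain ⟨k', Xk', k'k, -⟩ := h.avoid_ne Xk k
    have kk' : ¬ Tch I k k' := fun t => k'k t.symm
    have nk'a : k' ≠ a := by rintro rfl; exact k'k ⟨Y, Ya, Yk⟩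
    obtain ⟨hSk', e2⟩ := h.nested kk' Xk' Yk hSk fun e => n e.symm
    have hRk' : ¬ I R k' := h.off Xa Xk' nk'a.symm Ra oX.1.symm
    have hYk' : ¬ I Y k' := fun hh => k'k ⟨Y, hh, Yk⟩
    have s1 := hits' hRk' hSk' (fun ⟨W, hW, Wk⟩ => n
      ((h.side_of_miss k'k Xk' Wk).trans (h.side_of_miss (fun t => kb t.symm) (mem_b hW) Sb)))
      ⟨X, (h.mem_ray hA).2 (Or.inr oX), Xk'⟩
    have w := (h.side_btw hRk' hYk' Xk' Ra Ya Xa).2 fun e => s1 (e.trans e2.symm)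
    exact o (h.onRay_trans hA oX (h.onRay_of_btw w))

theorem rays_asy (h : Axioms I) (Ra : I R a) (Aa : I A a) (Sb : I S b) (Bb : I B b) (hA : A ≠ R)
    (hB : B ≠ S) (nab : a ≠ b) (hits : ∀ k, Hits I k (ray I R A) → Hits I k (ray I S B) ∨
      Hits I k (segment I R S)) (hits' : ∀ k, Hits I k (ray I S B) → Hits I k (ray I R A) ∨
      Hits I k (segment I R S)) : Asy I a (rayEnd I R A) b (rayEnd I S B) := by
  have dF : Dir I (rayEnd I R A) a := ⟨R, A, hA.symm, Ra, Aa, rfl⟩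
  have dG : Dir I (rayEnd I S B) b := ⟨S, B, hB.symm, Sb, Bb, rfl⟩
  have ab := rays_disjoint h Ra Aa Sb Bb hA hB nab hits
  obtain ⟨t, Rt, St⟩ := h.exists_line R S
  have nta : t ≠ a := by rintro rfl; exact ab ⟨S, St, Sb⟩
  have ntb : t ≠ b := by rintro rfl; exact ab ⟨R, Ra, Rt⟩
  have et : Tail I (rayEnd I R A) t ↔ Tail I (rayEnd I S B) t := by
    rw [h.tail_rayEnd hA Ra Aa Rt nta, h.tail_rayEnd hB Sb Bb St ntb]
    obtain ⟨x, Ax, xt, -⟩ := h.avoid_ne (h.off Ra Rt nta.symm Aa hA) t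
    rcases hits x ⟨A, Or.inr (Or.inl rfl), Ax⟩ with ⟨W, hW, Wx⟩ | ⟨W, hW, Wx⟩
    · rcases (h.mem_ray hB).1 hW with e | w
      · exact (xt ⟨W, Wx, e ▸ St⟩).elim
      · exact (h.side_of_miss xt Ax Wx).trans (h.side_onRay hB Sb Bb St ntb w).2
    · refine (xt ⟨W, Wx, ?_⟩).elim
      rcases hW with e | e | w
      · exact e ▸ Rt
      · exact e ▸ St
      · exact w.mem2 h Rt St
  refine Asy.mk dF dG ab fun k ka kb tk => ?_
  by_cases t1 : Tch I k a <;> by_cases t2 : Tch I k b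
  · exact dF.compat dG h ab ⟨R, Rt, Ra⟩ ⟨S, St, Sb⟩ t1 t2 et
  · rw [dG.tail_miss h t2 Sb]
    exact rays_tail h Ra Aa Sb Bb hA hB ab hits ka t1 t2
  · rw [dF.tail_miss h t1 Ra]
    refine (rays_tail h Sb Bb Ra Aa hB hA (fun t => ab t.symm) (fun k hk => ?_) kb t2 t1).symm
    refine (hits' k hk).imp_right fun ⟨W, hW, Wk⟩ => ⟨W, ?_, Wk⟩
    rcases hW with e | e | w
    · exact Or.inr (Or.inl e)
    · exact Or.inl e
    · exact Or.inr (Or.inr w.symm)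
  · exact (tk.elim t1 t2).elim

theorem hits_of_asy (h : Axioms I) (Ra : I R a) (Aa : I A a) (Sb : I S b) (Bb : I B b) (hA : A ≠ R)
    (hB : B ≠ S) (s : Asy I a (rayEnd I R A) b (rayEnd I S B)) (hk : Hits I k (ray I R A)) :
    Hits I k (ray I S B) ∨ Hits I k (segment I R S) := by
  by_cases hR : I R k
  · exact Or.inr ⟨R, Or.inl rfl, hR⟩
  by_cases hS : I S k
  · exact Or.inr ⟨S, Or.inr (Or.inl rfl), hS⟩
  by_cases e : side I k R ↔ side I k S
  · left
    have nka : k ≠ a := by rintro rfl; exact hR Ra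
    have nkb : k ≠ b := by rintro rfl; exact hS Sb
    obtain ⟨X, hX, Xk⟩ := hk
    rcases (h.mem_ray hA).1 hX with e' | o
    · exact (hR (e' ▸ Xk)).elim
    have Xa := ((h.onRay_iff Ra Aa hA).1 o).2.1
    have e1 := (s.1.hit h Ra hR nka).1 ⟨X, Xk, Xa, (h.rayEnd_congr hA o).symm⟩
    have e2 := s.tail nka nkb (Or.inl ⟨X, Xk, Xa⟩)
    obtain ⟨Y, Yk, Yb, eY⟩ := (s.2.1.hit h Sb hS nkb).2 (by tauto)
    refine ⟨Y, (h.mem_ray hB).2 (Or.inr ?_), Yk⟩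
    have hYS : Y ≠ S := by rintro rfl; exact hS Yk
    obtain ⟨g, Sg, ngb⟩ := h.exists_line_ne S b
    have e3 : side I g B ↔ side I g Y := by
      rw [← h.tail_rayEnd hB Sb Bb Sg ngb, eY, h.tail_rayEnd hYS Sb Yb Sg ngb]
    exact (h.onRay_iff Sb Bb hB).2 ⟨hYS, Yb, fun w => (h.side_btw (h.off Sb Sg ngb.symm Yb hYS)
      (h.off Sb Sg ngb.symm Bb hB) Sg Yb Bb Sb).1 w e3.symm⟩
  · exact Or.inr ((h.opp_iff hR hS).2 e |>.imp fun W ⟨h1, h2⟩ => ⟨Or.inr (Or.inr h2), h1⟩)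

end Rays

theorem raysParallel_asy (h : Axioms I) {r s : Set P} (rs : RaysParallel I r s) (ha : Contains I a r)
    (hb : Contains I b s) : a ≠ b ∧ ∃ R A S B, A ≠ R ∧ B ≠ S ∧ r = ray I R A ∧ s = ray I S B ∧
      Asy I a (rayEnd I R A) b (rayEnd I S B) := by
  obtain ⟨R, S, ⟨A, hA, rfl⟩, ⟨B, hB, rfl⟩, nc, hits⟩ := rs
  have nab : a ≠ b := by
    rintro rfl
    exact nc ⟨a, fun X hX => hX.elim (ha X) (hb X)⟩
  exact ⟨nab, R, A, S, B, hA, hB, rfl, rfl, rays_asy h (ha R (Or.inl rfl)) (ha A (Or.inr (Or.inl rfl)))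
    (hb S (Or.inl rfl)) (hb B (Or.inr (Or.inl rfl))) hA hB nab (fun k => (hits k).1)
    fun k => (hits k).2⟩

theorem Axioms.contains_ray (h : Axioms I) {R A : P} (Ra : I R a) (Aa : I A a) (hA : A ≠ R) :
    Contains I a (ray I R A) := fun X hX => by
  rcases (h.mem_ray hA).1 hX with e | o
  · exact e ▸ Ra
  · exact ((h.onRay_iff Ra Aa hA).1 o).2.1

theorem parallel_iff (h : Axioms I) : Parallel I a b ↔ a ≠ b ∧ ∃ F G, Asy I a F b G := by
  constructor
  · rintro ⟨r, s, ha, hb, rs⟩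
    obtain ⟨n, R, A, S, B, -, -, -, -, s⟩ := raysParallel_asy h rs ha hb
    exact ⟨n, _, _, s⟩
  · rintro ⟨n, F, G, s⟩
    obtain ⟨R, A, hA, Ra, Aa, rfl⟩ := s.1
    obtain ⟨S, B, hB, Sb, Bb, rfl⟩ := s.2.1
    refine ⟨ray I R A, ray I S B, h.contains_ray Ra Aa hA.symm, h.contains_ray Sb Bb hB.symm, R, S,
      ⟨A, hA.symm, rfl⟩, ⟨B, hB.symm, rfl⟩, ?_, fun k => ⟨hits_of_asy h Ra Aa Sb Bb hA.symm hB.symm s,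
        fun hk => ?_⟩⟩
    · rintro ⟨m, hm⟩
      have h1 := h.eq_line hA (hm R (Or.inl (Or.inl rfl))) (hm A (Or.inl (Or.inr (Or.inl rfl)))) Ra Aa
      have h2 := h.eq_line hB (hm S (Or.inr (Or.inl rfl))) (hm B (Or.inr (Or.inr (Or.inl rfl)))) Sb Bb
      exact n (h1.symm.trans h2)
    · refine (hits_of_asy h Sb Bb Ra Aa hB.symm hA.symm s.symm hk).imp_right fun ⟨W, hW, Wk⟩ => ⟨W, ?_, Wk⟩
      rcases hW with e | e | w
      · exact Or.inr (Or.inl e)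
      · exact Or.inl e
      · exact Or.inr (Or.inr w.symm)

theorem rayLineParallel_asy (h : Axioms I) {R A : P} (Ra : I R a) (Aa : I A a) (hA : A ≠ R)
    (p : RayLineParallel I (ray I R A) m) : a ≠ m ∧ ∃ G, Asy I a (rayEnd I R A) m G := by
  obtain ⟨r', s, hr, hm, rs⟩ := p
  obtain ⟨n, R', A', S, B, hA', hB, rfl, rfl, as⟩ := raysParallel_asy h rs
    (fun X hX => h.contains_ray Ra Aa hA X (hr hX)) hm
  refine ⟨n, rayEnd I S B, ?_⟩
  have e : rayEnd I R' A' = rayEnd I R A := by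
    have := as.1.neBot h
    obtain ⟨Y, o, h1, h2, e⟩ := ((h.ev_onRay hA').and (as.1.ev_base h Ra)).exists
    rw [e]
    have := hr ((h.mem_ray hA').2 (Or.inr o))
    exact h.rayEnd_congr hA (((h.mem_ray hA).1 this).resolve_left h2)
  rwa [e] at as

end HypInc

/-! ### Rimpoints, their joins, and the sides on which they lie. -/

namespace HypInc

universe u v

variable {P : Type u} {L : Type v} {I : P → L → Prop}

open Filter

variable {F G H : Filter P} {a b c k l m n : L}

/-- An asymptote `p` through a point of `k` and different from `k` would have its tail on the side
of `B` as well as on the side of `C`. -/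
theorem Asy.middle (h : Axioms I) (s : Asy I b F c G) (kb : ¬ Tch I k b) (kc : ¬ Tch I k c) {B C : P}
    (Bb : I B b) (Cc : I C c) (sep : ¬ (side I k B ↔ side I k C)) : ∃ K, Asy I k K b F := by
  obtain ⟨A, hA⟩ := h.A2 k
  obtain ⟨p, K, Ap, s'⟩ := asy_exists h s.1 A
  by_cases e : p = k
  · subst e; exact ⟨K, s'⟩
  refine (sep ?_).elim
  have t : Tch I k p := ⟨A, hA, Ap⟩
  have kb' : k ≠ b := by rintro rfl; exact kb (h.tch_self k)
  have kc' : k ≠ c := by rintro rfl; exact kc (h.tch_self k)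
  have e1 := s'.tail (Ne.symm e) kb' (Or.inl t)
  have e2 := (s'.trans h s).tail (Ne.symm e) kc' (Or.inl t)
  rw [s.1.tail_miss h kb Bb] at e1
  rw [s.2.1.tail_miss h kc Cc] at e2
  exact e1.symm.trans e2

/-- A line through a point of `m` that misses `k` has all of `k` on one side. Both directions of `m`
would therefore have the same tail with respect to it, hence be equal. -/
theorem Asy.join_unique (h : Axioms I) {F' G' : Filter P} (s : Asy I m G k F) (s' : Asy I m G' k F')
    (n : F ≠ F') : m = k := by
  by_contra nmk
  have mk := s.miss h nmk
  obtain ⟨A, hA⟩ := h.A2 m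
  obtain ⟨k', Ak', k'k, nk'm⟩ := h.avoid_ne (ntch mk hA) m
  obtain ⟨B, hB⟩ := h.A2 k
  have nk'k : k' ≠ k := by rintro rfl; exact k'k (h.tch_self k')
  have t : Tch I k' m := ⟨A, Ak', hA⟩
  have e1 := s.tail nk'm nk'k (Or.inl t)
  have e2 := s'.tail nk'm nk'k (Or.inl t)
  rw [s.2.1.tail_miss h k'k hB] at e1
  rw [s'.2.1.tail_miss h k'k hB] at e2
  have e3 : G = G' := s.1.ext s'.1 h nk'm t (e1.trans e2.symm)
  subst e3
  exact n ((s.symm.trans h s').eq h)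

/-- The lines asymptotic to the direction `F` of `a`. -/
def cls (I : P → L → Prop) (a : L) (F : Filter P) : Set L := {b | ∃ G, Asy I a F b G}

theorem Asy.cls_eq (h : Axioms I) (s : Asy I a F b G) : cls I a F = cls I b G := by
  ext c
  exact ⟨fun ⟨K, t⟩ => ⟨K, s.symm.trans h t⟩, fun ⟨K, t⟩ => ⟨K, s.trans h t⟩⟩

theorem asy_of_cls_eq (h : Axioms I) (dF : Dir I F a) (e : cls I a F = cls I b G) :
    Asy I a F b G := by
  have ha : a ∈ cls I a F := ⟨F, Asy.refl dF⟩
  rw [e] at ha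
  obtain ⟨F', s⟩ := ha
  obtain ⟨A, hA⟩ := h.exists_notMem a
  obtain ⟨m, M, Am, s'⟩ := asy_exists h dF A
  have hm : m ∈ cls I a F := ⟨M, s'.symm⟩
  rw [e] at hm
  obtain ⟨M', s''⟩ := hm
  by_contra n
  have nF : F ≠ F' := by rintro rfl; exact n s.symm
  have := Asy.join_unique h s' (s''.symm.trans h s) nF
  subst this
  exact hA Am

/-- Points are chosen on the three lines. If none of the three joining lines met the remaining line,
the tails of the common direction would violate `trio` at `A`. -/
theorem exists_transversal (h : Axioms I) (s : Asy I a F b G) (s' : Asy I a F m H) (nab : a ≠ b)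
    (nam : a ≠ m) (nbm : b ≠ m) : ∃ t, Meets I t a ∧ Meets I t b ∧ Meets I t m := by
  have ab := s.miss h nab
  have am := s'.miss h nam
  have s'' := s.symm.trans h s'
  have bm := s''.miss h nbm
  obtain ⟨A, Aa⟩ := h.A2 a
  obtain ⟨B, Bb⟩ := h.A2 b
  obtain ⟨M, Mm⟩ := h.A2 m
  obtain ⟨x, Ax, Bx⟩ := h.exists_line A B
  obtain ⟨y, Ay, My⟩ := h.exists_line A M
  obtain ⟨z, Bz, Mz⟩ := h.exists_line B M
  have ne : ∀ {t u v : L} {X : P}, ¬ Tch I u v → I X t → I X v → t ≠ u := by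
    rintro t u v X n h1 h2 rfl; exact n ⟨X, h1, h2⟩
  by_cases xm : Tch I x m
  · exact ⟨x, ⟨ne ab Bx Bb, A, Ax, Aa⟩, ⟨ne (fun t => ab t.symm) Ax Aa, B, Bx, Bb⟩,
      ⟨ne (fun t => am t.symm) Ax Aa, xm⟩⟩
  by_cases yb : Tch I y b
  · exact ⟨y, ⟨ne am My Mm, A, Ay, Aa⟩, ⟨ne (fun t => ab t.symm) Ay Aa, yb⟩,
      ⟨ne (fun t => am t.symm) Ay Aa, M, My, Mm⟩⟩
  by_cases za : Tch I z a
  · exact ⟨z, ⟨ne ab Bz Bb, za⟩, ⟨ne bm Mz Mm, B, Bz, Bb⟩, ⟨ne (fun t => bm t.symm) Bz Bb, M, Mz, Mm⟩⟩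
  exfalso
  have nxa : x ≠ a := ne ab Bx Bb
  have nya : y ≠ a := ne am My Mm
  have nxm : x ≠ m := ne (fun t => am t.symm) Ax Aa
  have nyb : y ≠ b := ne (fun t => ab t.symm) Ay Aa
  have nym : y ≠ m := ne (fun t => am t.symm) Ay Aa
  have nxb : x ≠ b := ne (fun t => ab t.symm) Ax Aa
  have nxy : x ≠ y := by rintro rfl; exact xm ⟨M, My, Mm⟩
  have hBA : B ≠ A := by rintro rfl; exact ab ⟨B, Aa, Bb⟩
  have hMA : M ≠ A := by rintro rfl; exact am ⟨M, Aa, Mm⟩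
  have e1 := s'.tail nxa nxm (Or.inl ⟨A, Ax, Aa⟩)
  have e2 := s.tail nya nyb (Or.inl ⟨A, Ay, Aa⟩)
  rw [s'.2.1.tail_miss h xm Mm] at e1
  rw [s.2.1.tail_miss h yb Bb] at e2
  obtain ⟨Y, Ya, hY, -, eY⟩ := s.1.pt h Aa
  have T := h.trio Ax Ay Aa Bx My Ya hBA hMA hY nxy nxa nya
  have e3 := h.side_of_miss za Bz Mz
  rw [eY _ Ax nxa] at e1
  rw [eY _ Ay nya] at e2
  clear eY ne
  grind

theorem pencil_eq_cls (h : Axioms I) (s : Asy I a F b G) (nab : a ≠ b) : pencil I a b = cls I a F := by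
  ext m
  constructor
  · rintro (rfl | rfl | ⟨p1, p2, t, ⟨ta, A, At, Aa⟩, ⟨tb, B, Bt, Bb⟩, ⟨tm, M, Mt, Mm⟩⟩)
    · exact ⟨F, Asy.refl s.1⟩
    · exact ⟨G, s⟩
    · obtain ⟨nma, M1, F', s1⟩ := (parallel_iff h).1 p1
      obtain ⟨nmb, M2, G', s2⟩ := (parallel_iff h).1 p2
      by_cases e1 : F' = F
      · subst e1; exact ⟨M1, s1.symm⟩
      by_cases e2 : G' = G
      · subst e2; exact ⟨M2, s.trans h s2.symm⟩
      by_cases e3 : M1 = M2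
      · subst e3
        exact (nab (Asy.join_unique h s (s1.symm.trans h s2) (Ne.symm e2))).elim
      -- Here the three lines would form an ideal triangle with distinct corners. A transversal of
      -- all its sides changes the tail three times on the way around, which is impossible; this is
      -- why `pencil` asks for a line meeting all three.
      have f1 := s1.1.tail_opp s2.1 h e3 tm ⟨M, Mt, Mm⟩
      have f2 := s.1.tail_opp s1.2.1 h (Ne.symm e1) ta ⟨A, At, Aa⟩
      have f3 := s.2.1.tail_opp s2.2.1 h (Ne.symm e2) tb ⟨B, Bt, Bb⟩
      have g1 := s.tail ta tb (Or.inl ⟨A, At, Aa⟩)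
      have g2 := s1.tail tm ta (Or.inl ⟨M, Mt, Mm⟩)
      have g3 := s2.tail tm tb (Or.inl ⟨M, Mt, Mm⟩)
      exfalso
      tauto
  · rintro ⟨H, s'⟩
    by_cases e1 : m = a
    · exact Or.inl e1
    by_cases e2 : m = b
    · exact Or.inr (Or.inl e2)
    exact Or.inr (Or.inr ⟨(parallel_iff h).2 ⟨e1, _, _, s'.symm⟩,
      (parallel_iff h).2 ⟨e2, _, _, s'.symm.trans h s⟩,
      exists_transversal h s s' nab (Ne.symm e1) (Ne.symm e2)⟩)

/-- Every direction is represented by a rimpoint: asymptotes through two further points of one line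
supply the second line and the third line that `IsRimPair` requires. -/
theorem exists_rimPair (h : Axioms I) (dF : Dir I F a) :
    ∃ b, IsRimPair I a b ∧ cls I a F = pencil I a b := by
  obtain ⟨B, hB⟩ := h.exists_notMem a
  obtain ⟨b, G, Bb, s⟩ := asy_exists h dF B
  have nab : a ≠ b := by rintro rfl; exact hB Bb
  obtain ⟨A, Aa⟩ := h.A2 a
  obtain ⟨x, Ax, Bx⟩ := h.exists_line A B
  obtain ⟨M, Mx, hMA, hMB⟩ := h.three_points x A B
  obtain ⟨m, H, Mm, s'⟩ := asy_exists h dF M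
  have hxa : x ≠ a := by rintro rfl; exact hB Bx
  have hxb : x ≠ b := by rintro rfl; exact s.miss h nab.symm ⟨A, Ax, Aa⟩
  have nam : m ≠ a := by rintro rfl; exact hMA (h.eq_pt hxa Mx Mm Ax Aa)
  have nbm : m ≠ b := by rintro rfl; exact hMB (h.eq_pt hxb Mx Mm Bx Bb)
  exact ⟨b, ⟨(parallel_iff h).2 ⟨nab, _, _, s.symm⟩, m, (parallel_iff h).2 ⟨nam, _, _, s'⟩,
      (parallel_iff h).2 ⟨nbm, _, _, s'.trans h s.symm⟩,
      exists_transversal h s.symm s'.symm nab nam.symm nbm.symm⟩, (pencil_eq_cls h s.symm nab).symm⟩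

/-- `F` is the direction of `m` that leads to the rimpoint `X`. -/
def EndOf (I : P → L → Prop) (X : Rim I) (m : L) (F : Filter P) : Prop := Dir I F m ∧ X.1 = cls I m F

theorem exists_endOf (h : Axioms I) (dF : Dir I F a) : ∃ X : Rim I, EndOf I X a F := by
  obtain ⟨b, h1, h2⟩ := exists_rimPair h dF
  exact ⟨⟨cls I a F, a, b, h1, h2⟩, dF, rfl⟩

theorem Rim.exists_line (h : Axioms I) (X : Rim I) : ∃ a F, EndOf I X a F := by
  obtain ⟨s, a, b, h1, rfl⟩ := X
  obtain ⟨n, F, G, s⟩ := (parallel_iff h).1 h1.1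
  exact ⟨a, F, s.1, pencil_eq_cls h s n⟩

variable {X Y Z W : Rim I}

theorem rimInc_iff (h : Axioms I) : RimInc I X m ↔ ∃ F, EndOf I X m F := by
  constructor
  · intro i
    obtain ⟨a, F, dF, e⟩ := X.exists_line h
    unfold RimInc at i
    rw [e] at i
    obtain ⟨G, s⟩ := i
    exact ⟨G, s.2.1, e.trans (s.cls_eq h)⟩
  · rintro ⟨F, dF, e⟩
    unfold RimInc
    rw [e]
    exact ⟨F, Asy.refl dF⟩

theorem EndOf.inc (h : Axioms I) (e : EndOf I X m F) : RimInc I X m := (rimInc_iff h).2 ⟨F, e⟩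

theorem EndOf.asy (h : Axioms I) (e : EndOf I X m F) (e' : EndOf I X n G) : Asy I m F n G :=
  asy_of_cls_eq h e.1 (e.2.symm.trans e'.2)

theorem EndOf.eq_iff (h : Axioms I) (e : EndOf I X m F) (e' : EndOf I Y m G) : X = Y ↔ F = G := by
  constructor
  · rintro rfl; exact (e.asy h e').eq h
  · rintro rfl; exact Subtype.ext (e.2.trans e'.2.symm)

theorem EndOf.of_asy (h : Axioms I) (e : EndOf I X m F) (s : Asy I m F n G) : EndOf I X n G :=
  ⟨s.2.1, e.2.trans (s.cls_eq h)⟩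

theorem Rim.other (h : Axioms I) (i : RimInc I X m) : ∃ Y, Y ≠ X ∧ RimInc I Y m ∧
    ∀ Z, RimInc I Z m → Z = X ∨ Z = Y := by
  obtain ⟨F, e⟩ := (rimInc_iff h).1 i
  obtain ⟨G, dG, n⟩ := e.1.exists_opp h
  obtain ⟨Y, e'⟩ := exists_endOf h dG
  refine ⟨Y, fun q => n ((e'.eq_iff h e).1 q), e'.inc h, fun Z iZ => ?_⟩
  obtain ⟨H, e''⟩ := (rimInc_iff h).1 iZ
  rw [e''.eq_iff h e, e''.eq_iff h e']
  exact e.1.eq_or e'.1 e''.1 h n.symm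

theorem Rim.exists_end (h : Axioms I) (m : L) : ∃ X, RimInc I X m := by
  obtain ⟨F, dF⟩ := Dir.exists_dir h m
  exact (exists_endOf h dF).imp fun _ e => e.inc h

theorem Rim.exists_ends (h : Axioms I) (m : L) : ∃ X Y, Join I X Y m := by
  obtain ⟨X, hX⟩ := Rim.exists_end h m
  obtain ⟨Y, h1, h2, -⟩ := Rim.other h hX
  exact ⟨X, Y, h1.symm, hX, h2⟩

theorem Rim.eq_or (h : Axioms I) (j : Join I X Y m) (i : RimInc I Z m) : Z = X ∨ Z = Y := by
  obtain ⟨n, hX, hY⟩ := j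
  obtain ⟨W, h1, h2, h3⟩ := Rim.other h hX
  rcases h3 Y hY with e | e
  · exact (n e.symm).elim
  · subst e; exact h3 Z i

theorem Rim.line_through (h : Axioms I) (A : P) (X : Rim I) : ∃ m, I A m ∧ RimInc I X m := by
  obtain ⟨a, F, e⟩ := X.exists_line h
  obtain ⟨m, G, hA, s⟩ := asy_exists h e.1 A
  exact ⟨m, hA, (e.of_asy h s.symm).inc h⟩

theorem Rim.line_unique (h : Axioms I) {A : P} (hA : I A m) (iX : RimInc I X m) (hA' : I A n)
    (iX' : RimInc I X n) : m = n := by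
  obtain ⟨F, e⟩ := (rimInc_iff h).1 iX
  obtain ⟨G, e'⟩ := (rimInc_iff h).1 iX'
  obtain ⟨H, e''⟩ := (rimInc_iff h).1 iX
  exact Asy.unique h (e.asy h e') (Asy.refl e'.1) hA hA'

theorem Rim.join_unique (h : Axioms I) (j : Join I X Y m) (j' : Join I X Y n) : m = n := by
  obtain ⟨F, eX⟩ := (rimInc_iff h).1 j.2.1
  obtain ⟨G, eY⟩ := (rimInc_iff h).1 j.2.2
  obtain ⟨F', eX'⟩ := (rimInc_iff h).1 j'.2.1
  obtain ⟨G', eY'⟩ := (rimInc_iff h).1 j'.2.2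
  exact Asy.join_unique h (eX.asy h eX') (eY.asy h eY') (mt (eX'.eq_iff h eY').2 j.1)

theorem Join.symm (j : Join I X Y m) : Join I Y X m := ⟨j.1.symm, j.2.2, j.2.1⟩

/-- This is (A6) for the two rays from a common point `O`. The common parallel contains neither ray:
being the line of one, it would meet the line of the other at `O`. -/
theorem Rim.exists_join (h : Axioms I) (n : X ≠ Y) : ∃ m, Join I X Y m := by
  obtain ⟨O, -⟩ := h.A3.1
  obtain ⟨a, Oa, iX⟩ := Rim.line_through h O X
  obtain ⟨b, Ob, iY⟩ := Rim.line_through h O Y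
  by_cases nab : a = b
  · subst nab; exact ⟨a, n, iX, iY⟩
  obtain ⟨F, eX⟩ := (rimInc_iff h).1 iX
  obtain ⟨G, eY⟩ := (rimInc_iff h).1 iY
  obtain ⟨A, Aa, hA, eF⟩ := eX.1.base h Oa
  obtain ⟨B, Bb, hB, eG⟩ := eY.1.base h Ob
  have nc : ¬ Collin I (ray I O A ∪ ray I O B) := by
    rintro ⟨m, hm⟩
    have hOm := hm O (Or.inl (Or.inl rfl))
    have h1 := h.eq_line hA (hm A (Or.inl (Or.inr (Or.inl rfl)))) hOm Aa Oa
    have h2 := h.eq_line hB (hm B (Or.inr (Or.inr (Or.inl rfl)))) hOm Bb Ob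
    exact nab (h1.symm.trans h2)
  obtain ⟨m, q1, q2⟩ := h.A6 _ _ O O ⟨A, hA, rfl⟩ ⟨B, hB, rfl⟩ nc
  have key : ∀ {a b : L} {A B : P}, a ≠ b → I O a → I O b → I A a → I B b → A ≠ O → B ≠ O →
      (Contains I m (ray I O A) ∨ RayLineParallel I (ray I O A) m) →
      (Contains I m (ray I O B) ∨ RayLineParallel I (ray I O B) m) →
      RayLineParallel I (ray I O A) m := by
    intro a b A B nab Oa Ob Aa Bb hA hB q1 q2
    refine q1.resolve_left fun c1 => ?_
    have e1 := h.eq_line hA (c1 A (Or.inr (Or.inl rfl))) (c1 O (Or.inl rfl)) Aa Oa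
    subst e1
    rcases q2 with c2 | c2
    · exact nab (h.eq_line hB (c2 B (Or.inr (Or.inl rfl))) (c2 O (Or.inl rfl)) Bb Ob)
    · obtain ⟨n1, G, s⟩ := rayLineParallel_asy h Ob Bb hB c2
      exact s.miss h n1 ⟨O, Ob, Oa⟩
  obtain ⟨-, M, s⟩ := rayLineParallel_asy h Oa Aa hA (key nab Oa Ob Aa Bb hA hB q1 q2)
  obtain ⟨-, M', s'⟩ := rayLineParallel_asy h Ob Bb hB (key (Ne.symm nab) Ob Oa Bb Aa hB hA q2 q1)
  rw [← eF] at s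
  rw [← eG] at s'
  exact ⟨m, n, (eX.of_asy h s).inc h, (eY.of_asy h s').inc h⟩

theorem Rim.miss (h : Axioms I) (n : a ≠ b) (i : RimInc I X a) (i' : RimInc I X b) : ¬ Tch I a b :=
  fun ⟨_, h1, h2⟩ => n (Rim.line_unique h h1 i h2 i')

theorem parallel_iff_rim (h : Axioms I) : Parallel I a b ↔ a ≠ b ∧ ∃ X, RimInc I X a ∧ RimInc I X b := by
  rw [parallel_iff h]
  refine and_congr_right fun _ => ⟨?_, ?_⟩
  · rintro ⟨F, G, s⟩
    obtain ⟨X, e⟩ := exists_endOf h s.1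
    exact ⟨X, e.inc h, (e.of_asy h s).inc h⟩
  · rintro ⟨X, i, i'⟩
    obtain ⟨F, e⟩ := (rimInc_iff h).1 i
    obtain ⟨G, e'⟩ := (rimInc_iff h).1 i'
    exact ⟨F, G, e.asy h e'⟩

/-- The side of `k` on which the rimpoint `X` lies. -/
def rside (I : P → L → Prop) (k : L) (X : Rim I) : Prop := ∃ m F, EndOf I X m F ∧ Tail I F k

/-- The side of a rimpoint does not depend on the line leading to it. If `k` misses two such lines
and separates them, then by `Asy.middle` it passes through the rimpoint as well. -/
theorem rside_iff (h : Axioms I) (e : EndOf I X m F) (n : ¬ RimInc I X k) :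
    rside I k X ↔ Tail I F k := by
  have key : ∀ {a b F G}, EndOf I X a F → EndOf I X b G → Tail I F k → Tail I G k := by
    intro a b F G e e' t
    have ka : k ≠ a := by rintro rfl; exact n (e.inc h)
    have kb : k ≠ b := by rintro rfl; exact n (e'.inc h)
    have s := e.asy h e'
    by_cases q : Tch I k a ∨ Tch I k b
    · exact (s.tail ka kb q).1 t
    · push Not at q
      obtain ⟨A, hA⟩ := h.A2 a
      obtain ⟨B, hB⟩ := h.A2 b
      rw [e.1.tail_miss h q.1 hA] at t
      rw [e'.1.tail_miss h q.2 hB]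
      by_contra c
      obtain ⟨K, sK⟩ := s.middle h q.1 q.2 hA hB (fun i => c (i.1 t))
      exact n ((e.of_asy h sK.symm).inc h)
  exact ⟨fun ⟨a, G, e', t⟩ => key e' e t, fun t => ⟨m, F, e, t⟩⟩

/-- A line through a point and a rimpoint that misses `k`. -/
theorem rside_of_miss (h : Axioms I) (mk : ¬ Tch I m k) (i : RimInc I X m) (n : ¬ RimInc I X k) {A : P}
    (hA : I A m) : rside I k X ↔ side I k A := by
  obtain ⟨F, e⟩ := (rimInc_iff h).1 i
  rw [rside_iff h e n, e.1.tail_miss h (fun t => mk t.symm) hA]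

theorem rside_join (h : Axioms I) (j : Join I X Y m) (nX : ¬ RimInc I X k) (nY : ¬ RimInc I Y k) :
    Tch I m k ↔ ¬ (rside I k X ↔ rside I k Y) := by
  obtain ⟨F, eX⟩ := (rimInc_iff h).1 j.2.1
  obtain ⟨G, eY⟩ := (rimInc_iff h).1 j.2.2
  have hk : k ≠ m := by rintro rfl; exact nX j.2.1
  have hFG := mt (eX.eq_iff h eY).2 j.1
  rw [rside_iff h eX nX, rside_iff h eY nY]
  constructor
  · intro t
    have := eX.1.tail_opp eY.1 h hFG hk t.symm
    tauto
  · intro q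
    by_contra t
    obtain ⟨A, hA⟩ := h.A2 m
    rw [eX.1.tail_miss h (fun t' => t t'.symm) hA, eY.1.tail_miss h (fun t' => t t'.symm) hA] at q
    exact q Iff.rfl

theorem rim_trio (h : Axioms I) {A : P} {x y z : L} (Ax : I A x) (Ay : I A y) (Az : I A z)
    (iX : RimInc I X x) (iY : RimInc I Y y) (iZ : RimInc I Z z) (nxy : x ≠ y) (nxz : x ≠ z)
    (nyz : y ≠ z) : (rside I x Y ↔ rside I x Z) ↔ ((rside I y X ↔ rside I y Z) ↔
      ¬ (rside I z X ↔ rside I z Y)) := by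
  have off : ∀ {U : Rim I} {u v : L}, I A u → I A v → u ≠ v → RimInc I U u → ¬ RimInc I U v :=
    fun hu hv n i i' => n (Rim.line_unique h hu i hv i')
  obtain ⟨F, eX⟩ := (rimInc_iff h).1 iX
  obtain ⟨G, eY⟩ := (rimInc_iff h).1 iY
  obtain ⟨H, eZ⟩ := (rimInc_iff h).1 iZ
  obtain ⟨U, Ux, hU, -, eU⟩ := eX.1.pt h Ax
  obtain ⟨V, Vy, hV, -, eV⟩ := eY.1.pt h Ay
  obtain ⟨T, Tz, hT, -, eT⟩ := eZ.1.pt h Az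
  have := h.trio Ax Ay Az Ux Vy Tz hU hV hT nxy nxz nyz
  rwa [rside_iff h eX (off Ax Ay nxy iX), rside_iff h eX (off Ax Az nxz iX),
    rside_iff h eY (off Ay Ax nxy.symm iY), rside_iff h eY (off Ay Az nyz iY),
    rside_iff h eZ (off Az Ax nxz.symm iZ), rside_iff h eZ (off Az Ay nyz.symm iZ),
    eU y Ay nxy.symm, eU z Az nxz.symm, eV x Ax nxy, eV z Az nyz.symm, eT x Ax nxz, eT y Ay nyz]

/-- `V` on `m` lies towards the rimpoint `X` from `A` if both are on the same side of another line
through `A`. -/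
theorem rside_hit (h : Axioms I) {A V : P} {m k g : L} (Am : I A m) (Vm : I V m) (Ak : I A k)
    (Vg : I V g) (Ag : ¬ I A g) (nmk : k ≠ m) (nXg : ¬ RimInc I X g) (nXk : ¬ RimInc I X k)
    (iX : RimInc I X m) (e : side I k V ↔ rside I k X) : ¬ (rside I g X ↔ side I g A) := by
  obtain ⟨F, eX⟩ := (rimInc_iff h).1 iX
  have hVA : V ≠ A := by rintro rfl; exact Ag Vg
  have ngm : g ≠ m := by rintro rfl; exact Ag Am
  rw [rside_iff h eX nXg]
  refine (eX.1.hit h Am Ag ngm).1 ⟨V, Vg, Vm, ?_⟩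
  refine eX.1.ext ⟨A, V, hVA.symm, Am, Vm, rfl⟩ h nmk ⟨A, Ak, Am⟩ ?_
  rw [← rside_iff h eX nXk, ← e, h.tail_rayEnd hVA Am Vm Ak nmk]

end HypInc

/-! ### Crossing of chords is a separation relation. -/

namespace HypInc

universe u v

/-- The axioms of a separation relation. -/
structure SepRel {O : Type u} (D : O → O → O → O → Prop) : Prop where
  flip : ∀ a b c d, D a b c d → D b a c d
  swap : ∀ a b c d, D a b c d → D c d a b
  ne : ∀ a b c d, D a b c d → a ≠ b ∧ a ≠ c
  some : ∀ a b c d, a ≠ b → a ≠ c → a ≠ d → b ≠ c → b ≠ d → c ≠ d →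
    D a b c d ∨ D a c b d ∨ D a d b c
  one : ∀ a b c d, D a b c d → ¬ D a c b d
  even : ∀ a b c d e, D a b c d → D a b d e → ¬ D a b c e
  trans : ∀ a b c d e, d ≠ a → d ≠ b → ¬ D a b c d → ¬ D a b d e → ¬ D a b c e

variable {P : Type u} {L : Type v} {I : P → L → Prop} {X Y Z W : Rim I} {a b m k : L}

theorem Sep.flip (s : Sep I W X Y Z) : Sep I X W Y Z := by
  obtain ⟨a, b, j, j', M⟩ := s
  exact ⟨a, b, j.symm, j', M⟩

theorem Sep.swap (s : Sep I W X Y Z) : Sep I Y Z W X := by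
  obtain ⟨a, b, j, j', M, T, Ta, Tb⟩ := s
  exact ⟨b, a, j', j, M.symm, T, Tb, Ta⟩

theorem Sep.ne (h : Axioms I) (s : Sep I W X Y Z) : W ≠ X ∧ W ≠ Y := by
  obtain ⟨a, b, j, j', M, T⟩ := s
  refine ⟨j.1, ?_⟩
  rintro rfl
  exact Rim.miss h M j.2.1 j'.2.1 T

theorem sep_iff (h : Axioms I) (j : Join I W X m) (nY : ¬ RimInc I Y m) (nZ : ¬ RimInc I Z m) :
    Sep I W X Y Z ↔ ¬ (rside I m Y ↔ rside I m Z) := by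
  by_cases e : Y = Z
  · subst e
    exact iff_of_false (fun s => (s.swap.ne h).1 rfl) (fun q => q Iff.rfl)
  obtain ⟨b, jb⟩ := Rim.exists_join h e
  rw [← rside_join h jb nY nZ]
  constructor
  · rintro ⟨a', b', j', jb', M, T, Ta, Tb⟩
    rw [Rim.join_unique h j j', Rim.join_unique h jb jb']
    exact ⟨T, Tb, Ta⟩
  · rintro ⟨T, Tb, Tm⟩
    exact ⟨m, b, j, jb, fun e => nY (e ▸ jb.2.1), T, Tm, Tb⟩

/-- Let `T` be the common point of `WX` and `YZ`. Each of these lines shares an end with `WY` and so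
misses it, hence `X`, `T` and `Z` are on one side of `WY`. -/
theorem Sep.not_sep (h : Axioms I) (s : Sep I W X Y Z) : ¬ Sep I W Y X Z := by
  intro s'
  obtain ⟨nWX, nWY⟩ := s.ne h
  obtain ⟨nXW, nXY⟩ := s.flip.ne h
  obtain ⟨nYZ, -⟩ := s.swap.ne h
  obtain ⟨-, nZW⟩ := s.swap.flip.ne h
  obtain ⟨nXZ, -⟩ := s'.swap.ne h
  obtain ⟨k, jk⟩ := Rim.exists_join h nWY
  have hX : ¬ RimInc I X k := fun i => (Rim.eq_or h jk i).elim nXW nXY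
  have hZ : ¬ RimInc I Z k := fun i => (Rim.eq_or h jk i).elim nZW nYZ.symm
  rw [sep_iff h jk hX hZ] at s'
  obtain ⟨a, b, ja, jb, M, T, Ta, Tb⟩ := s
  have nak : a ≠ k := by rintro rfl; exact hX ja.2.2
  have nbk : b ≠ k := by rintro rfl; exact hZ jb.2.2
  rw [rside_of_miss h (Rim.miss h nak ja.2.1 jk.2.1) ja.2.2 hX Ta,
    rside_of_miss h (Rim.miss h nbk jb.2.1 jk.2.2) jb.2.2 hZ Tb] at s'
  exact s' Iff.rfl

/-- The line `WZ` crosses `y` at a point `V` between `A` and the end `Y`, so it separates `Y` from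
`A`; and `X` is on the side of `A`, because `m` shares the end `W` with `WZ`. -/
theorem sep_some_aux (h : Axioms I) {A : P} {y z : L} (j : Join I W X m) (Am : I A m) (nWY : W ≠ Y)
    (nWZ : W ≠ Z) (nXY : X ≠ Y) (nXZ : X ≠ Z) (nYZ : Y ≠ Z)
    (sYZ : rside I m Y ↔ rside I m Z) (Ay : I A y) (iY : RimInc I Y y) (Az : I A z)
    (iZ : RimInc I Z z) (nzm : z ≠ m) (nym : y ≠ m) (nyz : y ≠ z)
    (e : rside I y X ↔ rside I y Z) : Sep I W Z X Y := by
  have hY : ¬ RimInc I Y m := fun i => (Rim.eq_or h j i).elim nWY.symm nXY.symm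
  have hZ : ¬ RimInc I Z m := fun i => (Rim.eq_or h j i).elim nWZ.symm nXZ.symm
  have hWy : ¬ RimInc I W y := fun i => nym (Rim.line_unique h Ay i Am j.2.1)
  have hXy : ¬ RimInc I X y := fun i => nym (Rim.line_unique h Ay i Am j.2.2)
  have hZy : ¬ RimInc I Z y := fun i => nyz (Rim.line_unique h Ay i Az iZ)
  have hWX := (rside_join h j hWy hXy).1 ⟨A, Am, Ay⟩
  obtain ⟨g, jg⟩ := Rim.exists_join h nWZ
  have hXg : ¬ RimInc I X g := fun i => (Rim.eq_or h jg i).elim j.1.symm nXZ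
  have hYg : ¬ RimInc I Y g := fun i => (Rim.eq_or h jg i).elim nWY.symm nYZ
  obtain ⟨V, Vg, Vy⟩ := (rside_join h jg hWy hZy).2 (by grind)
  have ngm : g ≠ m := by rintro rfl; exact hXg j.2.2
  have hgm := Rim.miss h ngm jg.2.1 j.2.1
  have hVm : side I m V ↔ rside I m Y := by
    rw [sYZ, rside_of_miss h hgm jg.2.2 hZ Vg]
  have hAg : ¬ I A g := fun Ag => hgm ⟨A, Ag, Am⟩
  have hit := rside_hit h Ay Vy Am Vg hAg nym.symm hYg hY iY hVm
  rw [sep_iff h jg hXg hYg, rside_of_miss h (fun t => hgm t.symm) j.2.2 hXg Am]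
  tauto

theorem sep_some (h : Axioms I) (nWX : W ≠ X) (nWY : W ≠ Y)
    (nWZ : W ≠ Z) (nXY : X ≠ Y) (nXZ : X ≠ Z) (nYZ : Y ≠ Z) :
    Sep I W X Y Z ∨ Sep I W Y X Z ∨ Sep I W Z X Y := by
  obtain ⟨m, j⟩ := Rim.exists_join h nWX
  have hY : ¬ RimInc I Y m := fun i => (Rim.eq_or h j i).elim nWY.symm nXY.symm
  have hZ : ¬ RimInc I Z m := fun i => (Rim.eq_or h j i).elim nWZ.symm nXZ.symm
  rw [sep_iff h j hY hZ]
  by_cases sYZ : rside I m Y ↔ rside I m Z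
  swap
  · exact Or.inl sYZ
  right
  obtain ⟨A, Am⟩ := h.A2 m
  obtain ⟨y, Ay, iY⟩ := Rim.line_through h A Y
  obtain ⟨z, Az, iZ⟩ := Rim.line_through h A Z
  have nym : y ≠ m := by rintro rfl; exact hY iY
  have nzm : z ≠ m := by rintro rfl; exact hZ iZ
  have nyz : y ≠ z := by
    rintro rfl
    exact (rside_join h ⟨nYZ, iY, iZ⟩ hY hZ).1 ⟨A, Ay, Am⟩ sYZ
  have tr := rim_trio h Am Ay Az j.2.2 iY iZ nym.symm nzm.symm nyz
  by_cases e : rside I y X ↔ rside I y Z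
  · exact Or.inr (sep_some_aux h j Am nWY nWZ nXY nXZ nYZ sYZ Ay iY Az iZ nzm nym nyz e)
  · exact Or.inl (sep_some_aux h j Am nWZ nWY nXZ nXY nYZ.symm sYZ.symm Az iZ Ay iY nym nzm
      nyz.symm (by grind))

theorem sepRel (h : Axioms I) : SepRel (Sep I) where
  flip _ _ _ _ s := s.flip
  swap _ _ _ _ s := s.swap
  ne _ _ _ _ s := s.ne h
  some _ _ _ _ h1 h2 h3 h4 h5 h6 := sep_some h h1 h2 h3 h4 h5 h6
  one _ _ _ _ s := s.not_sep h
  even a b c d e s s' s'' := by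
    obtain ⟨m, j⟩ := Rim.exists_join h (s.ne h).1
    have hc : ¬ RimInc I c m := fun i => (Rim.eq_or h j i).elim (s.ne h).2.symm (s.flip.ne h).2.symm
    have hd : ¬ RimInc I d m := fun i => (Rim.eq_or h j i).elim (s'.ne h).2.symm (s'.flip.ne h).2.symm
    have he : ¬ RimInc I e m := fun i => (Rim.eq_or h j i).elim (s'.swap.flip.ne h).2
      (s'.swap.flip.swap.flip.swap.ne h).2
    rw [sep_iff h j hc hd] at s
    rw [sep_iff h j hd he] at s'
    rw [sep_iff h j hc he] at s''
    tauto
  trans a b c d e n n' s s' s'' := by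
    obtain ⟨m, j⟩ := Rim.exists_join h (s''.ne h).1
    have hc : ¬ RimInc I c m := fun i => (Rim.eq_or h j i).elim (s''.ne h).2.symm
      (s''.flip.ne h).2.symm
    have hd : ¬ RimInc I d m := fun i => (Rim.eq_or h j i).elim n n'
    have he : ¬ RimInc I e m := fun i => (Rim.eq_or h j i).elim (s''.swap.flip.ne h).2
      (s''.swap.flip.swap.flip.swap.ne h).2
    rw [sep_iff h j hc hd] at s
    rw [sep_iff h j hd he] at s'
    rw [sep_iff h j hc he] at s''
    tauto

end HypInc

/-! ### From separation to linear and cyclic orders on the rim. -/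

namespace HypInc

universe u v

section Cyclic

variable {O : Type u} {D : O → O → O → O → Prop}

/-- The linear order with top element `w` determined by a separation relation, for which `p` is
the boundary between the upper part `R` and the lower part. -/
def SepRel.lt (D : O → O → O → O → Prop) (w p : O) (R : O → Prop) (x y : O) : Prop :=
  x ≠ y ∧ x ≠ w ∧ (y = w ∨ (x = p ∧ R y) ∨ (y = p ∧ ¬ R x) ∨
    (x ≠ p ∧ y ≠ p ∧ ((¬ R x ∧ R y) ∨ (R x ∧ R y ∧ D w x y p) ∨ (¬ R x ∧ ¬ R y ∧ D w y x p))))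

theorem SepRel.flip' (s : SepRel D) {a b c d : O} (h : D a b c d) : D a b d c :=
  s.swap _ _ _ _ (s.flip _ _ _ _ (s.swap _ _ _ _ h))

theorem SepRel.flip₃ (s : SepRel D) {a b c d : O} (h : D a b c d) : D b a d c :=
  s.flip _ _ _ _ (s.flip' h)

theorem SepRel.mid (s : SepRel D) {w x y z p : O} (h1 : D w x y p) (h2 : D w y z p) :
    D w y x z := by
  by_contra q
  exact s.trans w y p x z (s.ne _ _ _ _ h1).1.symm (s.ne _ _ _ _ (s.flip _ _ _ _ h1)).2
    (fun q => s.one _ _ _ _ h1 (s.flip' q)) q (s.flip' h2)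

theorem SepRel.chain (s : SepRel D) {w x y z p : O} (h1 : D w x y p) (h2 : D w y z p) :
    D w x z p := by
  have n1 := s.mid h1 h2
  by_contra q
  exact s.trans w x y z p (s.ne _ _ _ _ h2).2.symm (s.ne _ _ _ _ (s.swap _ _ _ _ n1)).1.symm
    (s.one _ _ _ _ n1) q h1

theorem SepRel.mixed (s : SepRel D) {w x y z p : O} (h1 : D w y x p) (h2 : D w p y z) :
    D w y x z := by
  by_contra q
  exact s.trans w y x z p (s.ne _ _ _ _ (s.flip' h2)).2.symm (s.ne _ _ _ _ (s.swap _ _ _ _ h2)).1.symm q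
    (fun r => s.one _ _ _ _ h2 (s.flip' r)) h1

theorem SepRel.lt_asymm (s : SepRel D) {w p : O} {R : O → Prop} {x y : O}
    (h1 : SepRel.lt D w p R x y) (h2 : SepRel.lt D w p R y x) : False := by
  have := s.one w x y p
  have := s.one w y x p
  unfold SepRel.lt at *; clear s; grind

theorem SepRel.lt_trans (s : SepRel D) {w p : O} {R : O → Prop} {x y z : O}
    (h1 : SepRel.lt D w p R x y) (h2 : SepRel.lt D w p R y z) : SepRel.lt D w p R x z := by
  by_cases xz : x = z
  · subst xz; exact (s.lt_asymm h1 h2).elim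
  have c1 := fun q r => s.chain (w := w) (x := x) (y := y) (z := z) (p := p) q r
  have c2 := fun q r => s.chain (w := w) (x := z) (y := y) (z := x) (p := p) q r
  unfold SepRel.lt at *; clear s; grind

theorem SepRel.lt_total (s : SepRel D) {w p : O} {R : O → Prop} (hwp : w ≠ p)
    (hR : ∀ x y, x ≠ w → x ≠ p → y ≠ w → y ≠ p → (D w p x y ↔ ¬ (R x ↔ R y))) {x y : O}
    (n : x ≠ y) : SepRel.lt D w p R x y ∨ SepRel.lt D w p R y x := by
  by_cases xw : x = w
  · right; exact ⟨n.symm, fun e => n (xw.trans e.symm), Or.inl xw⟩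
  by_cases yw : y = w
  · left; exact ⟨n, xw, Or.inl yw⟩
  by_cases xp : x = p
  · subst xp; unfold SepRel.lt; by_cases R y <;> grind
  by_cases yp : y = p
  · subst yp; unfold SepRel.lt; by_cases R x <;> grind
  have a1 := s.some w p x y hwp (Ne.symm xw) (Ne.symm yw) (Ne.symm xp) (Ne.symm yp) n
  have a2 := s.swap x p w y
  have b0 := hR x y xw xp yw yp
  have a3 := s.flip w x p y
  have a4 := s.swap w x p y
  have a5 := s.flip p y w x
  have a6 := s.swap y p w x
  have c4 := s.swap w y p x
  have c5 := s.flip p x w y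
  have c6 := s.swap x p w y
  unfold SepRel.lt; clear s; grind

/-- Two disjoint pairs alternate in a linear order. -/
def Alt [LinearOrder O] (a b c d : O) : Prop :=
  (a < c ∧ c < b ∧ (d < a ∨ b < d)) ∨ (a < d ∧ d < b ∧ (c < a ∨ b < c)) ∨
    (b < c ∧ c < a ∧ (d < b ∨ a < d)) ∨ (b < d ∧ d < a ∧ (c < b ∨ a < c))

theorem SepRel.lt_btw (s : SepRel D) {w p : O} {R : O → Prop}
    (hR : ∀ x y, x ≠ w → x ≠ p → y ≠ w → y ≠ p → (D w p x y ↔ ¬ (R x ↔ R y))) {x y z : O}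
    (h1 : SepRel.lt D w p R x y) (h2 : SepRel.lt D w p R y z) (n : z ≠ w) : D w y x z := by
  have xz : x ≠ z := by rintro rfl; exact s.lt_asymm h1 h2
  have c1 := fun q r => s.mid (w := w) (x := x) (y := y) (z := z) (p := p) q r
  have c2 := fun q r => s.flip' (s.mid (w := w) (x := z) (y := y) (z := x) (p := p) q r)
  have c3 := fun q r => s.mixed (w := w) (x := x) (y := y) (z := z) (p := p) q r
  have c4 := fun q r => s.flip' (s.mixed (w := w) (x := z) (y := y) (z := x) (p := p) q r)
  have c5 := fun q => s.flip' (a := w) (b := y) (c := z) (d := p) q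
  have r1 := hR x y
  have r2 := hR y z
  have r3 := hR x z
  have r4 := hR y x
  unfold SepRel.lt at *; clear s hR; grind

/-- The separations involving the cut point `w` determine all the others by the transitivity axiom
of `SepRel`. -/
theorem SepRel.of_lt (s : SepRel D) {w : O} (lt : O → O → Prop)
    (asymm : ∀ {x y}, lt x y → lt y x → False)
    (htrans : ∀ {x y z}, lt x y → lt y z → lt x z)
    (btw : ∀ {x y z}, lt x y → lt y z → z ≠ w → D w y x z) {a b c d : O} (h1 : lt a b) (h2 : lt b c)
    (h3 : lt c d) : D a c b d := by
  have ne : ∀ {x y}, lt x y → x ≠ y := by rintro x y h rfl; exact asymm h h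
  by_cases e : d = w
  · subst e; exact s.flip' (s.swap _ _ _ _ (btw h1 h2 (ne h3)))
  have hcw : c ≠ w := by
    rintro rfl
    exact (s.ne _ _ _ _ (btw h2 h3 e)).1 rfl
  have d1 := s.swap _ _ _ _ (btw h1 h2 hcw)
  have d2 := btw (htrans h1 h2) h3 e
  have hbd := (s.ne _ _ _ _ (s.flip' (btw h2 h3 e))).2
  by_contra q
  refine s.trans a c w d b (ne (htrans (htrans h1 h2) h3)).symm (ne h3).symm (fun r => ?_)
    (fun r => q (s.flip' r)) d1
  exact s.one _ _ _ _ (s.flip' d2) (s.flip' (s.swap _ _ _ _ r))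

/-- Cutting the rim open at `w` leaves a betweenness that fixes a linear order up to reversal; the
arc `R` next to `p` chooses the orientation. Separation becomes alternation of pairs. -/
theorem SepRel.exists_linearOrder (s : SepRel D) {w p : O} {R : O → Prop} (hwp : w ≠ p)
    (hR : ∀ x y, x ≠ w → x ≠ p → y ≠ w → y ≠ p → (D w p x y ↔ ¬ (R x ↔ R y))) :
    ∃ _ : LinearOrder O, (∀ x, x ≤ w) ∧ ∀ a b c d : O, D a b c d ↔ Alt a b c d := by
  classical
  have asymm := fun {x y} => s.lt_asymm (w := w) (p := p) (R := R) (x := x) (y := y)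
  have htrans := fun {x y z} => s.lt_trans (w := w) (p := p) (R := R) (x := x) (y := y) (z := z)
  let lo : LinearOrder O :=
    { le := fun x y => x = y ∨ SepRel.lt D w p R x y
      lt := fun x y => SepRel.lt D w p R x y
      le_refl := fun x => Or.inl rfl
      le_trans := by
        rintro x y z (rfl | h1) (rfl | h2)
        · exact Or.inl rfl
        · exact Or.inr h2
        · exact Or.inr h1
        · exact Or.inr (htrans h1 h2)
      lt_iff_le_not_ge := fun x y => ⟨fun q => ⟨Or.inr q, by
        rintro (rfl | q')
        · exact q.1 rfl
        · exact asymm q q'⟩, fun ⟨q, q'⟩ => q.resolve_left fun e => q' (Or.inl e.symm)⟩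
      le_antisymm := by
        rintro x y (rfl | h1) (e | h2)
        · rfl
        · rfl
        · exact e.symm
        · exact (asymm h1 h2).elim
      le_total := fun x y => by
        by_cases e : x = y
        · exact Or.inl (Or.inl e)
        · exact (s.lt_total hwp hR e).imp Or.inr Or.inr
      toDecidableLE := Classical.decRel _ }
  refine ⟨lo, fun x => ?_, fun a b c d => ?_⟩
  · by_cases e : x = w
    · exact Or.inl e
    · exact Or.inr ⟨e, e, Or.inl rfl⟩
  have key : ∀ {a b c d : O}, a < b → b < c → c < d → D a c b d := fun h1 h2 h3 =>
    s.of_lt (w := w) (SepRel.lt D w p R) asymm htrans (s.lt_btw hR) h1 h2 h3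
  clear_value lo
  have up : ∀ {a b c d : O}, Alt a b c d → D a b c d := by
    rintro a b c d (⟨h1, h2, h3 | h3⟩ | ⟨h1, h2, h3 | h3⟩ | ⟨h1, h2, h3 | h3⟩ | ⟨h1, h2, h3 | h3⟩)
    · exact s.flip' (s.swap _ _ _ _ (key h3 h1 h2))
    · exact key h1 h2 h3
    · exact s.swap _ _ _ _ (key h3 h1 h2)
    · exact s.flip' (key h1 h2 h3)
    · exact s.flip₃ (s.swap _ _ _ _ (key h3 h1 h2))
    · exact s.flip _ _ _ _ (key h1 h2 h3)
    · exact s.flip _ _ _ _ (s.swap _ _ _ _ (key h3 h1 h2))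
    · exact s.flip₃ (key h1 h2 h3)
  refine ⟨fun q => ?_, up⟩
  have nab := s.ne _ _ _ _ q
  have ncd := s.ne _ _ _ _ (s.swap _ _ _ _ q)
  have nba := s.ne _ _ _ _ (s.flip₃ q)
  have nad := s.ne _ _ _ _ (s.flip' q)
  have nbc := s.ne _ _ _ _ (s.flip _ _ _ _ q)
  have n1 := mt (up (a := a) (b := c) (c := b) (d := d)) (s.one _ _ _ _ q)
  have n2 := mt (up (a := a) (b := d) (c := b) (d := c)) (s.one _ _ _ _ (s.flip' q))
  by_contra n
  clear up key htrans asymm s hR q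
  unfold Alt at *
  obtain ⟨-, nac⟩ := nab
  obtain ⟨-, nad⟩ := nad
  obtain ⟨-, nbc⟩ := nbc
  obtain ⟨nba, nbd⟩ := nba
  rcases lt_or_gt_of_ne nba with h1 | h1 <;> rcases lt_or_gt_of_ne nac with h2 | h2 <;>
  rcases lt_or_gt_of_ne nad with h3 | h3 <;> rcases lt_or_gt_of_ne nbc with h4 | h4 <;>
  rcases lt_or_gt_of_ne nbd with h5 | h5 <;> rcases lt_or_gt_of_ne ncd.1 with h6 | h6 <;>
  simp_all

end Cyclic
end HypInc

namespace HypInc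

universe u v

section Cyclic

variable {O : Type u} {C : O → O → O → Prop}

/-- The cyclic order of a linear order. -/
def Cyc [LinearOrder O] (x y z : O) : Prop := (x < y ∧ y < z) ∨ (y < z ∧ z < x) ∨ (z < x ∧ x < y)

theorem isCyclicOrder_cyc [LinearOrder O] : IsCyclicOrder (Cyc (O := O)) where
  distinct x y z h := by unfold Cyc at h; grind
  total x y z h1 h2 h3 := by
    unfold Cyc
    rcases lt_or_gt_of_ne h1 with h1 | h1 <;> rcases lt_or_gt_of_ne h2 with h2 | h2 <;>
    rcases lt_or_gt_of_ne h3 with h3 | h3 <;> simp_all [lt_asymm]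
  cycle x y z h := by unfold Cyc at *; tauto
  trans x y z t h h' := by unfold Cyc at *; grind

theorem alt_iff_cyc [LinearOrder O] (w x y z : O) :
    Alt w y x z ↔ (Cyc w x y ∧ Cyc y z w) ∨ (Cyc w z y ∧ Cyc y x w) := by
  unfold Alt Cyc; constructor <;> grind

/-- The cut is made at `w`, with `C w x y` as the order of the rest. Statements about cyclic order
and separation then become finite checks of inequalities with a largest element. -/
theorem IsCyclicOrder.exists_linearOrder (hC : IsCyclicOrder C) (w : O) :
    ∃ _ : LinearOrder O, (∀ x, x ≤ w) ∧ ∀ x y z, C x y z ↔ Cyc x y z := by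
  classical
  have asymm : ∀ {x y z}, C x y z → ¬ C x z y := fun q q' => by
    obtain ⟨h1, h2, h3⟩ := hC.distinct _ _ _ q
    exact (hC.total _ _ _ h1 h2 h3).2 ⟨q, q'⟩
  have c1 := fun {x y z} => hC.cycle x y z
  have c2 : ∀ {x y z}, C x y z → C z x y := fun q => c1 (c1 q)
  have tr : ∀ {x y z}, C w x y → C w y z → C w x z := fun q q' => hC.trans _ _ _ _ q q'
  let lt : O → O → Prop := fun x y => (x ≠ w ∧ y = w) ∨ C w x y
  have nw : ∀ {x y}, C w x y → x ≠ w ∧ y ≠ w ∧ x ≠ y := fun q => by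
    obtain ⟨h1, h2, h3⟩ := hC.distinct _ _ _ q
    exact ⟨h1.symm, h3, h2⟩
  have lasymm : ∀ {x y}, lt x y → ¬ lt y x := by
    rintro x y (⟨h1, h2⟩ | h1) (⟨h3, h4⟩ | h3)
    · exact h1 h4
    · exact (nw h3).1 h2
    · exact (nw h1).1 h4
    · exact asymm h1 h3
  let lo : LinearOrder O :=
    { le := fun x y => x = y ∨ lt x y
      lt := lt
      le_refl := fun x => Or.inl rfl
      le_trans := by
        rintro x y z (rfl | h1) (rfl | h2)
        · exact Or.inl rfl
        · exact Or.inr h2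
        · exact Or.inr h1
        · right
          rcases h1 with ⟨-, a⟩ | a <;> rcases h2 with ⟨b, b'⟩ | b
          · exact (b a).elim
          · exact ((nw b).1 a).elim
          · exact Or.inl ⟨(nw a).1, b'⟩
          · exact Or.inr (tr a b)
      lt_iff_le_not_ge := fun x y => ⟨fun q => ⟨Or.inr q, by
        rintro (rfl | q')
        · exact lasymm q q
        · exact lasymm q q'⟩, fun ⟨q, q'⟩ => q.resolve_left fun e => q' (Or.inl e.symm)⟩
      le_antisymm := by
        rintro x y (rfl | h1) (e | h2)
        · rfl
        · rfl
        · exact e.symm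
        · exact (lasymm h1 h2).elim
      le_total := fun x y => by
        by_cases e : x = y
        · exact Or.inl (Or.inl e)
        by_cases ex : x = w
        · exact Or.inr (Or.inr (Or.inl ⟨fun ey => e (ex.trans ey.symm), ex⟩))
        by_cases ey : y = w
        · exact Or.inl (Or.inr (Or.inl ⟨ex, ey⟩))
        exact (hC.total w x y (Ne.symm ex) e ey).1.imp (fun q => Or.inr (Or.inr q))
          fun q => Or.inr (Or.inr q)
      toDecidableLE := Classical.decRel _ }
  have top : ∀ x, x ≤ w := fun x => by
    by_cases e : x = w
    · exact Or.inl e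
    · exact Or.inr (Or.inl ⟨e, rfl⟩)
  have hlt : ∀ {x y}, x < y ↔ (x ≠ w ∧ y = w) ∨ C w x y := Iff.rfl
  clear_value lo
  have up : ∀ {x y z}, x < y → y < z → C x y z := by
    intro x y z h1 h2
    have hyw : y ≠ w := (h2.trans_le (top z)).ne
    have q1 : C w x y := (hlt.1 h1).resolve_left fun e => hyw e.2
    rcases hlt.1 h2 with ⟨-, rfl⟩ | q2
    · exact c1 q1
    · exact c2 (hC.trans _ _ _ _ (c1 q2) (c2 q1))
  have up' : ∀ {x y z}, Cyc x y z → C x y z := by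
    rintro x y z (⟨h1, h2⟩ | ⟨h1, h2⟩ | ⟨h1, h2⟩)
    · exact up h1 h2
    · exact c2 (up h1 h2)
    · exact c1 (up h1 h2)
  refine ⟨lo, top, fun x y z => ⟨fun q => ?_, up'⟩⟩
  obtain ⟨h1, h2, h3⟩ := hC.distinct _ _ _ q
  exact (isCyclicOrder_cyc.total x y z h1 h2 h3).1.resolve_right fun q' => asymm q (up' q')

end Cyclic

variable {P : Type u} {L : Type v} {I : P → L → Prop} {X Y Z W : Rim I} {a b m k : L}

theorem exists_cyclicOrder (h : Axioms I) :
    ∃ C : Rim I → Rim I → Rim I → Prop, IsCyclicOrder C ∧ Compatible I C := by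
  obtain ⟨O, -⟩ := h.A3.1
  obtain ⟨m, -⟩ := h.exists_line O O
  obtain ⟨A, B, j⟩ := Rim.exists_ends h m
  -- The rim is cut at the end `A` of `m`, the other end `B` serves as boundary, and the two sides
  -- of `m` are the two arcs.
  obtain ⟨lo, -, hS⟩ := (sepRel h).exists_linearOrder (R := rside I m) j.1
    fun x y hxw hxp hyw hyp => sep_iff h j (fun i => (Rim.eq_or h j i).elim hxw hxp)
      (fun i => (Rim.eq_or h j i).elim hyw hyp)
  exact ⟨Cyc, isCyclicOrder_cyc, fun W X Y Z => (hS W Y X Z).trans (alt_iff_cyc W X Y Z)⟩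

/-- A cyclic order compatible with separation, cut open at a rimpoint. -/
theorem exists_linearOrder {C : Rim I → Rim I → Rim I → Prop} (hC : IsCyclicOrder C)
    (hc : Compatible I C) (w : Rim I) : ∃ _ : LinearOrder (Rim I), (∀ x, x ≤ w) ∧
      (∀ x y z, C x y z ↔ Cyc x y z) ∧ ∀ a b c d : Rim I, Sep I a b c d ↔ Alt a b c d := by
  obtain ⟨lo, h1, h2⟩ := hC.exists_linearOrder w
  exact ⟨lo, h1, h2, fun a b c d => by rw [hc, alt_iff_cyc]; simp only [h2]⟩

end HypInc

/-! ### Half-turns about finite points. -/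

namespace HypInc

universe u v

variable {P : Type u} {L : Type v} {I : P → L → Prop} {X Y Z W : Rim I} {a b l m k : L} {A B : P}

theorem Opp.symm (o : Opp I A X Y) : Opp I A Y X := o.imp fun _ q => ⟨q.1, q.2.symm⟩

theorem opp_unique (h : Axioms I) (o : Opp I A X Y) (o' : Opp I A X Z) : Y = Z := by
  obtain ⟨m, Am, j⟩ := o
  obtain ⟨n, An, j'⟩ := o'
  have := Rim.line_unique h Am j.2.1 An j'.2.1
  subst this
  exact ((Rim.eq_or h j j'.2.2).resolve_left j'.1.symm).symm

theorem exists_opp (h : Axioms I) (A : P) (X : Rim I) : ∃ Y, Opp I A X Y := by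
  obtain ⟨m, Am, i⟩ := Rim.line_through h A X
  obtain ⟨Y, n, iY, -⟩ := Rim.other h i
  exact ⟨Y, m, Am, n.symm, i, iY⟩

/-- The half-turn about a finite point. -/
noncomputable def halfTurn (h : Axioms I) (A : P) : Equiv.Perm (Rim I) where
  toFun X := (exists_opp h A X).choose
  invFun X := (exists_opp h A X).choose
  left_inv X := opp_unique h (exists_opp h A _).choose_spec (exists_opp h A X).choose_spec.symm
  right_inv X := opp_unique h (exists_opp h A _).choose_spec (exists_opp h A X).choose_spec.symm

theorem opp_halfTurn (h : Axioms I) (A : P) (X : Rim I) : Opp I A X (halfTurn h A X) :=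
  (exists_opp h A X).choose_spec

theorem halfTurn_eq_iff (h : Axioms I) : halfTurn h A X = Y ↔ Opp I A X Y :=
  ⟨fun e => e ▸ opp_halfTurn h A X, fun o => opp_unique h (opp_halfTurn h A X) o⟩

theorem halfTurn_halfTurn (h : Axioms I) (A : P) (X : Rim I) : halfTurn h A (halfTurn h A X) = X :=
  (halfTurn h A).left_inv X

theorem halfTurn_mul_self (h : Axioms I) (A : P) : halfTurn h A * halfTurn h A = 1 :=
  Equiv.ext (halfTurn_halfTurn h A)

theorem halfTurn_inv (h : Axioms I) (A : P) : (halfTurn h A)⁻¹ = halfTurn h A := rfl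

theorem halfTurn_eq_comm (h : Axioms I) : halfTurn h A X = Y ↔ halfTurn h A Y = X := by
  constructor <;> rintro rfl <;> exact halfTurn_halfTurn h A _

theorem halfTurn_ne (h : Axioms I) (A : P) (X : Rim I) : halfTurn h A X ≠ X := by
  obtain ⟨m, -, j⟩ := opp_halfTurn h A X
  exact j.1.symm

theorem isHalfTurn_halfTurn (h : Axioms I) (A : P) : IsHalfTurn I A (halfTurn h A) := opp_halfTurn h A

theorem isHalfTurn_iff (h : Axioms I) {σ : Equiv.Perm (Rim I)} :
    IsHalfTurn I A σ ↔ σ = halfTurn h A :=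
  ⟨fun q => Equiv.ext fun X => opp_unique h (q X) (opp_halfTurn h A X),
    fun e => e ▸ isHalfTurn_halfTurn h A⟩

theorem halfTurn_of_join (h : Axioms I) (j : Join I X Y m) (Am : I A m) : halfTurn h A X = Y :=
  (halfTurn_eq_iff h).2 ⟨m, Am, j⟩

theorem mem_of_halfTurn (h : Axioms I) (j : Join I X Y m) (e : halfTurn h A X = Y) : I A m := by
  obtain ⟨n, An, j'⟩ := (halfTurn_eq_iff h).1 e
  rwa [Rim.join_unique h j j']

theorem mem_iff_halfTurn (h : Axioms I) (j : Join I X Y m) : I A m ↔ halfTurn h A X = Y :=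
  ⟨halfTurn_of_join h j, mem_of_halfTurn h j⟩

theorem halfTurn_inc (h : Axioms I) (Am : I A m) (i : RimInc I X m) :
    RimInc I (halfTurn h A X) m := by
  obtain ⟨n, An, j⟩ := opp_halfTurn h A X
  rw [Rim.line_unique h Am i An j.2.1]
  exact j.2.2

theorem halfTurn_inc_iff (h : Axioms I) (Am : I A m) :
    RimInc I (halfTurn h A X) m ↔ RimInc I X m :=
  ⟨fun i => by simpa only [halfTurn_halfTurn] using halfTurn_inc h Am i, halfTurn_inc h Am⟩

theorem eq_of_halfTurn (h : Axioms I) (Al : I A l) (Bl : I B l) (n : ¬ RimInc I X l)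
    (e : halfTurn h A X = halfTurn h B X) : A = B := by
  obtain ⟨a, Aa, j⟩ := opp_halfTurn h A X
  obtain ⟨b, Bb, j'⟩ := opp_halfTurn h B X
  rw [← e] at j'
  have := Rim.join_unique h j j'
  subst this
  exact h.eq_pt (fun e : a = l => n (e ▸ j.2.1)) Aa Al Bb Bl

theorem Rim.exists_notInc (h : Axioms I) (m : L) : ∃ X : Rim I, ¬ RimInc I X m := by
  obtain ⟨A, hA⟩ := h.exists_notMem m
  obtain ⟨X, iX⟩ := Rim.exists_end h m
  obtain ⟨n, An, i⟩ := Rim.line_through h A X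
  obtain ⟨Y, nYX, iY, -⟩ := Rim.other h i
  refine ⟨Y, fun i' => hA ?_⟩
  rwa [Rim.join_unique h ⟨nYX, i', iX⟩ ⟨nYX, iY, i⟩]

theorem halfTurn_injective (h : Axioms I) : Function.Injective (halfTurn h) := by
  intro A B e
  obtain ⟨l, Al, Bl⟩ := h.exists_line A B
  obtain ⟨X, hX⟩ := Rim.exists_notInc h l
  exact eq_of_halfTurn h Al Bl hX (by rw [e])

theorem rside_halfTurn (h : Axioms I) (Al : I A l) (n : ¬ RimInc I X l) :
    ¬ (rside I l X ↔ rside I l (halfTurn h A X)) := by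
  obtain ⟨m, Am, j⟩ := opp_halfTurn h A X
  exact (rside_join h j n (mt (halfTurn_inc_iff h Al).1 n)).1 ⟨A, Am, Al⟩

theorem exists_halfTurn (h : Axioms I) (nX : ¬ RimInc I X l) (nY : ¬ RimInc I Y l)
    (s : ¬ (rside I l X ↔ rside I l Y)) : ∃ V, I V l ∧ halfTurn h V X = Y := by
  obtain ⟨m, j⟩ := Rim.exists_join h (X := X) (Y := Y) (by rintro rfl; exact s Iff.rfl)
  obtain ⟨V, Vm, Vl⟩ := (rside_join h j nX nY).2 s
  exact ⟨V, Vl, halfTurn_of_join h j Vm⟩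

/-- Two chords cross exactly if one half-turn, about the crossing point, interchanges the ends of
both. This translates crossing into algebra from here on. -/
theorem sep_iff_halfTurn (h : Axioms I) : Sep I W X Y Z ↔ W ≠ Y ∧ X ≠ Y ∧
    ∃ V, halfTurn h V W = X ∧ halfTurn h V Y = Z := by
  constructor
  · intro s
    refine ⟨(s.ne h).2, (s.flip.ne h).2, ?_⟩
    obtain ⟨a, b, j, j', -, V, Va, Vb⟩ := s
    exact ⟨V, halfTurn_of_join h j Va, halfTurn_of_join h j' Vb⟩
  · rintro ⟨n, n', V, rfl, rfl⟩
    obtain ⟨a, Va, j⟩ := opp_halfTurn h V W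
    obtain ⟨b, Vb, j'⟩ := opp_halfTurn h V Y
    refine ⟨a, b, j, j', ?_, V, Va, Vb⟩
    rintro rfl
    exact (Rim.eq_or h j j'.2.1).elim n.symm n'.symm

/-- All chords through `A` cross each other, so each rimpoint and its image separate every other
such pair; this forces the cyclic order to be kept. -/
theorem halfTurn_cyc (h : Axioms I) {C : Rim I → Rim I → Rim I → Prop} (hC : IsCyclicOrder C)
    (hc : Compatible I C) (A : P) (c : C X Y Z) :
    C (halfTurn h A X) (halfTurn h A Y) (halfTurn h A Z) := by
  obtain ⟨lo, top, hCyc, hS⟩ := exists_linearOrder hC hc X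
  have alt : ∀ U V, U ≠ V → halfTurn h A U ≠ V → Alt U (halfTurn h A U) V (halfTurn h A V) :=
    fun U V n n' => (hS _ _ _ _).1 ((sep_iff_halfTurn h).2 ⟨n, n', A, rfl, rfl⟩)
  have inj := (halfTurn h A).injective
  have a1 := alt X Y
  have a2 := alt X Z
  have a3 := alt Y Z
  have e1 := halfTurn_eq_comm h (A := A) (X := X) (Y := Y)
  have e2 := halfTurn_eq_comm h (A := A) (X := X) (Y := Z)
  have e3 := halfTurn_eq_comm h (A := A) (X := Y) (Y := Z)
  have n1 := halfTurn_ne h A X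
  have n2 := halfTurn_ne h A Y
  have n3 := halfTurn_ne h A Z
  have i1 := inj.ne_iff (x := X) (y := Y)
  have i2 := inj.ne_iff (x := X) (y := Z)
  have i3 := inj.ne_iff (x := Y) (y := Z)
  have t := fun U => (top U).lt_or_eq
  have t1 := t Y
  have t2 := t Z
  have t3 := t (halfTurn h A X)
  have t4 := t (halfTurn h A Y)
  have t5 := t (halfTurn h A Z)
  rw [hCyc] at *
  generalize halfTurn h A X = X' at *
  generalize halfTurn h A Y = Y' at *
  generalize halfTurn h A Z = Z' at *
  clear alt inj t top hCyc hS hc hC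
  unfold Cyc Alt at *
  grind

/-- Whether `X ^ A` and `X` separate `X ^ B` from `K` depends only on whether the ray from `A`
through `B` leads to `K`, and so not on `X`. In `pascal_aux` this compares the two rounds of the
hexagon. -/
theorem halfTurn_order (h : Axioms I) {K : Rim I} (Al : I A l) (Bl : I B l) (nAB : A ≠ B)
    (iK : RimInc I K l) (nX : ¬ RimInc I X l) (nY : ¬ RimInc I Y l) :
    Sep I X (halfTurn h A X) (halfTurn h B X) K ↔ Sep I Y (halfTurn h A Y) (halfTurn h B Y) K := by
  obtain ⟨F, e⟩ := (rimInc_iff h).1 iK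
  have key : ∀ {X : Rim I}, ¬ RimInc I X l →
      (Sep I X (halfTurn h A X) (halfTurn h B X) K ↔ F ≠ rayEnd I A B) := by
    intro X nX
    obtain ⟨k, Ak, j⟩ := opp_halfTurn h A X
    obtain ⟨b, Bb, jb⟩ := opp_halfTurn h B X
    have nkl : k ≠ l := by rintro rfl; exact nX j.2.1
    have nbk : b ≠ k := by
      rintro rfl
      exact nAB (h.eq_pt nkl Ak Al Bb Bl)
    have nK : ¬ RimInc I K k := fun i => nkl (Rim.line_unique h Ak i Al iK)
    have nB : ¬ RimInc I (halfTurn h B X) k := fun i =>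
      nbk (Rim.join_unique h jb ⟨jb.1, j.2.1, i⟩)
    rw [sep_iff h j nB nK, rside_of_miss h (Rim.miss h nbk jb.2.1 j.2.1) jb.2.2 nB Bb,
      rside_iff h e nK, ← h.tail_rayEnd nAB.symm Al Bl Ak nkl]
    constructor
    · rintro q rfl
      exact q Iff.rfl
    · intro q q'
      have d : Dir I (rayEnd I A B) l := ⟨A, B, nAB, Al, Bl, rfl⟩
      have := d.tail_opp e.1 h q.symm nkl ⟨A, Ak, Al⟩
      tauto
  rw [key nX, key nY]

end HypInc

/-! ### Pascal's theorem as an identity of half-turns. -/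

namespace HypInc

universe u v

variable {P : Type u} {L : Type v} {I : P → L → Prop} {W : Rim I} {a b l m k : L} {A B X Y Z V : P}

theorem Rim.join_ne (h : Axioms I) {A B C D : Rim I} (j : Join I A B a) (j' : Join I C D b)
    (n : A ≠ C) (n' : B ≠ C) : a ≠ b := by
  rintro rfl
  exact (Rim.eq_or h j j'.2.1).elim n.symm n'.symm

theorem not_iff_chain {p q r s : Prop} (h1 : ¬ (p ↔ q)) (h2 : ¬ (q ↔ r)) (h3 : ¬ (r ↔ s)) :
    ¬ (p ↔ s) := by tauto

theorem alt_sides {O : Type*} [LinearOrder O] {K M U V : O} (h1 : U < M) (h2 : V < M) (q : Alt K M U V) : (U < K ∧ K < V) ∨ (K < U ∧ V < K) := by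
  unfold Alt at q; grind

/-- The points `A`, `C` lie on one side of `K` and `D`, `F` on the other. The hypothesis `o` says
that `A` to `C` and `D` to `F` are moves in opposite senses of the linear order, which is what makes
`CD` and `FA` cross. -/
theorem alt_hexagon {O : Type*} [LinearOrder O] {A B C D E F K : O}
    (h1 : (A < K ∧ K < B) ∨ (K < A ∧ B < K)) (h2 : (B < K ∧ K < C) ∨ (K < B ∧ C < K))
    (h3 : (C < K ∧ K < D) ∨ (K < C ∧ D < K)) (h4 : (D < K ∧ K < E) ∨ (K < D ∧ E < K))
    (h5 : (E < K ∧ K < F) ∨ (K < E ∧ F < K)) (nAC : A ≠ C) (nDF : D ≠ F)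
    (o : Alt B A C K ↔ Alt E D F K) : Alt C D F A := by
  have e1 : Alt B A C K ↔ (A < K ∧ C < A) ∨ (K < A ∧ A < C) := by
    unfold Alt; clear h3 h4 h5 o; grind
  have e2 : Alt E D F K ↔ (E < K ∧ D < F) ∨ (K < E ∧ F < D) := by
    unfold Alt; clear h1 h2 h3 o e1; grind
  rw [e1, e2] at o
  unfold Alt
  rcases lt_or_gt_of_ne nAC with h6 | h6 <;> rcases lt_or_gt_of_ne nDF with h7 | h7 <;> grind

/-- The hexagon `ABCDEF` has `X` on `AB` and `DE`, and `Y` on `BC` and `EF`. By (A7) the lines `CD`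
and `FA` meet on `l`, hence at `Z`, and so the hexagon closes. -/
theorem pascal_aux (h : Axioms I) (Xl : I X l) (Yl : I Y l) (Zl : I Z l) (nXY : X ≠ Y) (nYZ : Y ≠ Z)
    (nXZ : X ≠ Z) {A B C D E F : Rim I} (hA : ¬ RimInc I A l) (hB : halfTurn h X A = B)
    (hC : halfTurn h Y B = C) (hD : halfTurn h Z C = D) (hE : halfTurn h X D = E)
    (hF : halfTurn h Y E = F) : halfTurn h Z F = A := by
  have oB : ¬ RimInc I B l := hB ▸ mt (halfTurn_inc_iff h Xl).1 hA
  have oC : ¬ RimInc I C l := hC ▸ mt (halfTurn_inc_iff h Yl).1 oB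
  have oD : ¬ RimInc I D l := hD ▸ mt (halfTurn_inc_iff h Zl).1 oC
  have oE : ¬ RimInc I E l := hE ▸ mt (halfTurn_inc_iff h Xl).1 oD
  have oF : ¬ RimInc I F l := hF ▸ mt (halfTurn_inc_iff h Yl).1 oE
  have sAB := hB ▸ rside_halfTurn h Xl hA
  have sBC := hC ▸ rside_halfTurn h Yl oB
  have sCD := hD ▸ rside_halfTurn h Zl oC
  have sDE := hE ▸ rside_halfTurn h Xl oD
  have sEF := hF ▸ rside_halfTurn h Yl oE
  have ne : ∀ {U V}, ¬ (rside I l U ↔ rside I l V) → U ≠ V := by rintro U V s rfl; exact s Iff.rfl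
  have hA' := (halfTurn_eq_comm h).1 hB
  have hB' := (halfTurn_eq_comm h).1 hC
  have hC' := (halfTurn_eq_comm h).1 hD
  have hD' := (halfTurn_eq_comm h).1 hE
  have hE' := (halfTurn_eq_comm h).1 hF
  have nAC : A ≠ C := by
    rintro rfl; exact nXY (eq_of_halfTurn h Xl Yl oB (by rw [hA', hC]))
  have nBD : B ≠ D := by
    rintro rfl; exact nYZ (eq_of_halfTurn h Yl Zl oC (by rw [hB', hD]))
  have nCE : C ≠ E := by
    rintro rfl; exact nXZ.symm (eq_of_halfTurn h Zl Xl oD (by rw [hC', hE]))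
  have nDF : D ≠ F := by
    rintro rfl; exact nXY (eq_of_halfTurn h Xl Yl oE (by rw [hD', hF]))
  have nAE : A ≠ E := by
    rintro rfl; exact nBD (hB.symm.trans hD')
  have nBF : B ≠ F := by
    rintro rfl; exact nCE (hC.symm.trans hE')
  have nAB := ne sAB
  have nBC := ne sBC
  have nCD := ne sCD
  have nDE := ne sDE
  have nEF := ne sEF
  have nAD : A ≠ D := ne (not_iff_chain sAB sBC sCD)
  have nBE : B ≠ E := ne (not_iff_chain sBC sCD sDE)
  have nCF : C ≠ F := ne (not_iff_chain sCD sDE sEF)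
  have nFA : F ≠ A := (ne (not_iff_chain (not_iff_chain sAB sBC sCD) sDE sEF)).symm
  -- (A7) presupposes that `CD` and `FA` have a finite common point. This follows from the order of
  -- the six rimpoints, read off after cutting the rim at the end `M` of `l`.
  have sep : Sep I C D F A := by
    obtain ⟨K, M, jl⟩ := Rim.exists_ends h l
    have o := (halfTurn_order h Xl Yl nXY jl.2.1 oB oE)
    rw [hA', hC, hD', hF] at o
    obtain ⟨Cy, c1, c2⟩ := exists_cyclicOrder h
    obtain ⟨lo, top, -, hS⟩ := exists_linearOrder c1 c2 M
    have off : ∀ {U}, ¬ RimInc I U l → U < M := fun q =>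
      (top _).lt_of_ne fun e => q (e ▸ jl.2.2)
    have side : ∀ {U V}, ¬ RimInc I U l → ¬ RimInc I V l → ¬ (rside I l U ↔ rside I l V) →
        (U < K ∧ K < V) ∨ (K < U ∧ V < K) := fun q q' q'' =>
      alt_sides (off q) (off q') ((hS _ _ _ _).1 ((sep_iff h jl q q').2 q''))
    rw [hS] at o ⊢
    rw [hS] at o
    exact alt_hexagon (side hA oB sAB) (side oB oC sBC) (side oC oD sCD) (side oD oE sDE)
      (side oE oF sEF) nAC nDF o
  obtain ⟨cd, fa, jcd, jfa, -, T, Tcd, Tfa⟩ := sep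
  obtain ⟨ab, Xab, jab⟩ := (halfTurn_eq_iff h).1 hB
  obtain ⟨bc, Ybc, jbc⟩ := (halfTurn_eq_iff h).1 hC
  obtain ⟨de, Xde, jde⟩ := (halfTurn_eq_iff h).1 hE
  obtain ⟨ef, Yef, jef⟩ := (halfTurn_eq_iff h).1 hF
  have nd : [A, B, C, D, E, F].Nodup := by
    simp only [List.nodup_cons, List.mem_cons, List.not_mem_nil, or_false, not_or, not_false_eq_true,
      List.nodup_nil, and_true]
    exact ⟨⟨nAB, nAC, nAD, nAE, nFA.symm⟩, ⟨nBC, nBD, nBE, nBF⟩, ⟨nCD, nCE, nCF⟩, ⟨nDE, nDF⟩, nEF⟩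
  obtain ⟨n, hn⟩ := h.A7 A B C D E F nd ab bc cd de ef fa jab jbc jcd jde jef jfa
    (Rim.join_ne h jab jde nAD nBD) (Rim.join_ne h jbc jef nBE nCE) (Rim.join_ne h jcd jfa nCF nDF)
    X Y T Xab Xde Ybc Yef Tcd Tfa
  have := h.eq_line nXY (hn X (by simp)) (hn Y (by simp)) Xl Yl
  subst this
  have e : T = Z := h.eq_pt (fun e : cd = n => oC (e ▸ jcd.2.1)) Tcd (hn T (by simp))
    (mem_of_halfTurn h jcd hD) Zl
  exact halfTurn_of_join h jfa (e ▸ Tfa)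

/-- The product of three half-turns about collinear points is an involution. -/
theorem pascal (h : Axioms I) (Xl : I X l) (Yl : I Y l) (Zl : I Z l) :
    halfTurn h X * halfTurn h Y * halfTurn h Z = halfTurn h Z * halfTurn h Y * halfTurn h X := by
  by_cases nXY : X = Y
  · subst nXY; rw [halfTurn_mul_self, mul_assoc, halfTurn_mul_self]; rfl
  by_cases nYZ : Y = Z
  · subst nYZ; rw [halfTurn_mul_self, mul_assoc, halfTurn_mul_self]; rfl
  by_cases nXZ : X = Z
  · subst nXZ; rfl
  ext1 W
  simp only [Equiv.Perm.mul_apply]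
  by_cases hW : RimInc I W l
  · obtain ⟨M, n, iM, -⟩ := Rim.other h hW
    have e : ∀ {V}, I V l → halfTurn h V W = M ∧ halfTurn h V M = W := fun Vl =>
      ⟨halfTurn_of_join h ⟨n.symm, hW, iM⟩ Vl, halfTurn_of_join h ⟨n, iM, hW⟩ Vl⟩
    simp only [e Xl, e Yl, e Zl]
  · have := pascal_aux h Xl Yl Zl nXY nYZ nXZ hW rfl rfl rfl rfl rfl
    have := (halfTurn_eq_comm h).1 ((halfTurn_eq_comm h).1 this).symm
    exact (halfTurn_eq_comm h).1 this.symm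

end HypInc

/-! ### Translations along a line. -/

namespace HypInc

universe u v

variable {P : Type u} {L : Type v} {I : P → L → Prop} {X Y Z K M N : Rim I} {a b l m k n : L}
  {A B R S T V W : P} {g g' α β : Equiv.Perm (Rim I)}

/-- The products of two half-turns about points of `l`. -/
def Trans (h : Axioms I) (l : L) (g : Equiv.Perm (Rim I)) : Prop :=
  ∃ A B, I A l ∧ I B l ∧ g = halfTurn h A * halfTurn h B

theorem Trans.mk (h : Axioms I) (Al : I A l) (Bl : I B l) :
    Trans h l (halfTurn h A * halfTurn h B) := ⟨A, B, Al, Bl, rfl⟩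

/-- Two uses of `pascal` suffice: `ABCD = CBAD = CDAB`. -/
theorem Trans.comm {h : Axioms I} (t : Trans h l g) (t' : Trans h l g') : g * g' = g' * g := by
  obtain ⟨A, B, Al, Bl, rfl⟩ := t
  obtain ⟨C, D, Cl, Dl, rfl⟩ := t'
  rw [← mul_assoc, pascal h Al Bl Cl, mul_assoc _ (halfTurn h A), mul_assoc (halfTurn h C),
    ← mul_assoc (halfTurn h B), pascal h Bl Al Dl]
  simp only [mul_assoc]

theorem Trans.inv {h : Axioms I} (t : Trans h l g) : Trans h l g⁻¹ := by
  obtain ⟨A, B, Al, Bl, rfl⟩ := t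
  exact ⟨B, A, Bl, Al, by rw [mul_inv_rev]; rfl⟩

theorem Trans.conj {h : Axioms I} (t : Trans h l g) (Al : I A l) :
    halfTurn h A * g = g⁻¹ * halfTurn h A := by
  obtain ⟨B, C, Bl, Cl, rfl⟩ := t
  rw [← mul_assoc, pascal h Al Bl Cl, mul_inv_rev, halfTurn_inv, halfTurn_inv]

theorem Trans.eq_one {h : Axioms I} (t : Trans h l g) (n : ¬ RimInc I X l) (e : g X = X) : g = 1 := by
  obtain ⟨A, B, Al, Bl, rfl⟩ := t
  have : A = B := eq_of_halfTurn h Al Bl n ((halfTurn_eq_comm h).1 e)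
  rw [this, halfTurn_mul_self]

theorem Trans.inc_iff {h : Axioms I} (t : Trans h l g) : RimInc I (g X) l ↔ RimInc I X l := by
  obtain ⟨A, B, Al, Bl, rfl⟩ := t
  rw [Equiv.Perm.mul_apply, halfTurn_inc_iff h Al, halfTurn_inc_iff h Bl]

theorem Trans.rside_iff {h : Axioms I} (t : Trans h l g) (n : ¬ RimInc I X l) :
    rside I l (g X) ↔ rside I l X := by
  obtain ⟨A, B, Al, Bl, rfl⟩ := t
  have h1 := rside_halfTurn h Bl n
  have h2 := rside_halfTurn h Al (mt (halfTurn_inc_iff h Bl).1 n)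
  rw [Equiv.Perm.mul_apply]
  tauto

theorem Trans.fix {h : Axioms I} (t : Trans h l g) (i : RimInc I X l) : g X = X := by
  obtain ⟨A, B, Al, Bl, rfl⟩ := t
  obtain ⟨Y, n, iY, -⟩ := Rim.other h i
  rw [Equiv.Perm.mul_apply, halfTurn_of_join h ⟨n.symm, i, iY⟩ Bl, halfTurn_of_join h ⟨n, iY, i⟩ Al]

theorem exists_trans (h : Axioms I) (nX : ¬ RimInc I X l) (nY : ¬ RimInc I Y l)
    (s : rside I l X ↔ rside I l Y) : ∃ g, Trans h l g ∧ g X = Y := by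
  obtain ⟨A, Al⟩ := h.A2 l
  have nX' := mt (halfTurn_inc_iff h Al).1 nX
  have s' := rside_halfTurn h Al nX
  obtain ⟨B, Bl, e⟩ := exists_halfTurn h nX' nY (by tauto)
  exact ⟨_, Trans.mk h Bl Al, e⟩

/-- The only candidate is the half-turn about the point `W` that treats one rimpoint off `l`
correctly. The quotient `k` fixes a rimpoint and commutes with the translations, which are
transitive on each side of `l`, so it is trivial on one side; the half-turn about `W`, which inverts
`k`, carries this to the other side. -/
theorem exists_mul_three (h : Axioms I) (Al : I A l) (Bl : I B l) (Vl : I V l) :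
    ∃ W, I W l ∧ halfTurn h A * halfTurn h B * halfTurn h V = halfTurn h W := by
  obtain ⟨X, nX⟩ := Rim.exists_notInc h l
  have n1 := mt (halfTurn_inc_iff h Vl).1 nX
  have n2 := mt (halfTurn_inc_iff h Bl).1 n1
  have n3 := mt (halfTurn_inc_iff h Al).1 n2
  obtain ⟨W, Wl, e⟩ := exists_halfTurn h nX n3
    (not_iff_chain (rside_halfTurn h Vl nX) (rside_halfTurn h Bl n1) (rside_halfTurn h Al n2))
  have t1 := Trans.mk h Al Bl
  have t2 := Trans.mk h Vl Wl
  set k := (halfTurn h A * halfTurn h B) * (halfTurn h V * halfTurn h W) with hk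
  have e' : k (halfTurn h W X) = halfTurn h W X := by
    simp only [hk, Equiv.Perm.mul_apply, halfTurn_halfTurn]; exact e.symm
  have e2 : halfTurn h W * k = k⁻¹ * halfTurn h W := by
    rw [hk, ← mul_assoc, t1.conj Wl, mul_assoc, t2.conj Wl, ← mul_assoc, ← mul_inv_rev, t2.comm t1]
  have nD := mt (halfTurn_inc_iff h Wl).1 nX
  have same : ∀ {Y}, ¬ RimInc I Y l → (rside I l (halfTurn h W X) ↔ rside I l Y) → k Y = Y := by
    intro Y nY s
    obtain ⟨g, tg, rfl⟩ := exists_trans h nD nY s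
    rw [← Equiv.Perm.mul_apply, hk, mul_assoc, t2.comm tg, ← mul_assoc, t1.comm tg, mul_assoc, ← hk,
      Equiv.Perm.mul_apply, e']
  have k1 : k = 1 := by
    ext1 Y
    by_cases iY : RimInc I Y l
    · rw [hk, Equiv.Perm.mul_apply, t2.fix iY, t1.fix iY, Equiv.Perm.one_apply]
    by_cases s : rside I l (halfTurn h W X) ↔ rside I l Y
    · exact same iY s
    · have s' := rside_halfTurn h Wl iY
      have e3 := same (mt (halfTurn_inc_iff h Wl).1 iY) (by tauto)
      have e4 : halfTurn h W (k Y) = k⁻¹ (halfTurn h W Y) := DFunLike.congr_fun e2 Y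
      rw [Equiv.Perm.inv_eq_iff_eq.2 e3.symm] at e4
      exact (halfTurn h W).injective e4
  refine ⟨W, Wl, ?_⟩
  rw [hk, ← mul_assoc] at k1
  exact mul_eq_one_iff_eq_inv.1 k1

theorem Trans.halfTurn_mul {h : Axioms I} (t : Trans h l g) (Al : I A l) :
    ∃ B, I B l ∧ halfTurn h A * g = halfTurn h B := by
  obtain ⟨C, D, Cl, Dl, rfl⟩ := t
  obtain ⟨W, Wl, e⟩ := exists_mul_three h Al Cl Dl
  exact ⟨W, Wl, by rw [← e, mul_assoc]⟩

theorem Trans.mul_halfTurn {h : Axioms I} (t : Trans h l g) (Al : I A l) :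
    ∃ B, I B l ∧ g * halfTurn h A = halfTurn h B := by
  obtain ⟨C, D, Cl, Dl, rfl⟩ := t
  exact exists_mul_three h Cl Dl Al

theorem Trans.eq_mul {h : Axioms I} (t : Trans h l g) (Al : I A l) :
    ∃ B, I B l ∧ g = halfTurn h A * halfTurn h B := by
  obtain ⟨B, Bl, e⟩ := t.halfTurn_mul Al
  exact ⟨B, Bl, by rw [← e, ← mul_assoc, halfTurn_mul_self, one_mul]⟩

theorem Trans.cyc {h : Axioms I} {C : Rim I → Rim I → Rim I → Prop} (hC : IsCyclicOrder C)
    (hc : Compatible I C) (t : Trans h l g) (c : C X Y Z) : C (g X) (g Y) (g Z) := by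
  obtain ⟨A, B, Al, Bl, rfl⟩ := t
  exact halfTurn_cyc h hC hc A (halfTurn_cyc h hC hc B c)

/-- A linear order describing separation, with an end of `l` on top, preserved by the products
of two half-turns about points of `l`. -/
theorem exists_trans_order (h : Axioms I) (i : RimInc I K l) : ∃ _ : LinearOrder (Rim I),
    (∀ X, X ≤ K) ∧ (∀ a b c d : Rim I, Sep I a b c d ↔ Alt a b c d) ∧
      ∀ g, Trans h l g → ∀ X Y, X < Y → g X < g Y := by
  obtain ⟨C, c1, c2⟩ := exists_cyclicOrder h
  obtain ⟨lo, top, h1, h2⟩ := exists_linearOrder c1 c2 K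
  refine ⟨lo, top, h2, fun g t X Y q => ?_⟩
  have fK := t.fix i
  by_cases e : Y = K
  · subst e
    rw [fK]
    exact (top _).lt_of_ne fun e => q.ne (g.injective (e.trans fK.symm))
  have := t.cyc c1 c2 ((h1 _ _ _).2 (Or.inl ⟨q, (top Y).lt_of_ne e⟩))
  rw [h1, fK] at this
  rcases this with ⟨q1, q2⟩ | ⟨q1, q2⟩ | ⟨q1, q2⟩
  · exact q1
  · exact (q2.not_ge (top _)).elim
  · exact (q1.not_ge (top _)).elim

/-- Translations preserve a linear order of the rim with an end of `l` on top, and an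
order-preserving involution has no moved points. -/
theorem Trans.eq_one_of_mul_self {h : Axioms I} (t : Trans h l g) (e : g * g = 1) : g = 1 := by
  obtain ⟨K, iK⟩ := Rim.exists_end h l
  obtain ⟨lo, -, -, mono⟩ := exists_trans_order h iK
  obtain ⟨X, nX⟩ := Rim.exists_notInc h l
  have e' : g (g X) = X := DFunLike.congr_fun e X
  refine t.eq_one nX ?_
  rcases lt_trichotomy (g X) X with q | q | q
  · have := mono g t _ _ q
    rw [e'] at this
    exact (lt_asymm q this).elim
  · exact q
  · have := mono g t _ _ q
    rw [e'] at this
    exact (lt_asymm q this).elim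

/-- `α` carries the half-turn about `V` to the half-turn about `W`. -/
def Conj (h : Axioms I) (α : Equiv.Perm (Rim I)) (V W : P) : Prop :=
  ∀ X, halfTurn h W (α X) = α (halfTurn h V X)

/-- `α` normalizes the set of half-turns. -/
def Aut (h : Axioms I) (α : Equiv.Perm (Rim I)) : Prop :=
  (∀ V, ∃ W, Conj h α V W) ∧ ∀ W, ∃ V, Conj h α V W

theorem conj_iff (h : Axioms I) : Conj h α V W ↔ halfTurn h W * α = α * halfTurn h V :=
  ⟨fun c => Equiv.ext c, fun e X => DFunLike.congr_fun e X⟩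

theorem Conj.mul {h : Axioms I} (c : Conj h α V W) (c' : Conj h β W T) : Conj h (β * α) V T :=
  fun X => by rw [Equiv.Perm.mul_apply, c', c]; rfl

theorem Aut.mul {h : Axioms I} (u : Aut h α) (u' : Aut h β) : Aut h (β * α) := by
  refine ⟨fun V => ?_, fun W => ?_⟩
  · obtain ⟨W, c⟩ := u.1 V
    obtain ⟨T, c'⟩ := u'.1 W
    exact ⟨T, c.mul c'⟩
  · obtain ⟨V, c⟩ := u'.2 W
    obtain ⟨T, c'⟩ := u.2 V
    exact ⟨T, c'.mul c⟩

theorem conj_halfTurn (h : Axioms I) (Al : I A l) (Vl : I V l) :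
    ∃ W, I W l ∧ Conj h (halfTurn h A) V W := by
  obtain ⟨W, Wl, e⟩ := exists_mul_three h Al Vl Al
  refine ⟨W, Wl, (conj_iff h).2 ?_⟩
  rw [← e, mul_assoc, halfTurn_mul_self, mul_one]

theorem conj_self (h : Axioms I) (A : P) : Conj h (halfTurn h A) A A := fun _ => rfl

theorem Conj.symm_halfTurn {h : Axioms I} (c : Conj h (halfTurn h A) V W) :
    Conj h (halfTurn h A) W V := fun X => by
  have := c (halfTurn h A X)
  rw [halfTurn_halfTurn] at this
  rw [this, halfTurn_halfTurn]

theorem aut_halfTurn (h : Axioms I) (A : P) : Aut h (halfTurn h A) := by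
  have key : ∀ V, ∃ W, Conj h (halfTurn h A) V W := fun V => by
    obtain ⟨l, Al, Vl⟩ := h.exists_line A V
    exact (conj_halfTurn h Al Vl).imp fun _ q => q.2
  exact ⟨key, fun V => (key V).imp fun _ c => c.symm_halfTurn⟩

theorem Conj.inj {h : Axioms I} (c : Conj h α V W) (c' : Conj h α V T) : W = T := by
  apply halfTurn_injective h
  ext1 X
  obtain ⟨Y, rfl⟩ := α.surjective X
  rw [c, c']

theorem Conj.mem {h : Axioms I} (c : Conj h α V W) (j : Join I X Y l) (j' : Join I (α X) (α Y) m) :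
    I W m ↔ I V l := by
  rw [mem_iff_halfTurn h j, mem_iff_halfTurn h j', c, α.injective.eq_iff]

end HypInc

/-! ### Midpoints and feet of perpendiculars. -/

namespace HypInc

universe u v

variable {P : Type u} {L : Type v} {I : P → L → Prop} {X Y Z K M N : Rim I} {a b l m k n : L}
  {A B R S T V W Q : P} {g g' α β : Equiv.Perm (Rim I)}

/-- The common parallels of (A10) meet at a point `T` of `AB` whose half-turn takes the ends of `l`
to those of `m`. It thus takes `A` to the point of `m` on `AB`, which is `B`. -/
theorem exists_midpoint (h : Axioms I) (nAB : A ≠ B) (An : I A n) (Bn : I B n) :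
    ∃ T, I T n ∧ Conj h (halfTurn h T) A B := by
  obtain ⟨n', l, m, An', Bn', Al, Bm, a, b, pal, pam, pbl, pbm, nab, T, Ta, Tb, Tn⟩ := h.A10 A B nAB
  obtain rfl := h.eq_line nAB An' Bn' An Bn
  refine ⟨T, Tn, ?_⟩
  rw [parallel_iff_rim h] at pal pam pbl pbm
  obtain ⟨nal, X, Xa, Xl⟩ := pal
  obtain ⟨nam, Y, Ya, Ym⟩ := pam
  obtain ⟨nbl, Z, Zb, Zl⟩ := pbl
  obtain ⟨nbm, N, Nb, Nm⟩ := pbm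
  have dis : ∀ {U}, RimInc I U a → ¬ RimInc I U b := fun i i' => Rim.miss h nab i i' ⟨T, Ta, Tb⟩
  have nln : l ≠ n' := by rintro rfl; exact Rim.miss h nal Xa Xl ⟨T, Ta, Tn⟩
  have nmn : m ≠ n' := by rintro rfl; exact Rim.miss h nam Ya Ym ⟨T, Ta, Tn⟩
  have jl : Join I X Z l := ⟨by rintro rfl; exact dis Xa Zb, Xl, Zl⟩
  have jm : Join I Y N m := ⟨by rintro rfl; exact dis Ya Nb, Ym, Nm⟩
  have off : ∀ {U k A}, I A k → I A n' → RimInc I U k → k ≠ n' → ¬ RimInc I U n' :=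
    fun q q' i n i' => n (Rim.line_unique h q i q' i')
  -- an ideal triangle is not cut on all three sides
  have tri : ∀ {x y z p q r}, Join I x y p → Join I y z q → Join I x z r → ¬ RimInc I x n' → ¬ RimInc I y n' →
      ¬ RimInc I z n' → Tch I p n' → Tch I q n' → Tch I r n' → False := by
    intro x y z p q r j1 j2 j3 n1 n2 n3 t1 t2 t3
    rw [rside_join h j1 n1 n2] at t1
    rw [rside_join h j2 n2 n3] at t2
    rw [rside_join h j3 n1 n3] at t3
    tauto
  have oX := off Al An' Xl nln
  have oZ := off Al An' Zl nln
  have oY := off Bm Bn' Ym nmn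
  have oN := off Bm Bn' Nm nmn
  have tl : Tch I l n' := ⟨A, Al, An'⟩
  have tm : Tch I m n' := ⟨B, Bm, Bn'⟩
  by_cases e1 : X = Y
  · subst e1
    have e2 : Z ≠ N := by
      rintro rfl
      have := Rim.join_unique h jl jm
      subst this
      exact nln (h.eq_line nAB Al Bm An' Bn')
    exact (tri jl ⟨e2, Zb, Nb⟩ jm oX oZ oN tl ⟨T, Tb, Tn⟩ tm).elim
  by_cases e2 : Z = N
  · subst e2
    exact (tri jl.symm ⟨e1, Xa, Ya⟩ jm.symm oZ oX oY tl ⟨T, Ta, Tn⟩ tm).elim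
  obtain ⟨W, Wn, c⟩ := conj_halfTurn h Tn An'
  have f1 := halfTurn_of_join h ⟨e1, Xa, Ya⟩ Ta
  have f2 := halfTurn_of_join h ⟨e2, Zb, Nb⟩ Tb
  have Wm : I W m := (c.mem jl (by rwa [f1, f2])).2 Al
  rwa [h.eq_pt nmn Bm Bn' Wm Wn]

/-- If `T` is the midpoint of `A` and `B`, then `AT = TB` as products of half-turns, so `(TB)(TB) =
AB`. -/
theorem Trans.exists_sqrt {h : Axioms I} (t : Trans h l g) : ∃ g', Trans h l g' ∧ g = g' * g' := by
  obtain ⟨A, B, Al, Bl, rfl⟩ := t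
  by_cases e : A = B
  · subst e
    exact ⟨_, Trans.mk h Al Al, by simp only [halfTurn_mul_self, mul_one]⟩
  obtain ⟨T, Tl, c⟩ := exists_midpoint h (Ne.symm e) Bl Al
  rw [conj_iff] at c
  refine ⟨_, Trans.mk h Tl Bl, ?_⟩
  rw [← mul_assoc, ← c, mul_assoc (halfTurn h A), halfTurn_mul_self, mul_one]

/-- `R` is the foot on `l` of the perpendicular from the rimpoint `X`. -/
def Foot (h : Axioms I) (l : L) (X : Rim I) (R : P) : Prop :=
  I R l ∧ ∀ g, Trans h l g → g ≠ 1 → ∃ K M T, Join I K M l ∧ halfTurn h T K = g X ∧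
    halfTurn h T M = g⁻¹ X ∧ halfTurn h T X = halfTurn h R X

/-- With `g` the product of the half-turns about `R` and `S`, the rimpoints `X ^ (S R)` and `X ^ (R
S)` of (A11) are `g X` and `g⁻¹ X`. The two common parallels join them to the ends of `l`. -/
theorem foot_iff (h : Axioms I) (nX : ¬ RimInc I X l) : Foot h l X R ↔ I R l ∧ ∀ S, I S l → S ≠ R →
      ∃ (Y Z Y' Z' : Rim I) (m n : L),
        Opp I S X Y ∧ Opp I R Y Z ∧ Opp I R X Y' ∧ Opp I S Y' Z' ∧
        Join I Z Z' m ∧ RimInc I X n ∧ I R n ∧ CommonParallelsMeetOn I l m n := by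
  refine and_congr_right fun Rl => ⟨fun F S Sl nSR => ?_, fun F g tg ng => ?_⟩
  · set g := halfTurn h R * halfTurn h S with hg
    have tg : Trans h l g := Trans.mk h Rl Sl
    have ng : g ≠ 1 := by
      intro e
      rw [hg, mul_eq_one_iff_eq_inv] at e
      exact nSR (halfTurn_injective h e).symm
    obtain ⟨K, M, T, j, e1, e2, e3⟩ := F g tg ng
    have nZ : g X ≠ g⁻¹ X := by rw [← e1, ← e2]; exact (halfTurn h T).injective.ne j.1
    have o1 := mt tg.inc_iff.1 nX
    have o2 := mt tg.inv.inc_iff.1 nX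
    obtain ⟨m, jm⟩ := Rim.exists_join h nZ
    obtain ⟨a, Ta, ja⟩ := (halfTurn_eq_iff h).1 e1
    obtain ⟨b, Tb, jb⟩ := (halfTurn_eq_iff h).1 e2
    obtain ⟨n, Rn, jn⟩ := opp_halfTurn h R X
    have nal : a ≠ l := by rintro rfl; exact o1 ja.2.2
    have nbl : b ≠ l := by rintro rfl; exact o2 jb.2.2
    have Km : ¬ RimInc I K m := fun i =>
      (Rim.eq_or h jm i).elim (fun e => o1 (e ▸ j.2.1)) (fun e => o2 (e ▸ j.2.1))
    have Mm : ¬ RimInc I M m := fun i =>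
      (Rim.eq_or h jm i).elim (fun e => o1 (e ▸ j.2.2)) (fun e => o2 (e ▸ j.2.2))
    have nam : a ≠ m := by rintro rfl; exact Km ja.2.1
    have nbm : b ≠ m := by rintro rfl; exact Mm jb.2.1
    have nab : a ≠ b := by
      rintro rfl
      exact nal (Rim.join_unique h ⟨j.1, ja.2.1, jb.2.1⟩ j)
    refine ⟨_, _, _, _, m, n, opp_halfTurn h S X, opp_halfTurn h R _, opp_halfTurn h R X,
      opp_halfTurn h S _, jm, jn.2.1, Rn, a, b, ?_⟩
    simp only [parallel_iff_rim h]
    exact ⟨⟨nal, K, ja.2.1, j.2.1⟩, ⟨nam, _, ja.2.2, jm.2.1⟩, ⟨nbl, M, jb.2.1, j.2.2⟩,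
      ⟨nbm, _, jb.2.2, jm.2.2⟩, nab, T, Ta, Tb, mem_of_halfTurn h jn e3⟩
  · obtain ⟨S, Sl, rfl⟩ := tg.eq_mul Rl
    have nSR : S ≠ R := by rintro rfl; exact ng (halfTurn_mul_self h S)
    obtain ⟨_, Z, _, Z', m, n, o1, o2, o3, o4, jm, iX, Rn, a, b, pal, pam, pbl, pbm, nab, T, Ta, Tb, Tn⟩ :=
      F S Sl nSR
    rw [← halfTurn_eq_iff h] at o1 o2 o3 o4
    subst o1 o2 o3 o4
    rw [parallel_iff_rim h] at pal pam pbl pbm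
    obtain ⟨nal, K, Ka, Kl⟩ := pal
    obtain ⟨nam, Y, Ya, Ym⟩ := pam
    obtain ⟨nbl, M, Mb, Ml⟩ := pbl
    obtain ⟨nbm, N, Nb, Nm⟩ := pbm
    have dis : ∀ {U}, RimInc I U a → ¬ RimInc I U b := fun i i' => Rim.miss h nab i i' ⟨T, Ta, Tb⟩
    have jl : Join I K M l := ⟨by rintro rfl; exact dis Ka Mb, Kl, Ml⟩
    have oZ := mt tg.inc_iff.1 nX
    have oZ' := mt tg.inv.inc_iff.1 nX
    have oY : ¬ RimInc I Y l := (Rim.eq_or h jm Ym).elim (fun e => e ▸ oZ) fun e => e ▸ oZ'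
    have oN : ¬ RimInc I N l := (Rim.eq_or h jm Nm).elim (fun e => e ▸ oZ) fun e => e ▸ oZ'
    have nYN : Y ≠ N := by rintro rfl; exact dis Ya Nb
    have e1 := halfTurn_of_join h (X := K) (Y := Y) ⟨by rintro rfl; exact oY Kl, Ka, Ya⟩ Ta
    have e2 := halfTurn_of_join h (X := M) (Y := N) ⟨by rintro rfl; exact oN Ml, Mb, Nb⟩ Tb
    have e3 : halfTurn h T X = halfTurn h R X := by
      obtain ⟨n', Rn', jn⟩ := opp_halfTurn h R X
      obtain rfl := Rim.line_unique h Rn iX Rn' jn.2.1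
      exact halfTurn_of_join h jn Tn
    rcases Rim.eq_or h jm Ym with e | e <;> rcases Rim.eq_or h jm Nm with e' | e'
    · exact (nYN (e.trans e'.symm)).elim
    · exact ⟨K, M, T, jl, e1.trans e, e2.trans e', e3⟩
    · exact ⟨M, K, T, jl.symm, e2.trans e', e1.trans e, e3⟩
    · exact (nYN (e.trans e'.symm)).elim

theorem existsUnique_foot (h : Axioms I) (nX : ¬ RimInc I X l) : ∃! R, Foot h l X R := by
  simp only [foot_iff h nX]
  exact h.A11 X l nX

theorem Foot.unique {h : Axioms I} (nX : ¬ RimInc I X l) (f : Foot h l X R) (f' : Foot h l X S) :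
    R = S := (existsUnique_foot h nX).unique f f'

/-- `Foot` speaks of half-turns and incidence of rimpoints only, so every permutation normalizing
the half-turns carries feet to feet. Later arguments combine this with uniqueness of the foot. -/
theorem Foot.map {h : Axioms I} (f : Foot h l X R) (u : Aut h α) (j : Join I K M l)
    (j' : Join I (α K) (α M) m) (c : Conj h α R S) : Foot h m (α X) S := by
  refine ⟨(c.mem j j').2 f.1, fun g tg ng => ?_⟩
  obtain ⟨A, B, Am, Bm, rfl⟩ := tg
  obtain ⟨A', cA⟩ := u.2 A
  obtain ⟨B', cB⟩ := u.2 B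
  have Al := (cA.mem j j').1 Am
  have Bl := (cB.mem j j').1 Bm
  have hA := (conj_iff h).1 cA
  have hB := (conj_iff h).1 cB
  obtain ⟨K', M', T, j1, e1, e2, e3⟩ := f.2 _ (Trans.mk h Al Bl) (by
    intro e
    apply ng
    have : A' = B' := halfTurn_injective h (by rwa [mul_eq_one_iff_eq_inv] at e)
    subst this
    rw [cA.inj cB, halfTurn_mul_self])
  obtain ⟨T', cT⟩ := u.1 T
  refine ⟨α K', α M', T', ?_, ?_, ?_, ?_⟩
  · refine ⟨α.injective.ne j1.1, ?_, ?_⟩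
    · rcases Rim.eq_or h j j1.2.1 with e | e <;> rw [e]
      exacts [j'.2.1, j'.2.2]
    · rcases Rim.eq_or h j j1.2.2 with e | e <;> rw [e]
      exacts [j'.2.1, j'.2.2]
  · rw [cT, e1, Equiv.Perm.mul_apply, Equiv.Perm.mul_apply, cB, cA]
  · rw [cT, e2, mul_inv_rev, mul_inv_rev]
    simp only [halfTurn_inv, Equiv.Perm.mul_apply]
    rw [cA, cB]
  · rw [cT, e3, c]

end HypInc

/-! ### Order-preserving axial maps are the nonidentity translations. -/

namespace HypInc

universe u v

variable {P : Type u} {L : Type v} {I : P → L → Prop} {X Y Z K M N : Rim I} {a b l m k n : L}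
  {A B R S T V W Q : P} {g g' α β : Equiv.Perm (Rim I)}

theorem halfTurn_eq_of_two (h : Axioms I) (n : X ≠ Y) (n' : halfTurn h S X ≠ Y)
    (e : halfTurn h S X = halfTurn h T X) (e' : halfTurn h S Y = halfTurn h T Y) : S = T := by
  obtain ⟨a, Sa, ja⟩ := opp_halfTurn h S X
  obtain ⟨b, Sb, jb⟩ := opp_halfTurn h S Y
  exact h.eq_pt (Rim.join_ne h ja jb n n') Sa Sb (mem_of_halfTurn h ja e.symm)
    (mem_of_halfTurn h jb e'.symm)

theorem halfTurn_not_crossed (h : Axioms I) (n : K ≠ M) (nX : X ≠ M) (nY : Y ≠ M)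
    (e1 : halfTurn h S K = X) (e2 : halfTurn h S M = Y) (e3 : halfTurn h T K = Y)
    (e4 : halfTurn h T M = X) : False := by
  have s1 : Sep I K X M Y := (sep_iff_halfTurn h).2 ⟨n, nX, S, e1, e2⟩
  have s2 : Sep I K Y M X := (sep_iff_halfTurn h).2 ⟨n, nY, T, e3, e4⟩
  exact s1.swap.flip.swap.not_sep h s2.swap.flip.swap

theorem oppositeSides_iff (h : Axioms I) :
    OppositeSides I l X Y ↔ ¬ RimInc I X l ∧ ¬ RimInc I Y l ∧ ¬ (rside I l X ↔ rside I l Y) := by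
  refine and_congr_right fun nX => and_congr_right fun nY => ⟨?_, fun s => ?_⟩
  · rintro ⟨m, j, -, t⟩
    exact (rside_join h j nX nY).1 t
  · obtain ⟨m, j⟩ := Rim.exists_join h (X := X) (Y := Y) (by rintro rfl; exact s Iff.rfl)
    exact ⟨m, j, fun e => nX (e ▸ j.2.1), (rside_join h j nX nY).2 s⟩

/-- For rimpoints `X`, `Y` on opposite sides, interchanged by the half-turn about `W`, the product
of `g` with that half-turn is a half-turn about a point of `l`; this is where `X (g Y)` and `Y (g
X)` meet. -/
theorem Trans.isAxial {h : Axioms I} (t : Trans h l g) (ng : g ≠ 1) : IsAxial I l g := by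
  have fixne : ∀ {X}, ¬ RimInc I X l → g X ≠ X := fun nX e => ng (t.eq_one nX e)
  have opp : ∀ {X Y}, ¬ RimInc I X l → ¬ RimInc I Y l → ¬ (rside I l X ↔ rside I l Y) →
      ∃ U, I U l ∧ halfTurn h U X = g Y ∧ halfTurn h U Y = g X := by
    intro X Y nX nY s
    obtain ⟨W, Wl, e⟩ := exists_halfTurn h nX nY s
    obtain ⟨U, Ul, eU⟩ := t.mul_halfTurn Wl
    exact ⟨U, Ul, by rw [← eU, Equiv.Perm.mul_apply, e],
      by rw [← eU, Equiv.Perm.mul_apply, (halfTurn_eq_comm h).1 e]⟩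
  refine ⟨ng, ?_, ?_, ?_⟩
  · obtain ⟨C, c1, c2⟩ := exists_cyclicOrder h
    refine ⟨C, c1, c2, fun X Y Z => ⟨t.cyc c1 c2, fun q => ?_⟩⟩
    simpa using t.inv.cyc c1 c2 q
  · intro X Y a b ja jb nab T Ta Tb
    have nXY : X ≠ Y := by
      rintro rfl
      exact nab (Rim.join_unique h ja jb)
    have nX : ¬ RimInc I X l := fun i => by
      rw [t.fix i] at jb
      exact Rim.miss h nab ja.2.1 jb.2.2 ⟨T, Ta, Tb⟩
    have nY : ¬ RimInc I Y l := fun i => by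
      rw [t.fix i] at ja
      exact Rim.miss h nab ja.2.2 jb.2.1 ⟨T, Ta, Tb⟩
    have e1 := halfTurn_of_join h ja Ta
    have e2 := halfTurn_of_join h jb Tb
    by_cases s : rside I l X ↔ rside I l Y
    -- On one side of `l`, write `Y = k X` with a translation `k`. Since `g` and `k` commute and
    -- preserve a linear order, the chords from `X` to `g (k X)` and from `k X` to `g X` cannot
    -- cross.
    · exfalso
      obtain ⟨K, iK⟩ := Rim.exists_end h l
      obtain ⟨lo, -, hS, mono⟩ := exists_trans_order h iK
      obtain ⟨k, tk, rfl⟩ := exists_trans h nX nY s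
      have sep : Sep I X (g (k X)) (k X) (g X) := (sep_iff_halfTurn h).2 ⟨nXY, fixne nY, T, e1, e2⟩
      rw [hS] at sep
      have comm : g (k X) = k (g X) := DFunLike.congr_fun (t.comm tk) X
      have m1 := mono g t X (k X)
      have m2 := mono g t (k X) X
      have m3 := mono k tk X (g X)
      have m4 := mono k tk (g X) X
      rw [← comm] at m3 m4
      have := fixne nX
      generalize g (k X) = U at *
      generalize k X = V at *
      generalize g X = W at *
      unfold Alt at sep
      rcases lt_or_gt_of_ne nXY with q | q <;> rcases lt_or_gt_of_ne this with q' | q' <;> grind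
    · obtain ⟨U, Ul, e3, e4⟩ := opp nX nY s
      rwa [halfTurn_eq_of_two h nXY (e1 ▸ fixne nY) (e1.trans e3.symm) (e2.trans e4.symm)]
  · intro X Y o
    obtain ⟨nX, nY, s⟩ := (oppositeSides_iff h).1 o
    obtain ⟨U, -, e3, e4⟩ := opp nX nY s
    obtain ⟨a, Ua, ja⟩ := (halfTurn_eq_iff h).1 e3
    obtain ⟨b, Ub, jb⟩ := (halfTurn_eq_iff h).1 e4
    exact ⟨a, b, ja, jb, Rim.join_ne h ja jb (by rintro rfl; exact s Iff.rfl) (fixne nY), U, Ua, Ub⟩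

/-- A translation `g` is made to agree with `α` on two rimpoints on opposite sides of `l`. The
crossing condition passes agreement from any rimpoint to all those on the other side, hence to
everything off `l`. -/
theorem IsAxial.trans (h : Axioms I) (ax : IsAxial I l α) : Trans h l α := by
  obtain ⟨-, ⟨C, c1, c2, c3⟩, ax3, ax4⟩ := ax
  have opp : ∀ {X Y}, ¬ RimInc I X l → ¬ RimInc I Y l → ¬ (rside I l X ↔ rside I l Y) →
      ∃ U, I U l ∧ halfTurn h U X = α Y ∧ halfTurn h U Y = α X := by
    intro X Y nX nY s
    obtain ⟨a, b, ja, jb, nab, U, Ua, Ub⟩ := ax4 X Y ((oppositeSides_iff h).2 ⟨nX, nY, s⟩)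
    exact ⟨U, ax3 X Y a b ja jb nab U Ua Ub, halfTurn_of_join h ja Ua, halfTurn_of_join h jb Ub⟩
  obtain ⟨X, nX⟩ := Rim.exists_notInc h l
  obtain ⟨V, Vl⟩ := h.A2 l
  have nY := mt (halfTurn_inc_iff h Vl).1 nX
  have sXY := rside_halfTurn h Vl nX
  have eY := halfTurn_halfTurn h V X
  set Y := halfTurn h V X with hY
  obtain ⟨T, Tl, e1, e2⟩ := opp nX nY sXY
  have tg := Trans.mk h Tl Vl
  set g := halfTurn h T * halfTurn h V with hg
  have gX : α X = g X := by rw [← e2, hg, Equiv.Perm.mul_apply]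
  have gY : α Y = g Y := by rw [← e1, hg, Equiv.Perm.mul_apply, eY]
  have step : ∀ {Y Z}, ¬ RimInc I Y l → ¬ RimInc I Z l → ¬ (rside I l Z ↔ rside I l Y) →
      α Y = g Y → α Z = g Z := by
    intro Y Z nY nZ s q
    obtain ⟨U, Ul, e1, e2⟩ := opp nZ nY s
    obtain ⟨W, Wl, e⟩ := exists_halfTurn h nZ nY s
    obtain ⟨U', Ul', eU⟩ := tg.mul_halfTurn Wl
    have : U' = U := eq_of_halfTurn h Ul' Ul nZ (by
      rw [← eU, e1, Equiv.Perm.mul_apply, e, q])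
    rw [← e2, ← this, ← eU, Equiv.Perm.mul_apply, (halfTurn_eq_comm h).1 e]
  have off : ∀ {Z}, ¬ RimInc I Z l → α Z = g Z := by
    intro Z nZ
    by_cases s : rside I l Z ↔ rside I l Y
    · exact step nX nZ (by tauto) gX
    · exact step nY nZ s gY
  have on : ∀ {K}, RimInc I K l → RimInc I (α K) l := by
    intro K i
    by_contra q
    obtain ⟨Z, hZ⟩ := g.surjective (α K)
    have nZ : ¬ RimInc I Z l := by rwa [← tg.inc_iff, hZ]
    exact nZ ((α.injective ((off nZ).trans hZ)) ▸ i)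
  obtain ⟨K, M, j⟩ := Rim.exists_ends h l
  -- Off `l` nothing prevents `α` from interchanging the ends of `l`; preservation of the cyclic
  -- order does.
  have fK : α K = K := by
    rcases Rim.eq_or h j (on j.2.1) with e | e
    · exact e
    exfalso
    have eM : α M = K := (Rim.eq_or h j (on j.2.2)).resolve_right
      fun e' => j.1 (α.injective (e.trans e'.symm))
    obtain ⟨lo, top, hC, hS⟩ := exists_linearOrder c1 c2 M
    have same : ¬ Sep I K M X (g X) := by
      rw [sep_iff h j nX (mt tg.inc_iff.1 nX), tg.rside_iff nX]
      exact fun q => q Iff.rfl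
    have q1 := (c3 K X M).1
    have q2 := (c3 K M X).1
    rw [hS] at same
    rw [e, eM, gX, hC, hC] at q1 q2
    have l1 : K < M := (top K).lt_of_ne j.1
    have l2 : X < M := (top X).lt_of_ne fun e => nX (e ▸ j.2.2)
    have l3 : g X < M := (top _).lt_of_ne fun e => mt tg.inc_iff.1 nX (e ▸ j.2.2)
    have l4 : X ≠ K := fun e => nX (e ▸ j.2.1)
    generalize g X = X' at *
    clear step off on opp ax3 ax4 c3 hC hS
    unfold Alt at same
    unfold Cyc at q1 q2
    rcases lt_or_gt_of_ne l4 with l4 | l4 <;> grind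
  have : α = g := by
    ext1 Z
    by_cases iZ : RimInc I Z l
    · rw [tg.fix iZ]
      rcases Rim.eq_or h j iZ with rfl | rfl
      · exact fK
      · exact (Rim.eq_or h j (on iZ)).resolve_left fun e => j.1 (α.injective (fK.trans e.symm))
    · exact off iZ
  rwa [this]

theorem isAxial_iff (h : Axioms I) : IsAxial I l α ↔ Trans h l α ∧ α ≠ 1 :=
  ⟨fun q => ⟨q.trans h, q.1⟩, fun q => q.1.isAxial q.2⟩

theorem exists_trans_ne_one (h : Axioms I) (l : L) : ∃ g, Trans h l g ∧ g ≠ 1 := by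
  obtain ⟨A, Al⟩ := h.A2 l
  obtain ⟨B, Bl, n⟩ := h.exists_pt_ne A l
  refine ⟨_, Trans.mk h Al Bl, fun e => n ?_⟩
  rw [mul_eq_one_iff_eq_inv] at e
  exact (halfTurn_injective h e).symm

end HypInc

/-! ### Reflections. -/

namespace HypInc

universe u v

variable {P : Type u} {L : Type v} {I : P → L → Prop} {X Y Z K M N : Rim I} {a b l m k n : L}
  {A B R S T V W Q : P} {g g' α β : Equiv.Perm (Rim I)}

theorem Conj.foot_halfTurn {h : Axioms I} (f : Foot h l X R) (Vl : I V l)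
    (c : Conj h (halfTurn h V) R S) : Foot h l (halfTurn h V X) S := by
  obtain ⟨K, M, j⟩ := Rim.exists_ends h l
  refine f.map (aut_halfTurn h V) j ?_ c
  rw [halfTurn_of_join h j Vl, halfTurn_of_join h j.symm Vl]
  exact j.symm

theorem exists_foot (h : Axioms I) (nX : ¬ RimInc I X l) : ∃ R, Foot h l X R :=
  (existsUnique_foot h nX).exists

open Classical in
/-- The value of the reflection in `l`. -/
noncomputable def reflectFun (h : Axioms I) (l : L) (X : Rim I) : Rim I :=
  if n : RimInc I X l then X else halfTurn h (exists_foot h n).choose X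

theorem reflectFun_inc (h : Axioms I) (i : RimInc I X l) : reflectFun h l X = X := dif_pos i

theorem reflectFun_foot (h : Axioms I) (n : ¬ RimInc I X l) (f : Foot h l X R) :
    reflectFun h l X = halfTurn h R X := by
  rw [reflectFun, dif_neg n, Foot.unique n (exists_foot h n).choose_spec f]

theorem reflectFun_reflectFun (h : Axioms I) (l : L) (X : Rim I) :
    reflectFun h l (reflectFun h l X) = X := by
  by_cases i : RimInc I X l
  · rw [reflectFun_inc h i, reflectFun_inc h i]
  obtain ⟨R, f⟩ := exists_foot h i
  have f' := Conj.foot_halfTurn f f.1 (conj_self h R)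
  rw [reflectFun_foot h i f, reflectFun_foot h (mt (halfTurn_inc_iff h f.1).1 i) f',
    halfTurn_halfTurn]

/-- The reflection in a line. -/
noncomputable def reflect (h : Axioms I) (l : L) : Equiv.Perm (Rim I) where
  toFun := reflectFun h l
  invFun := reflectFun h l
  left_inv := reflectFun_reflectFun h l
  right_inv := reflectFun_reflectFun h l

theorem reflect_inc (h : Axioms I) (i : RimInc I X l) : reflect h l X = X := reflectFun_inc h i

theorem reflect_foot (h : Axioms I) (n : ¬ RimInc I X l) (f : Foot h l X R) :
    reflect h l X = halfTurn h R X := reflectFun_foot h n f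

theorem reflect_mul_self (h : Axioms I) (l : L) : reflect h l * reflect h l = 1 :=
  Equiv.ext (reflectFun_reflectFun h l)

theorem reflect_reflect (h : Axioms I) (l : L) (X : Rim I) : reflect h l (reflect h l X) = X :=
  reflectFun_reflectFun h l X

theorem reflect_fixed_iff (h : Axioms I) : reflect h l X = X ↔ RimInc I X l := by
  refine ⟨fun e => ?_, reflect_inc h⟩
  by_contra n
  obtain ⟨R, f⟩ := exists_foot h n
  rw [reflect_foot h n f] at e
  exact halfTurn_ne h R X e

/-- The half-turn about `V` carries the foot of `X` to the foot of its image, by `Foot.map`. -/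
theorem reflect_halfTurn (h : Axioms I) (Vl : I V l) :
    reflect h l * halfTurn h V = halfTurn h V * reflect h l := by
  ext1 X
  rw [Equiv.Perm.mul_apply, Equiv.Perm.mul_apply]
  by_cases i : RimInc I X l
  · rw [reflect_inc h i, reflect_inc h (halfTurn_inc h Vl i)]
  obtain ⟨R, f⟩ := exists_foot h i
  obtain ⟨S, -, c⟩ := conj_halfTurn h Vl f.1
  rw [reflect_foot h i f, reflect_foot h (mt (halfTurn_inc_iff h Vl).1 i) (Conj.foot_halfTurn f Vl c), c]

theorem Trans.reflect_comm {h : Axioms I} (t : Trans h l g) :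
    reflect h l * g = g * reflect h l := by
  obtain ⟨A, B, Al, Bl, rfl⟩ := t
  rw [← mul_assoc, reflect_halfTurn h Al, mul_assoc, reflect_halfTurn h Bl, mul_assoc]

/-- A labelling that pairs the ends in the other way would make both pairings of the same four
rimpoints cross (`halfTurn_not_crossed`). -/
theorem IsBowtie.unique (h : Axioms I) (q : IsBowtie I l m S) (q' : IsBowtie I l m T) : S = T := by
  obtain ⟨np, K, M, X, Y, a, b, jl, jm, ja, jb, nab, Sa, Sb⟩ := q
  obtain ⟨-, K', M', X', Y', a', b', jl', jm', ja', jb', nab', Ta', Tb'⟩ := q'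
  have nlm : l ≠ m := by
    rintro rfl
    exact nab ((Rim.join_unique h ⟨ja.1, jl.2.1, jm.2.2⟩ ja).symm.trans
      (Rim.join_unique h ⟨jb.1, jl.2.2, jm.2.1⟩ jb))
  have dis : ∀ {U}, RimInc I U l → ¬ RimInc I U m := fun i i' =>
    np ((parallel_iff_rim h).2 ⟨nlm, _, i, i'⟩)
  have e1 := halfTurn_of_join h ja Sa
  have e2 := halfTurn_of_join h jb Sb
  have e3 := halfTurn_of_join h ja' Ta'
  have e4 := halfTurn_of_join h jb' Tb'
  have nYM : Y ≠ M := by rintro rfl; exact dis jl.2.2 jm.2.2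
  have nXM : X ≠ M := by rintro rfl; exact dis jl.2.2 jm.2.1
  have main : ∀ {U U'}, RimInc I U m → RimInc I U' m → U ≠ U' → halfTurn h T K = U →
      halfTurn h T M = U' → S = T := by
    intro U U' i i' n q q'
    rcases Rim.eq_or h jm i with rfl | rfl
    · have := (Rim.eq_or h jm i').resolve_left n.symm
      subst this
      exact (halfTurn_not_crossed h jl.1 nYM nXM e1 e2 q q').elim
    · have := (Rim.eq_or h jm i').resolve_right n.symm
      subst this
      exact halfTurn_eq_of_two h jl.1 (e1 ▸ nYM) (e1.trans q.symm) (e2.trans q'.symm)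
  rcases Rim.eq_or h jl jl'.2.1 with rfl | rfl
  · have := (Rim.eq_or h jl jl'.2.2).resolve_left jl'.1.symm
    subst this
    exact main jm'.2.2 jm'.2.1 jm'.1.symm e3 e4
  · have := (Rim.eq_or h jl jl'.2.2).resolve_right jl'.1.symm
    subst this
    exact main jm'.2.1 jm'.2.2 jm'.1 e4 e3

/-- The point `T` in the definition of `Foot` is the bowtie point for the axial map `g`. It need not
be the foot, but it lies on the same line through `X`, so both half-turns agree at `X`; this is why
the choice of the axial map does not matter. -/
theorem Foot.isBowtie {h : Axioms I} (nX : ¬ RimInc I X l) (f : Foot h l X R) (t : Trans h l g)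
    (ng : g ≠ 1) : ∃ m T, Join I (g X) (g⁻¹ X) m ∧ IsBowtie I l m T ∧
      halfTurn h T X = halfTurn h R X := by
  obtain ⟨K, M, T, j, e1, e2, e3⟩ := f.2 g t ng
  have n : g X ≠ g⁻¹ X := by rw [← e1, ← e2]; exact (halfTurn h T).injective.ne j.1
  have o1 := mt t.inc_iff.1 nX
  have o2 := mt t.inv.inc_iff.1 nX
  obtain ⟨m, jm⟩ := Rim.exists_join h n
  obtain ⟨a, Ta, ja⟩ := (halfTurn_eq_iff h).1 e1
  obtain ⟨b, Tb, jb⟩ := (halfTurn_eq_iff h).1 e2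
  refine ⟨m, T, jm, ⟨?_, K, M, _, _, a, b, j, jm.symm, ja, jb, ?_, Ta, Tb⟩, e3⟩
  · rw [parallel_iff_rim h]
    rintro ⟨-, U, i, i'⟩
    rcases Rim.eq_or h jm i' with rfl | rfl
    exacts [o1 i, o2 i]
  · rintro rfl
    have := Rim.join_unique h ⟨j.1, ja.2.1, jb.2.1⟩ j
    exact o1 (this ▸ ja.2.2)

theorem isReflection_iff (h : Axioms I) {σ : Equiv.Perm (Rim I)} :
    IsReflection I l σ ↔ σ = reflect h l := by
  constructor
  · rintro ⟨h1, ⟨α, ax⟩, h3⟩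
    ext1 X
    by_cases i : RimInc I X l
    · rw [h1 X i, reflect_inc h i]
    obtain ⟨R, f⟩ := exists_foot h i
    obtain ⟨t, nα⟩ := (isAxial_iff h).1 ax
    obtain ⟨m, T, jm, bw, o⟩ := h3 X i α ax
    obtain ⟨m', T', jm', bw', e⟩ := f.isBowtie i t nα
    obtain rfl := Rim.join_unique h jm jm'
    obtain rfl := bw.unique h bw'
    rw [reflect_foot h i f, ← e, eq_comm, halfTurn_eq_iff]
    exact o
  · rintro rfl
    obtain ⟨g, t, ng⟩ := exists_trans_ne_one h l
    refine ⟨fun X i => reflect_inc h i, ⟨g, t.isAxial ng⟩, fun X i α ax => ?_⟩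
    obtain ⟨t, nα⟩ := (isAxial_iff h).1 ax
    obtain ⟨R, f⟩ := exists_foot h i
    obtain ⟨m, T, jm, bw, e⟩ := f.isBowtie i t nα
    refine ⟨m, T, jm, bw, ?_⟩
    rw [← halfTurn_eq_iff h, e, reflect_foot h i f]

end HypInc

/-! ### Perpendiculars, and reflections as automorphisms. -/

namespace HypInc

universe u v

variable {P : Type u} {L : Type v} {I : P → L → Prop} {X Y Z K M N : Rim I} {a b l m k n : L}
  {A B R S T V W Q : P} {g g' α β : Equiv.Perm (Rim I)}

theorem Foot.other {h : Axioms I} (f : Foot h l X R) : Foot h l (halfTurn h R X) R :=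
  Conj.foot_halfTurn f f.1 (conj_self h R)

theorem Trans.inv_apply_ne {h : Axioms I} (t : Trans h l g) (n : ¬ RimInc I X l) (ng : g ≠ 1) :
    g X ≠ X := fun e => ng (t.eq_one n e)

/-- A point `T` of a perpendicular `n` to `m` in terms of the ends of `m`. -/
theorem Foot.exists_coord {h : Axioms I} (nX : ¬ RimInc I X m) (f : Foot h m X R)
    (jn : Join I X (halfTurn h R X) n) (jm : Join I K M m) (Tn : I T n) (nTR : T ≠ R) :
    ∃ Y g, Trans h m g ∧ (Y = X ∨ Y = halfTurn h R X) ∧ halfTurn h T K = g Y ∧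
      halfTurn h T M = g⁻¹ Y := by
  have Rn : I R n := mem_of_halfTurn h jn rfl
  have nnm : n ≠ m := by rintro rfl; exact nX jn.2.1
  have Tm : ¬ I T m := fun Tm => nTR (h.eq_pt nnm Tn Tm Rn f.1)
  have offn : ∀ {U}, RimInc I U m → ¬ RimInc I U n := fun i i' =>
    nnm (Rim.line_unique h Rn i' f.1 i)
  have nU : ¬ RimInc I (halfTurn h T K) m := by
    obtain ⟨c, Tc, jc⟩ := opp_halfTurn h T K
    intro i
    exact Tm (Rim.join_unique h jc ⟨jc.1, jm.2.1, i⟩ ▸ Tc)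
  obtain ⟨Y, hY, s⟩ : ∃ Y, (Y = X ∨ Y = halfTurn h R X) ∧
      (rside I m Y ↔ rside I m (halfTurn h T K)) := by
    have := rside_halfTurn h f.1 nX
    by_cases s : rside I m X ↔ rside I m (halfTurn h T K)
    · exact ⟨X, Or.inl rfl, s⟩
    · exact ⟨_, Or.inr rfl, by tauto⟩
  have nY : ¬ RimInc I Y m := by
    rcases hY with rfl | rfl
    exacts [nX, mt (halfTurn_inc_iff h f.1).1 nX]
  have jY : Join I Y (halfTurn h R Y) n := by
    rcases hY with rfl | rfl
    · exact jn
    · rw [halfTurn_halfTurn]; exact jn.symm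
  have fY : Foot h m Y R := by
    rcases hY with rfl | rfl
    exacts [f, f.other]
  have eT : halfTurn h T Y = halfTurn h R Y := halfTurn_of_join h jY Tn
  obtain ⟨g, tg, e⟩ := exists_trans h nY nU s
  have ng : g ≠ 1 := by
    rintro rfl
    have : halfTurn h T Y = K := (halfTurn_eq_comm h).1 e.symm
    exact offn jm.2.1 (by rw [← this, eT]; exact jY.2.2)
  obtain ⟨K', M', T', j', e1, e2, e3⟩ := fY.2 g tg ng
  have Tn' : I T' n := mem_of_halfTurn h jY e3
  rcases Rim.eq_or h jm j'.2.1 with rfl | rfl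
  · have := (Rim.eq_or h jm j'.2.2).resolve_left j'.1.symm
    subst this
    have := eq_of_halfTurn h Tn Tn' (offn jm.2.1) (e.symm.trans e1.symm)
    subst this
    exact ⟨Y, g, tg, hY, e1, e2⟩
  -- The opposite labelling would put `g Y` across the perpendicular from both ends of `m`, although
  -- the perpendicular separates these ends.
  · exfalso
    have neK : ∀ {U}, RimInc I U m → U ≠ Y := by rintro U i rfl; exact nY i
    have s1 : Sep I Y (halfTurn h R Y) K (g Y) :=
      ((sep_iff_halfTurn h).2 ⟨neK jm.2.1, e ▸ tg.inv_apply_ne nY ng, T, e.symm, eT⟩).swap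
    have s2 : Sep I Y (halfTurn h R Y) K' (g Y) :=
      ((sep_iff_halfTurn h).2 ⟨neK j'.2.1, tg.inv_apply_ne nY ng, T', e1, e3⟩).swap
    have s3 : Sep I Y (halfTurn h R Y) K K' :=
      ((sep_iff_halfTurn h).2 ⟨neK jm.2.1, neK jm.2.2, R, halfTurn_of_join h jm f.1, rfl⟩).swap
    exact (sepRel h).even _ _ _ _ _ s1 ((sepRel h).flip' s2) s3

/-- The reflection commutes with `g` and acts on `X` as the half-turn about `R`, which inverts `g`.
-/
theorem Foot.comm_trans {h : Axioms I} (nX : ¬ RimInc I X m) (f : Foot h m X R) (t : Trans h m g) :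
    halfTurn h R (reflect h m (g X)) = g⁻¹ X := by
  have e1 := DFunLike.congr_fun t.reflect_comm X
  have e2 := DFunLike.congr_fun (t.conj f.1) (halfTurn h R X)
  simp only [Equiv.Perm.mul_apply] at e1 e2
  rw [e1, reflect_foot h nX f, e2, halfTurn_halfTurn]

/-- By `exists_coord` the images of `K` and `M` under the half-turn about `T` have the form `g Y`
and `g⁻¹ Y`, where `Y` is an end of the perpendicular, so `comm_trans` applies. -/
theorem Foot.comm_end {h : Axioms I} (nX : ¬ RimInc I X m) (f : Foot h m X R)
    (jn : Join I X (halfTurn h R X) n) (jm : Join I K M m) (Tn : I T n) :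
    halfTurn h R (reflect h m (halfTurn h T K)) = halfTurn h T M := by
  by_cases e : T = R
  · subst e
    rw [halfTurn_of_join h jm f.1, reflect_inc h jm.2.2]
  obtain ⟨Y, g, tg, hY, e1, e2⟩ := f.exists_coord nX jn jm Tn e
  rw [e1, e2]
  rcases hY with rfl | rfl
  · exact f.comm_trans nX tg
  · exact f.other.comm_trans (mt (halfTurn_inc_iff h f.1).1 nX) tg

theorem Foot.exists_end_eq {h : Axioms I} (nX : ¬ RimInc I X m) (f : Foot h m X R)
    (jn : Join I X (halfTurn h R X) n) (nY : ¬ RimInc I Y n) :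
    ∃ K M g, Join I K M m ∧ Trans h n g ∧ Y = g K ∧
      ¬ (rside I n (g K) ↔ rside I n (g M)) := by
  have Rn : I R n := mem_of_halfTurn h jn rfl
  have nnm : n ≠ m := by rintro rfl; exact nX jn.2.1
  have offn : ∀ {U}, RimInc I U m → ¬ RimInc I U n := fun i i' =>
    nnm (Rim.line_unique h Rn i' f.1 i)
  obtain ⟨K, M, j⟩ := Rim.exists_ends h m
  have s := (rside_join h j (offn j.2.1) (offn j.2.2)).1 ⟨R, f.1, Rn⟩
  by_cases q : rside I n K ↔ rside I n Y
  · obtain ⟨g, t, e⟩ := exists_trans h (offn j.2.1) nY q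
    exact ⟨K, M, g, j, t, e.symm, by rwa [t.rside_iff (offn j.2.1), t.rside_iff (offn j.2.2)]⟩
  · obtain ⟨g, t, e⟩ := exists_trans h (offn j.2.2) nY (by tauto)
    exact ⟨M, K, g, j.symm, t, e.symm,
      by rw [t.rside_iff (offn j.2.1), t.rside_iff (offn j.2.2)]; tauto⟩

theorem Foot.comm_trans_end {h : Axioms I} (nX : ¬ RimInc I X m) (f : Foot h m X R)
    (jn : Join I X (halfTurn h R X) n) (jm : Join I K M m) (t : Trans h n g) :
    halfTurn h R (reflect h m (g K)) = g M := by
  obtain ⟨T, Tn, rfl⟩ := t.eq_mul (mem_of_halfTurn h jn rfl)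
  have := DFunLike.congr_fun (reflect_halfTurn h f.1) (halfTurn h T K)
  simp only [Equiv.Perm.mul_apply] at this ⊢
  rw [this, f.comm_end nX jn jm Tn]

/-- For a perpendicular `n` to `m` at `R`, the product of the half-turn about `R` and the
reflection in `m` commutes with the half-turns about the points of `n`. -/
theorem Foot.conj_self {h : Axioms I} (nX : ¬ RimInc I X m) (f : Foot h m X R)
    (jn : Join I X (halfTurn h R X) n) (Tn : I T n) :
    Conj h (halfTurn h R * reflect h m) T T := by
  intro Y
  simp only [Equiv.Perm.mul_apply]
  by_cases iY : RimInc I Y n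
  · have e1 : ∀ {Y}, RimInc I Y n → halfTurn h R (reflect h m Y) = Y := by
      intro Y iY
      rcases Rim.eq_or h jn iY with rfl | rfl
      · rw [reflect_foot h nX f, halfTurn_halfTurn]
      · rw [reflect_foot h (mt (halfTurn_inc_iff h f.1).1 nX) f.other, halfTurn_halfTurn]
    rw [e1 iY, e1 (halfTurn_inc h Tn iY)]
  -- Every rimpoint off `n` is the image of an end of `m` under a translation along `n`, and the map
  -- in question takes `g K` to `g M`.
  obtain ⟨K, M, g, jm, t, rfl, -⟩ := f.exists_end_eq nX jn iY
  rw [f.comm_trans_end nX jn jm t]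
  obtain ⟨W, Wn, e⟩ := t.halfTurn_mul Tn
  have e1 := DFunLike.congr_fun e K
  have e2 := DFunLike.congr_fun e M
  simp only [Equiv.Perm.mul_apply] at e1 e2
  rw [e1, e2, f.comm_end nX jn jm Wn]

/-- The lines from `T` to the ends of `m` have their other ends on one side of `m`. The rimpoint
halfway between these, found with the square root of the translation joining them, has its
perpendicular through `T`. -/
theorem exists_perp_of_notMem (h : Axioms I) (Tm : ¬ I T m) :
    ∃ X R, ¬ RimInc I X m ∧ Foot h m X R ∧ halfTurn h T X = halfTurn h R X := by
  obtain ⟨K, M, j⟩ := Rim.exists_ends h m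
  have off : ∀ {U}, RimInc I U m → ¬ RimInc I (halfTurn h T U) m ∧
      (rside I m (halfTurn h T U) ↔ side I m T) := by
    intro U i
    obtain ⟨c, Tc, jc⟩ := opp_halfTurn h T U
    have ncm : c ≠ m := by rintro rfl; exact Tm Tc
    have o : ¬ RimInc I (halfTurn h T U) m := fun i' =>
      ncm (Rim.join_unique h jc ⟨jc.1, i, i'⟩)
    exact ⟨o, rside_of_miss h (Rim.miss h ncm jc.2.1 i) jc.2.2 o Tc⟩
  obtain ⟨oK, sK⟩ := off j.2.1
  obtain ⟨oM, sM⟩ := off j.2.2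
  obtain ⟨b, tb, eb⟩ := exists_trans h oK oM (sK.trans sM.symm)
  obtain ⟨g, tg, rfl⟩ := tb.exists_sqrt
  set X := g (halfTurn h T K) with hX
  have oX : ¬ RimInc I X m := mt tg.inc_iff.1 oK
  have eM : g X = halfTurn h T M := eb
  have eK : g⁻¹ X = halfTurn h T K := g.symm_apply_apply _
  obtain ⟨R, f⟩ := exists_foot h oX
  have ng : g ≠ 1 := by
    rintro rfl
    exact j.1 ((halfTurn h T).injective (eK.symm.trans eM))
  obtain ⟨K', M', T', j', e1, e2, e3⟩ := f.2 g tg ng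
  rw [eM] at e1
  rw [eK] at e2
  refine ⟨X, R, oX, f, ?_⟩
  rcases Rim.eq_or h j j'.2.1 with rfl | rfl
  · have := (Rim.eq_or h j j'.2.2).resolve_left j'.1.symm
    subst this
    exact (halfTurn_not_crossed h j.1 (fun e => oM (e.symm ▸ j.2.2 : RimInc I _ m))
      (fun e => oK (e.symm ▸ j.2.2 : RimInc I _ m)) e1 e2 rfl rfl).elim
  · have := (Rim.eq_or h j j'.2.2).resolve_right j'.1.symm
    subst this
    rw [halfTurn_eq_of_two h j.1 (fun e => oK (e.symm ▸ j.2.2 : RimInc I _ m)) e2.symm e1.symm, e3]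

theorem Conj.of_halfTurn_mul {h : Axioms I} (c : Conj h (halfTurn h R * α) T T)
    (c' : Conj h (halfTurn h R) T W) : Conj h α T W := by
  rw [conj_iff] at *
  have e : α = halfTurn h R * (halfTurn h R * α) := by
    rw [← mul_assoc, halfTurn_mul_self, one_mul]
  rw [e, ← mul_assoc, c', mul_assoc, c]
  simp only [mul_assoc]

/-- For `T` off `m`, drop the perpendicular through `T`, with foot `R`. The half-turn about `R`
times the reflection fixes the half-turn about `T` under conjugation, so the reflection acts on it
as the half-turn about `R` does. -/
theorem aut_reflect (h : Axioms I) (m : L) : Aut h (reflect h m) := by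
  have key : ∀ T, ∃ W, Conj h (reflect h m) T W := by
    intro T
    by_cases Tm : I T m
    · exact ⟨T, (conj_iff h).2 (reflect_halfTurn h Tm).symm⟩
    obtain ⟨X, R, nX, f, e⟩ := exists_perp_of_notMem h Tm
    obtain ⟨n, Rn, jn⟩ := opp_halfTurn h R X
    obtain ⟨W, -, c⟩ := conj_halfTurn h Rn (mem_of_halfTurn h jn e)
    exact ⟨W, (f.conj_self nX jn (mem_of_halfTurn h jn e)).of_halfTurn_mul c⟩
  refine ⟨key, fun W => (key W).imp fun V c X => ?_⟩
  have := c (reflect h m X)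
  rw [reflect_reflect] at this
  rw [this, reflect_reflect]

/-- A translation taking `X` to `Y` would preserve the common foot and so commute with its
half-turn, which also inverts it. Being its own inverse, it is the identity. -/
theorem Foot.injective {h : Axioms I} (nX : ¬ RimInc I X l) (nY : ¬ RimInc I Y l)
    (s : rside I l X ↔ rside I l Y) (f : Foot h l X R) (f' : Foot h l Y R) : X = Y := by
  obtain ⟨g, tg, rfl⟩ := exists_trans h nX nY s
  obtain ⟨A, B, Al, Bl, rfl⟩ := tg
  obtain ⟨S, Sl, c⟩ := conj_halfTurn h Bl f.1
  obtain ⟨T, Tl, c'⟩ := conj_halfTurn h Al Sl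
  have := Foot.unique nY ((Conj.foot_halfTurn (Conj.foot_halfTurn f Bl c) Al c')) f'
  subst this
  have tg := Trans.mk h Al Bl
  have e := (conj_iff h).1 (c.mul c')
  rw [tg.conj Tl] at e
  have := tg.eq_one_of_mul_self (mul_eq_one_iff_inv_eq.2 (mul_right_cancel e))
  rw [this, Equiv.Perm.one_apply]

/-- The right-hand side fixes the ends of `n`, exchanges its sides and, as an automorphism commuting
with the half-turns about points of `n`, preserves feet on `n`. By `Foot.injective` it can only be
the reflection. -/
theorem Foot.reflect_eq {h : Axioms I} (nX : ¬ RimInc I X m) (f : Foot h m X R)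
    (jn : Join I X (halfTurn h R X) n) :
    reflect h n = halfTurn h R * reflect h m := by
  have e1 : (halfTurn h R * reflect h m) X = X := by
    rw [Equiv.Perm.mul_apply, reflect_foot h nX f, halfTurn_halfTurn]
  have e2 : (halfTurn h R * reflect h m) (halfTurn h R X) = halfTurn h R X := by
    rw [Equiv.Perm.mul_apply, reflect_foot h (mt (halfTurn_inc_iff h f.1).1 nX) f.other,
      halfTurn_halfTurn]
  have u := (aut_reflect h m).mul (aut_halfTurn h R)
  have c : ∀ {T}, I T n → Conj h (halfTurn h R * reflect h m) T T := f.conj_self nX jn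
  have opp : ∀ {Y}, ¬ RimInc I Y n → ¬ RimInc I ((halfTurn h R * reflect h m) Y) n ∧
      ¬ (rside I n Y ↔ rside I n ((halfTurn h R * reflect h m) Y)) := by
    intro Y nY
    obtain ⟨K, M, g, jm, t, rfl, s⟩ := f.exists_end_eq nX jn nY
    rw [Equiv.Perm.mul_apply, f.comm_trans_end nX jn jm t, t.inc_iff]
    have nnm : n ≠ m := by rintro rfl; exact nX jn.2.1
    exact ⟨fun i => nnm (Rim.line_unique h (mem_of_halfTurn h jn rfl) i f.1 jm.2.2), s⟩
  generalize halfTurn h R * reflect h m = ρ at *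
  ext1 Y
  by_cases iY : RimInc I Y n
  · rw [reflect_inc h iY]
    rcases Rim.eq_or h jn iY with rfl | rfl
    exacts [e1.symm, e2.symm]
  obtain ⟨S, fS⟩ := exists_foot h iY
  obtain ⟨nρ, s⟩ := opp iY
  have fρ : Foot h n (ρ Y) S := fS.map u jn (by rwa [e1, e2]) (c fS.1)
  have sρ := rside_halfTurn h fS.1 nρ
  rw [reflect_foot h iY fS]
  have := fρ.other.injective (mt (halfTurn_inc_iff h fS.1).1 nρ) iY (by tauto) fS
  exact (halfTurn_eq_comm h).1 this

end HypInc

/-! ### The abstract oval and its secant lines. -/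

namespace HypInc

universe u v

variable {P : Type u} {L : Type v} {I : P → L → Prop} {X Y Z K M N : Rim I} {a b l m k n : L}
  {A B R S T V W Q : P} {g α β σ τ : Equiv.Perm (Rim I)} {A₁ A₂ B₁ B₂ : Rim I}

/-- A half-turn about a midpoint moves any given foot on `m` to `R`. -/
theorem exists_foot_eq (h : Axioms I) (Rm : I R m) : ∃ X, ¬ RimInc I X m ∧ Foot h m X R := by
  obtain ⟨X, nX⟩ := Rim.exists_notInc h m
  obtain ⟨S, f⟩ := exists_foot h nX
  by_cases e : S = R
  · subst e; exact ⟨X, nX, f⟩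
  obtain ⟨T, Tm, c⟩ := exists_midpoint h e f.1 Rm
  exact ⟨_, mt (halfTurn_inc_iff h Tm).1 nX, Conj.foot_halfTurn f Tm c⟩

/-- The reflection in the perpendicular to `m` at `R`. -/
theorem exists_perp (h : Axioms I) (Rm : I R m) :
    ∃ n, reflect h n = halfTurn h R * reflect h m := by
  obtain ⟨X, nX, f⟩ := exists_foot_eq h Rm
  obtain ⟨n, -, jn⟩ := opp_halfTurn h R X
  exact ⟨n, f.reflect_eq nX jn⟩

theorem mem_halfTurnsAndReflections (h : Axioms I) : σ ∈ halfTurnsAndReflections I ↔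
    (∃ A, σ = halfTurn h A) ∨ ∃ l, σ = reflect h l := by
  simp only [halfTurnsAndReflections, Set.mem_ofPred_eq, isHalfTurn_iff h, isReflection_iff h]

theorem halfTurn_mem (h : Axioms I) (A : P) : halfTurn h A ∈ halfTurnsAndReflections I :=
  (mem_halfTurnsAndReflections h).2 (Or.inl ⟨A, rfl⟩)

theorem reflect_mem (h : Axioms I) (l : L) : reflect h l ∈ halfTurnsAndReflections I :=
  (mem_halfTurnsAndReflections h).2 (Or.inr ⟨l, rfl⟩)

theorem mul_self_of_mem (h : Axioms I) (s : σ ∈ halfTurnsAndReflections I) : σ * σ = 1 := by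
  obtain ⟨A, rfl⟩ | ⟨l, rfl⟩ := (mem_halfTurnsAndReflections h).1 s
  exacts [halfTurn_mul_self h A, reflect_mul_self h l]

theorem eq_reflect_of_fixed (h : Axioms I) (s : σ ∈ halfTurnsAndReflections I) (e : σ X = X) :
    ∃ l, σ = reflect h l ∧ RimInc I X l := by
  obtain ⟨A, rfl⟩ | ⟨l, rfl⟩ := (mem_halfTurnsAndReflections h).1 s
  · exact (halfTurn_ne h A X e).elim
  · exact ⟨l, rfl, (reflect_fixed_iff h).1 e⟩

/-- A reflection that interchanges the ends of `m`. -/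
theorem reflect_eq_of_swap (h : Axioms I) (j : Join I X Y m) (e : reflect h l X = Y) :
    ∃ R, I R l ∧ I R m ∧ reflect h l = halfTurn h R * reflect h m := by
  have nX : ¬ RimInc I X l := fun i => j.1 ((reflect_inc h i).symm.trans e)
  obtain ⟨R, f⟩ := exists_foot h nX
  have e' : halfTurn h R X = Y := (reflect_foot h nX f).symm.trans e
  refine ⟨R, f.1, mem_of_halfTurn h j e', ?_⟩
  have j' : Join I X (halfTurn h R X) m := by rwa [e']
  rw [f.reflect_eq nX j', ← mul_assoc, halfTurn_mul_self, one_mul]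

/-- The reflection in the perpendicular from `X` to `B₁B₂` interchanges the ends of that line. -/
theorem exists_mem_fixing (h : Axioms I) (n₁ : X ≠ B₁) (n₂ : X ≠ B₂) :
    ∃ s ∈ halfTurnsAndReflections I, s X = X ∧ s B₁ = B₂ := by
  by_cases e : B₁ = B₂
  · subst e
    obtain ⟨l, j⟩ := Rim.exists_join h n₁
    exact ⟨_, reflect_mem h l, reflect_inc h j.2.1, reflect_inc h j.2.2⟩
  obtain ⟨b, j⟩ := Rim.exists_join h e
  have nX : ¬ RimInc I X b := fun i => (Rim.eq_or h j i).elim n₁ n₂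
  obtain ⟨R, f⟩ := exists_foot h nX
  obtain ⟨n, -, jn⟩ := opp_halfTurn h R X
  refine ⟨_, reflect_mem h n, reflect_inc h jn.2.1, ?_⟩
  rw [f.reflect_eq nX jn, Equiv.Perm.mul_apply, reflect_inc h j.2.1, halfTurn_of_join h j f.1]

/-- The axis is the perpendicular from `T` to `A₁A₂`: its reflection interchanges `A₁` and `A₂` and
commutes with the half-turn about `T`, so it also interchanges their images. -/
theorem exists_mem_swap (h : Axioms I) (j : Join I A₁ A₂ a) (n : halfTurn h T A₁ ≠ A₂) :
    ∃ s ∈ halfTurnsAndReflections I, s A₁ = A₂ ∧ s (halfTurn h T A₁) = halfTurn h T A₂ := by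
  obtain ⟨X, R, nX, f, e⟩ := exists_perp_of_notMem h (mt (halfTurn_of_join h j) n)
  obtain ⟨n, Rn, jn⟩ := opp_halfTurn h R X
  have e1 : reflect h n A₁ = A₂ := by
    rw [f.reflect_eq nX jn, Equiv.Perm.mul_apply, reflect_inc h j.2.1, halfTurn_of_join h j f.1]
  refine ⟨_, reflect_mem h n, e1, ?_⟩
  rw [← Equiv.Perm.mul_apply, reflect_halfTurn h (mem_of_halfTurn h jn e), Equiv.Perm.mul_apply, e1]

theorem exists_mem_map (h : Axioms I) (n₁ : A₁ ≠ B₁) (n₂ : A₁ ≠ B₂) (n₃ : A₂ ≠ B₁) (n₄ : A₂ ≠ B₂) :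
    ∃ s ∈ halfTurnsAndReflections I, s A₁ = A₂ ∧ s B₁ = B₂ := by
  by_cases eA : A₁ = A₂
  · subst eA
    exact exists_mem_fixing h n₁ n₂
  by_cases eB : B₁ = B₂
  · subst eB
    obtain ⟨s, hs, e1, e2⟩ := exists_mem_fixing h n₁.symm n₃.symm
    exact ⟨s, hs, e2, e1⟩
  obtain ⟨a, j⟩ := Rim.exists_join h eA
  -- If `A₁A₂` and `B₁B₂` cross, a half-turn serves. Otherwise `A₁`, `A₂` are joined to `B₁`, `B₂`
  -- in some order by lines crossing at `T`, and the reflection of `exists_mem_swap` serves.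
  rcases sep_some h eA n₁ n₂ n₃ n₄ eB with s | s | s <;>
    obtain ⟨-, -, T, e1, e2⟩ := (sep_iff_halfTurn h).1 s
  · exact ⟨_, halfTurn_mem h T, e1, e2⟩
  · obtain ⟨s, hs, q, q'⟩ := exists_mem_swap h (T := T) j (e1 ▸ n₃.symm)
    exact ⟨s, hs, q, by rwa [e1, e2] at q'⟩
  · obtain ⟨s, hs, q, q'⟩ := exists_mem_swap h (T := T) j (e1 ▸ n₄.symm)
    refine ⟨s, hs, q, ?_⟩
    rw [e1, e2] at q'
    rw [← q']
    exact DFunLike.congr_fun (mul_self_of_mem h hs) B₂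

/-- The lines `A₁A₂` and `B₁B₂` would be perpendicular to `l` at points `R`, `S` and both pass
through `V`. The translation `RS` is the product of their reflections, so it commutes with the
half-turn about `V`; this puts `V` on `l`, where that half-turn also inverts `RS`, and so `RS = 1`.
-/
theorem halfTurn_ne_reflect (h : Axioms I) (nA : A₁ ≠ A₂) (n₁ : A₁ ≠ B₁) (n₃ : A₂ ≠ B₁)
    (e1 : halfTurn h V A₁ = A₂) (e2 : halfTurn h V B₁ = B₂) (e3 : reflect h l A₁ = A₂)
    (e4 : reflect h l B₁ = B₂) : False := by
  obtain ⟨a, ja⟩ := Rim.exists_join h nA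
  obtain ⟨b, jb⟩ := Rim.exists_join h (e2 ▸ (halfTurn_ne h V B₁).symm : B₁ ≠ B₂)
  have Va := mem_of_halfTurn h ja e1
  have Vb := mem_of_halfTurn h jb e2
  obtain ⟨R, Rl, Ra, ea⟩ := reflect_eq_of_swap h ja e3
  obtain ⟨S, Sl, Sb, eb⟩ := reflect_eq_of_swap h jb e4
  have ea' : reflect h a = halfTurn h R * reflect h l := by
    rw [ea, ← mul_assoc, halfTurn_mul_self, one_mul]
  have eb' : reflect h b = halfTurn h S * reflect h l := by
    rw [eb, ← mul_assoc, halfTurn_mul_self, one_mul]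
  have nRS : R ≠ S := by
    rintro rfl
    have f : reflect h b A₁ = A₁ := by rw [eb', ← ea', reflect_inc h ja.2.1]
    rcases Rim.eq_or h jb ((reflect_fixed_iff h).1 f) with q | q
    · exact n₁ q
    · subst q
      exact n₃ (e1.symm.trans ((halfTurn_eq_comm h).1 e2))
  have tg := Trans.mk h Rl Sl
  have eg : halfTurn h R * halfTurn h S = reflect h a * reflect h b := by
    rw [ea', eb', ← reflect_halfTurn h Sl, mul_assoc, ← mul_assoc (reflect h l), reflect_mul_self,
      one_mul]
  have comm : halfTurn h V * (halfTurn h R * halfTurn h S) =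
      halfTurn h R * halfTurn h S * halfTurn h V := by
    rw [eg, ← mul_assoc, ← reflect_halfTurn h Va, mul_assoc, ← reflect_halfTurn h Vb, mul_assoc]
  have ng : halfTurn h R * halfTurn h S ≠ 1 := fun e => by
    rw [mul_eq_one_iff_eq_inv] at e
    exact nRS (halfTurn_injective h e)
  obtain ⟨K, iK⟩ := Rim.exists_end h l
  have fK : (halfTurn h R * halfTurn h S) (halfTurn h V K) = halfTurn h V K := by
    rw [← Equiv.Perm.mul_apply, ← comm, Equiv.Perm.mul_apply, tg.fix iK]
  have iK' : RimInc I (halfTurn h V K) l := by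
    by_contra n
    exact ng (tg.eq_one n fK)
  have Vl : I V l := mem_of_halfTurn h ⟨(halfTurn_ne h V K).symm, iK, iK'⟩ rfl
  rw [tg.conj Vl] at comm
  exact ng (tg.eq_one_of_mul_self (mul_eq_one_iff_inv_eq.2 (mul_right_cancel comm)))

theorem eq_of_agree (h : Axioms I) (s : σ ∈ halfTurnsAndReflections I)
    (t : τ ∈ halfTurnsAndReflections I) (nA : A₁ ≠ A₂) (n₁ : A₁ ≠ B₁) (n₃ : A₂ ≠ B₁)
    (e1 : σ A₁ = A₂) (e2 : σ B₁ = B₂) (e3 : τ A₁ = A₂) (e4 : τ B₁ = B₂) : σ = τ := by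
  obtain ⟨V, rfl⟩ | ⟨l, rfl⟩ := (mem_halfTurnsAndReflections h).1 s <;>
    obtain ⟨W, rfl⟩ | ⟨m, rfl⟩ := (mem_halfTurnsAndReflections h).1 t
  · rw [halfTurn_eq_of_two h n₁ (e1 ▸ n₃) (e1.trans e3.symm) (e2.trans e4.symm)]
  · exact (halfTurn_ne_reflect h nA n₁ n₃ e1 e2 e3 e4).elim
  · exact (halfTurn_ne_reflect h nA n₁ n₃ e3 e4 e1 e2).elim
  -- Two reflections interchanging the ends of `a` are products of `reflect a` with half-turns about
  -- points of `a`. Their agreement at `B₁` makes the two centres equal.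
  · obtain ⟨a, ja⟩ := Rim.exists_join h nA
    obtain ⟨R, -, Ra, ea⟩ := reflect_eq_of_swap h ja e1
    obtain ⟨S, -, Sa, eb⟩ := reflect_eq_of_swap h ja e3
    have nB : ¬ RimInc I (reflect h a B₁) a := fun i => by
      have q := reflect_inc h i
      rw [reflect_reflect] at q
      rw [← q] at i
      exact (Rim.eq_or h ja i).elim n₁.symm n₃.symm
    rw [ea, eb, eq_of_halfTurn h Ra Sa nB]
    rw [← Equiv.Perm.mul_apply, ← Equiv.Perm.mul_apply, ← ea, ← eb, e2, e4]

theorem isAbstractOval (h : Axioms I) : IsAbstractOval (halfTurnsAndReflections I) where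
  card := by
    classical
    obtain ⟨O, -⟩ := h.A3.1
    obtain ⟨l, -⟩ := h.exists_line O O
    obtain ⟨K, M, j⟩ := Rim.exists_ends h l
    obtain ⟨X, nX⟩ := Rim.exists_notInc h l
    have c : ({K, M, X} : Finset (Rim I)).card = 3 :=
      Finset.card_eq_three.2 ⟨K, M, X, j.1, fun e => nX (e ▸ j.2.1), fun e => nX (e ▸ j.2.2), rfl⟩
    have := Cardinal.mk_set_le (({K, M, X} : Finset (Rim I)) : Set (Rim I))
    rw [Finset.coe_sort_coe, Cardinal.mk_coe_finset, c] at this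
    exact_mod_cast this
  invol _ s := mul_self_of_mem h s
  existsUnique A₁ A₂ B₁ B₂ dis := by
    have ne : ∀ {U V}, U ∈ ({A₁, A₂} : Set (Rim I)) → V ∈ ({B₁, B₂} : Set (Rim I)) → U ≠ V := by
      rintro U V hU hV rfl
      exact (Set.ext_iff.1 dis U).1 ⟨hU, hV⟩
    have n₁ : A₁ ≠ B₁ := ne (by simp) (by simp)
    have n₂ : A₁ ≠ B₂ := ne (by simp) (by simp)
    have n₃ : A₂ ≠ B₁ := ne (by simp) (by simp)
    have n₄ : A₂ ≠ B₂ := ne (by simp) (by simp)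
    obtain ⟨s, hs, e1, e2⟩ := exists_mem_map h n₁ n₂ n₃ n₄
    refine ⟨s, ⟨hs, e1, e2⟩, ?_⟩
    rintro t ⟨ht, e3, e4⟩
    by_cases eA : A₁ = A₂
    swap
    · exact eq_of_agree h ht hs eA n₁ n₃ e3 e4 e1 e2
    by_cases eB : B₁ = B₂
    swap
    · exact eq_of_agree h ht hs eB n₁.symm n₂.symm e4 e3 e2 e1
    subst eA eB
    obtain ⟨l, rfl, i⟩ := eq_reflect_of_fixed h hs e1
    obtain ⟨m, rfl, i'⟩ := eq_reflect_of_fixed h ht e3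
    rw [Rim.join_unique h ⟨n₁, i, (reflect_fixed_iff h).1 e2⟩ ⟨n₁, i', (reflect_fixed_iff h).1 e4⟩]

theorem isPascalian_ovalLine (h : Axioms I) (n : X ≠ Y) :
    IsPascalian (halfTurnsAndReflections I) (ovalLine (halfTurnsAndReflections I) X Y) := by
  obtain ⟨m, j⟩ := Rim.exists_join h n
  have mem : ∀ s : halfTurnsAndReflections I,
      Sum.inr s ∈ ovalLine (halfTurnsAndReflections I) X Y ↔ (s : Equiv.Perm (Rim I)) X = Y := by
    intro s
    simp [ovalLine]
  -- The exponent `e` records whether the element is a half-turn or a reflection in a perpendicular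
  -- to `m`. As `reflect h m` is an involution commuting with the half-turns about points of `m`,
  -- products of three reduce to products of three half-turns times a power of it.
  have form : ∀ s : halfTurnsAndReflections I, (s : Equiv.Perm (Rim I)) X = Y →
      ∃ R e, I R m ∧ (s : Equiv.Perm (Rim I)) = halfTurn h R * reflect h m ^ e := by
    rintro ⟨s, hs⟩ e
    obtain ⟨R, rfl⟩ | ⟨l, rfl⟩ := (mem_halfTurnsAndReflections h).1 hs
    · exact ⟨R, 0, mem_of_halfTurn h j e, by simp⟩
    · obtain ⟨R, -, Rm, q⟩ := reflect_eq_of_swap h j e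
      exact ⟨R, 1, Rm, by rw [pow_one]; exact q⟩
  have comm : ∀ {R} (e : ℕ), I R m → reflect h m ^ e * halfTurn h R = halfTurn h R * reflect h m ^ e :=
    fun e Rm => Commute.pow_left (reflect_halfTurn h Rm) e
  have back : ∀ {R} (e : ℕ), I R m → halfTurn h R * reflect h m ^ e ∈ halfTurnsAndReflections I := by
    intro R e Rm
    rcases Nat.even_or_odd' e with ⟨d, rfl | rfl⟩
    · rw [pow_mul, pow_two, reflect_mul_self, one_pow, mul_one]
      exact halfTurn_mem h R
    · rw [pow_succ, pow_mul, pow_two, reflect_mul_self, one_pow, one_mul]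
      obtain ⟨n, e⟩ := exists_perp h Rm
      rw [← e]
      exact reflect_mem h n
  intro s t w hs ht hw
  rw [mem] at hs ht hw
  obtain ⟨A, d, Am, es⟩ := form s hs
  obtain ⟨B, e, Bm, et⟩ := form t ht
  obtain ⟨C, f, Cm, ew⟩ := form w hw
  obtain ⟨R, Rm, eR⟩ := exists_mul_three h Am Bm Cm
  have prod : (s * t * w : Equiv.Perm (Rim I)) = halfTurn h R * reflect h m ^ (d + e + f) := by
    rw [es, et, ew, ← eR, pow_add, pow_add, mul_assoc (halfTurn h A), ← mul_assoc (reflect h m ^ d),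
      comm d Bm]
    simp only [mul_assoc]
    rw [← mul_assoc (reflect h m ^ e), comm e Cm, mul_assoc, ← mul_assoc (reflect h m ^ d), comm d Cm]
    simp only [mul_assoc]
  have fix : ∀ e : ℕ, (reflect h m ^ e) X = X := by
    intro e
    induction e with
    | zero => rfl
    | succ e ih => rw [pow_succ, Equiv.Perm.mul_apply, reflect_inc h j.2.1, ih]
  refine ⟨⟨_, back (d + e + f) Rm⟩, prod.symm, (mem _).2 ?_⟩
  rw [Equiv.Perm.mul_apply, fix, halfTurn_of_join h j Rm]

end HypInc

theorem mainTheorem3 {P L : Type*} (I : P → L → Prop)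
    (hI : HypInc.Axioms I) :
    (∀ A : P, ∃! σ, HypInc.IsHalfTurn I A σ) ∧
    (∀ l : L, ∃! σ, HypInc.IsReflection I l σ) ∧
    HypInc.IsAbstractOval (HypInc.halfTurnsAndReflections I) ∧
    ∀ X Y : HypInc.Rim I, X ≠ Y →
      HypInc.IsPascalian (HypInc.halfTurnsAndReflections I)
        (HypInc.ovalLine (HypInc.halfTurnsAndReflections I) X Y) :=
  ⟨fun A => ⟨_, HypInc.isHalfTurn_halfTurn hI A, fun _ q => (HypInc.isHalfTurn_iff hI).1 q⟩,
    fun _ => ⟨_, (HypInc.isReflection_iff hI).2 rfl, fun _ q => (HypInc.isReflection_iff hI).1 q⟩,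
    HypInc.isAbstractOval hI, fun _ _ n => HypInc.isPascalian_ovalLine hI n⟩
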